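/- **Trees.** Fix $d\ge 0$, a set of kernels $K$ with regularities $\beta_k\in\mathbb R$ and a set of noises $\Xi$ with path regularities $\alpha_\xi\in\mathbb R$. $\mathfrak T$ is spanned by the planar rooted trees whose vertices $v$ carry a decoration $n_v\in\mathbb N^d$ and whose edges carry a type in $K\cup\Xi$ (kernel or noise edge) and a decoration in $\mathbb N^d$, such that every vertex has at most one outgoing noise edge and a noise vertex (the upper end of a noise edge) has no outgoing edges. For a multi-index $|n|=\sum_i n_i$, $n!=\prod_i n_i!$. The regularity $|\tau|$ is the sum of $|n_v|$ over all vertices, of $\beta_k-|e|$ over all kernel edges of type $k$ and decoration $e$, and of $\alpha_\xi-1-|e|$ over all noise edges. $\mathfrak T^-$ is spanned by the trees with $|\tau|<0$, and $S(\mathfrak T^-)$ is the free commutative algebra on $\mathfrak T^-$. $\mathfrak T_{ex}$ is spanned by trees as above whose vertices carry in addition an extended decoration in $\mathbb R$ (in particular in the set of regularities); $|\tau|_+$ is the regularity plus the sum of all extended decorations. $\mathfrak T^+_{ex}$ is spanned by the trees in $\mathfrak T_{ex}$ without a noise edge at the root that have $|\tau|_+>0$ or are the single vertex with zero decorations. Coefficients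 are in an arbitrary commutative ring. **Recentering.** A left admissible cut $c$ of $\tau$ is a set of kernel edges that contains at most one edge of each path from the root to a leaf and contains, with an edge, all edges to its left with the same lower vertex. Its trunk $T$ is the part connected to the root; write $c_v$ for the edges of $c$ outgoing from a vertex $v$ of $T$. For multi-indices $a_v\le n_v$ ($v$ a non-noise vertex of $T$) and $\ell_e$ ($e\in c$) let $T_{a,\ell}$ be $T$ with decorations $N_v=n_v-a_v+\sum_{e\in c_v}\ell_e$ at the non-noise vertices. Let $P_{a,\ell}$ be the sum of the trees obtained by grafting the cut branches, with the decorations of the edges $e\in c$ increased by $\ell_e$, onto a new root with decoration $\sum_v a_v$ and extended decoration $0$, over all shuffles (edges cut from the same vertex keep their order). All vertices other than the new root keep their extended decorations. With $\pi_+$ the projection onto $\mathfrak T^+_{ex}$, $$\Delta^+_{ex}\tau=\sum_{c,a,\ell}\frac{(\sum_v a_v)!}{\prod_v a_v!}\prod_v\frac{N_v!}{(n_v-a_v)!\prod_{e\in c_v}\ell_e!}\;\pi_+(P_{a,\ell})\otimes T_{a,\ell},\qquad \Delta^+_{ex}:\mathfrak T_{ex}\to\mathfrak T^+_{ex}\otimes\mathfrak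 T_{ex}.$$ **Renormalisation.** Consider the finite sets $\{\sigma_1,\dots,\sigma_m\}$ ($m\ge0$) of pairwise disjoint subtrees of $\tau$ such that: if an edge is in $\sigma_i$, so are all edges to its right with the same lower vertex; and for each noise edge either it and both its ends belong to the same $\sigma_i$, or neither end belongs to any $\sigma_j$. For each $\sigma=\sigma_i$, sum over all $a_v\le n_v$ ($v$ a non-noise vertex of $\sigma$) and $\ell_e$ ($e$ an edge outgoing from $\sigma$ and not in it). Change the decorations of the non-noise vertices of $\sigma$ to $N_v=n_v-a_v+\sum_{e\text{ at }v}\ell_e$, increase the decorations of the outgoing edges by $\ell_e$, contract $\sigma$ to one vertex with decoration $\sum_v a_v$ and extended decoration the $|\cdot|_+$-degree of the changed $\sigma$, and sum over all shuffles of the outgoing edges (edges from the same vertex keep their order), with coefficient $\frac{(\sum_v a_v)!}{\prod_v a_v!}\prod_v\frac{N_v!}{(n_v-a_v)!\prod_{e}\ell_e!}$. Then $$\Delta^-_{ex}:\mathfrak T_{ex}\to S(\mathfrak T^-)\otimes\mathfrak T_{ex}$$ maps $\tau$ to the sum of the resulting terms (product of the changed $\sigma_i$) $\otimes$ (contracted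 tree), where extended decorations are forgotten in the left factor and a term is $0$ if a changed $\sigma_i$ does not have negative regularity. $\Delta^-_{ex\text{-}non\text{-}root}:\mathfrak T^+_{ex}\to S(\mathfrak T^-)\otimes\mathfrak T^+_{ex}$ is defined in the same way, using only sets in which no $\sigma_i$ contains the root. **Proposition.** With $m^{1,3}(x\otimes y\otimes z\otimes w)=xz\otimes y\otimes w$, $$(\mathrm{Id}\otimes\Delta^+_{ex})\,\Delta^-_{ex}=m^{1,3}\,(\Delta^-_{ex\text{-}non\text{-}root}\otimes\Delta^-_{ex})\,\Delta^+_{ex}$$ as maps $\mathfrak T_{ex}\to S(\mathfrak T^-)\otimes\mathfrak T^+_{ex}\otimes\mathfrak T_{ex}$. -/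

import Mathlib

open scoped TensorProduct

namespace PlanarRS

/-! ## Decorated planar trees -/

/-- Multi-indices in `ℕ^d`. -/
abbrev MIdx (d : ℕ) : Type := Fin d → ℕ

/-- `|n| = n₁ + ⋯ + n_d`. -/
def MIdx.size {d : ℕ} (n : MIdx d) : ℕ := ∑ i, n i

/-- The multi-index binomial coefficient `∏ i, (n i choose k i)`. -/
def mchoose {d : ℕ} (n k : MIdx d) : ℕ := ∏ i, (n i).choose (k i)

/-- `Branches d K Ξ O b` is the planar list, from left to right, of everything that grows out of one
vertex. `K` is the set of convolution kernels, `Ξ` the set of noises. Every edge carries a type in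
`K` or `Ξ` and a decoration in `ℕ^d`; every vertex carries a decoration in `ℕ^d` and a second
decoration in `O`. Two rules are built in: a vertex has at most one outgoing noise edge, and a noise
vertex (the upper end of a noise edge) has no outgoing edges. The index `b` says whether a noise
edge may still occur: there is none in `Branches d K Ξ O false`, and at most one, at an arbitrary
place, in `Branches d K Ξ O true`.

* `kernel k e n o above rest`: the leftmost edge is a kernel edge of type `(k, e)` to a vertex
  decorated by `(n, o)` with outgoing branches `above`; the edges to its right are `rest`.
* `noise ξ e n o rest`: the leftmost edge is a noise edge of type `(ξ, e)` to a noise vertex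
  decorated by `(n, o)`; the edges to its right are `rest`. -/
inductive Branches (d : ℕ) (K Ξ O : Type) : Bool → Type
  | nil {b : Bool} : Branches d K Ξ O b
  | kernel {b : Bool} (k : K) (e : MIdx d) (n : MIdx d) (o : O)
      (above : Branches d K Ξ O true) (rest : Branches d K Ξ O b) : Branches d K Ξ O b
  | noise (ξ : Ξ) (e : MIdx d) (n : MIdx d) (o : O)
      (rest : Branches d K Ξ O false) : Branches d K Ξ O true

/-- A planar tree: the two decorations of the root and the branches at the root. All trees are of
the form `PTree d K Ξ O true`; those in `PTree d K Ξ O false` have no noise edge at the root. -/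
structure PTree (d : ℕ) (K Ξ O : Type) (b : Bool) : Type where
  dec : MIdx d
  exdec : O
  br : Branches d K Ξ O b

/-- A kernel edge of type `(k, e)` together with the tree on top of it. -/
structure Limb (d : ℕ) (K Ξ O : Type) : Type where
  k : K
  e : MIdx d
  tree : PTree d K Ξ O true

variable {d : ℕ} {K Ξ O : Type}

/-- The planar list of branches with the given limbs, from left to right. -/
def ofLimbs {b : Bool} : List (Limb d K Ξ O) → Branches d K Ξ O b
  | [] => .nil
  | x :: l => .kernel x.k x.e x.tree.dec x.tree.exdec x.tree.br (ofLimbs l)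

/-- Forget the second vertex decoration. -/
def Branches.forget : {b : Bool} → Branches d K Ξ O b → Branches d K Ξ Unit b
  | _, .nil => .nil
  | _, .kernel k e n _ above rest => .kernel k e n () above.forget rest.forget
  | _, .noise ξ e n _ rest => .noise ξ e n () rest.forget

/-- Forget the second vertex decoration. -/
def PTree.forget {b : Bool} (t : PTree d K Ξ O b) : PTree d K Ξ Unit b := ⟨t.dec, (), t.br.forget⟩

/-! ## Degrees

`β k` is the regularity of the kernel `k` and `α ξ` the regularity of the path behind the noise `ξ`;
a noise edge contributes `α ξ - 1`. The function `x` says what a second vertex decoration counts. -/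

/-- The sum of all contributions of the edges and vertices in the branches. -/
def Branches.deg (β : K → ℝ) (α : Ξ → ℝ) (x : O → ℝ) : {b : Bool} → Branches d K Ξ O b → ℝ
  | _, .nil => 0
  | _, .kernel k e n o above rest =>
      (β k - (e.size : ℝ)) + ((n.size : ℝ) + x o + above.deg β α x) + rest.deg β α x
  | _, .noise ξ e n o rest =>
      (α ξ - 1 - (e.size : ℝ)) + ((n.size : ℝ) + x o) + rest.deg β α x

/-- The regularity `|τ|` of a tree without second decorations. -/
def PTree.reg (β : K → ℝ) (α : Ξ → ℝ) {b : Bool} (t : PTree d K Ξ Unit b) : ℝ :=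
  (t.dec.size : ℝ) + t.br.deg β α (fun _ => 0)

/-- The degree `|τ|₊` of a tree with extended decorations: its regularity plus the sum of all its
extended decorations. -/
def PTree.degPlus (β : K → ℝ) (α : Ξ → ℝ) {b : Bool} (t : PTree d K Ξ ℝ b) : ℝ :=
  (t.dec.size : ℝ) + t.exdec + t.br.deg β α id

/-- The sum of the absolute values of all contributions to the degree. -/
def Branches.absSize (β : K → ℝ) (α : Ξ → ℝ) : {b : Bool} → Branches d K Ξ ℝ b → ℝ
  | _, .nil => 0
  | _, .kernel k e n o above rest =>
      (|β k| + (e.size : ℝ)) + ((n.size : ℝ) + |o| + above.absSize β α) + rest.absSize β α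
  | _, .noise ξ e n o rest =>
      (|α ξ - 1| + (e.size : ℝ)) + ((n.size : ℝ) + |o|) + rest.absSize β α

/-- A number `B` such that no term of the two coactions below survives its projection (onto positive
trees, or onto negative trees) if an edge decoration is increased by some `ℓ` with `|ℓ| > B`. It
turns the formally infinite sums over `ℓ ∈ ℕ^d` into finite ones without changing their value. -/
noncomputable def PTree.bound (β : K → ℝ) (α : Ξ → ℝ) {b : Bool} (t : PTree d K Ξ ℝ b) : ℕ :=
  ⌈(t.dec.size : ℝ) + |t.exdec| + t.br.absSize β α⌉₊

/-! ## Spaces -/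

/-- Basis of `𝔗⁻`: trees (without extended decorations) of negative regularity. -/
abbrev NegTree (d : ℕ) {K Ξ : Type} (β : K → ℝ) (α : Ξ → ℝ) : Type :=
  {t : PTree d K Ξ Unit true // t.reg β α < 0}

/-- `S(𝔗⁻)`, the free commutative algebra generated by the trees of negative regularity. -/
abbrev SMinus (d : ℕ) {K Ξ : Type} (β : K → ℝ) (α : Ξ → ℝ) (R : Type*) [CommRing R] : Type _ :=
  MvPolynomial (NegTree d β α) R

/-- `𝔗_ex`, the free module on all trees with extended decorations. -/
abbrev TEx (d : ℕ) (K Ξ : Type) (R : Type*) [CommRing R] : Type _ := PTree d K Ξ ℝ true →₀ R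

/-- The tree consisting of a single vertex with zero decorations, the unit of `𝔗⁺_ex`. -/
def PTree.one {b : Bool} : PTree d K Ξ ℝ b := ⟨0, 0, .nil⟩

/-- The tree is positive for `|·|₊`, or it is the unit. -/
def PTree.IsPos (β : K → ℝ) (α : Ξ → ℝ) (t : PTree d K Ξ ℝ false) : Prop :=
  0 < t.degPlus β α ∨ t = PTree.one

/-- Basis of `𝔗⁺_ex`: trees with extended decorations and without a noise edge at the root which
are positive for `|·|₊`, together with the unit. -/
abbrev PosTree (d : ℕ) {K Ξ : Type} (β : K → ℝ) (α : Ξ → ℝ) : Type :=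
  {t : PTree d K Ξ ℝ false // t.IsPos β α}

/-- `𝔗⁺_ex`. -/
abbrev TExPlus (d : ℕ) {K Ξ : Type} (β : K → ℝ) (α : Ξ → ℝ) (R : Type*) [CommRing R] : Type _ :=
  PosTree d β α →₀ R

open Classical in
/-- The projection onto `𝔗⁺_ex`, on basis elements. -/
noncomputable def projPos (β : K → ℝ) (α : Ξ → ℝ) (R : Type*) [CommRing R]
    (t : PTree d K Ξ ℝ false) : TExPlus d β α R :=
  if h : t.IsPos β α then Finsupp.single ⟨t, h⟩ 1 else 0

open Classical in
/-- A tree, its extended decorations being forgotten, as an element of `𝔗⁻ ⊆ S(𝔗⁻)`; it is `0` if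
its regularity is not negative. -/
noncomputable def projNeg (β : K → ℝ) (α : Ξ → ℝ) (R : Type*) [CommRing R]
    (t : PTree d K Ξ ℝ true) : SMinus d β α R :=
  if h : t.forget.reg β α < 0 then MvPolynomial.X ⟨t.forget, h⟩ else 0

/-! ## Left admissible cuts with deformed decorations -/

/-- All shuffles of two lists, with multiplicity. -/
def shuffle {X : Type} : List X → List X → Multiset (List X)
  | [], l => {l}
  | x :: l, [] => {x :: l}
  | x :: l, y :: m =>
      (shuffle l (y :: m)).map (fun s => x :: s) + (shuffle (x :: l) m).map (fun s => y :: s)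
termination_by l m => l.length + m.length

/-- A term obtained by cutting inside the branches at one vertex `v`.
* `coef`: its coefficient;
* `red`: the total amount taken off the decorations of the kept vertices (`v` not included);
* `shift`: the sum of the `ℓ`'s by which the decorations of the cut edges at `v` are increased;
* `own`: the limbs cut off at `v`, in planar order;
* `deep`: the limbs cut off at vertices above `v`, shuffled;
* `kept`: the branches that stay at `v`. -/
structure BranchCut (C : Type*) (d : ℕ) (K Ξ O : Type) (b : Bool) where
  coef : C
  red : MIdx d
  shift : MIdx d
  own : List (Limb d K Ξ O)
  deep : List (Limb d K Ξ O)
  kept : Branches d K Ξ O b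

/-- A term obtained by cutting a tree.
* `coef`: its coefficient;
* `red`: the total amount taken off the decorations of the vertices of the trunk;
* `pruned`: the limbs that have been cut off, shuffled;
* `trunk`: the trunk. -/
structure TreeCut (C : Type*) (d : ℕ) (K Ξ O : Type) (b : Bool) where
  coef : C
  red : MIdx d
  pruned : List (Limb d K Ξ O)
  trunk : PTree d K Ξ O b

section Steps

variable {C : Type*} [CommSemiring C]

/-- Nothing is cut at a vertex without outgoing edges. -/
def nilStep {b : Bool} : Multiset (BranchCut C d K Ξ O b) := {⟨1, 0, 0, [], [], .nil⟩}

/-- Cut the leftmost edge, of type `(k, e)`, and increase its decoration to `e + ℓ`. The trees that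
may be on top of the edge are `heads`, with their coefficients; the terms for the edges to the right
are `rests`. The factors `(shift + ℓ choose ℓ)` multiply up to the multinomial coefficient
`(∑ ℓ)! / ∏ ℓ!` over the cut edges at the vertex. -/
def cutStep {b : Bool} (B : ℕ) (k : K) (e : MIdx d) (heads : Multiset (C × PTree d K Ξ O true))
    (rests : Multiset (BranchCut C d K Ξ O b)) : Multiset (BranchCut C d K Ξ O b) :=
  (Finset.Iic (fun _ => B : MIdx d)).val.bind fun ℓ =>
    heads.bind fun h => rests.map fun t =>
      ⟨h.1 * t.coef * (mchoose (t.shift + ℓ) ℓ : C), t.red, t.shift + ℓ,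
        ⟨k, e + ℓ, h.2⟩ :: t.own, t.deep, t.kept⟩

/-- Keep the leftmost edge, of type `(k, e)`. The terms for the tree above it are `aboves`, those
for the edges to the right are `rests`. -/
def keepStep {b : Bool} (k : K) (e : MIdx d) (aboves : Multiset (TreeCut C d K Ξ O true))
    (rests : Multiset (BranchCut C d K Ξ O b)) : Multiset (BranchCut C d K Ξ O b) :=
  aboves.bind fun s => rests.bind fun t => (shuffle s.pruned t.deep).map fun l =>
    ⟨s.coef * t.coef * (mchoose (s.red + t.red) s.red : C), s.red + t.red, t.shift, t.own, l,
      .kernel k e s.trunk.dec s.trunk.exdec s.trunk.br t.kept⟩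

/-- A noise edge stays, and its noise vertex is not touched. -/
def noiseStep (ξ : Ξ) (e n : MIdx d) (o : O) (rests : Multiset (BranchCut C d K Ξ O false)) :
    Multiset (BranchCut C d K Ξ O true) :=
  rests.map fun t => ⟨t.coef, t.red, t.shift, t.own, t.deep, .noise ξ e n o t.kept⟩

/-- Pass from the branches at a vertex with decorations `(n, o)` to the tree with this root: take
`a ≤ n` off `n`, and add the sum of the `ℓ`'s of the edges that have been cut at the vertex. With
`N = n - a + ∑ ℓ` the new decoration, the coefficient is completed to the multinomial coefficient
`N! / ((n - a)! ∏ ℓ!)`, and the `a`'s of all vertices contribute the multinomial coefficient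
`(∑ a)! / ∏ a!`. -/
def closeVertex {b : Bool} (n : MIdx d) (o : O) (terms : Multiset (BranchCut C d K Ξ O b)) :
    Multiset (TreeCut C d K Ξ O b) :=
  (Finset.Iic n).val.bind fun a => terms.bind fun t => (shuffle t.own t.deep).map fun l =>
    ⟨t.coef * (mchoose (n - a + t.shift) t.shift * mchoose (a + t.red) a : ℕ), a + t.red, l,
      ⟨n - a + t.shift, o, t.kept⟩⟩

end Steps

/-- All left admissible cuts inside the branches at a vertex: the cut edges at a vertex form an
initial segment of the kernel edges to the left of a possible noise edge, and nothing above a cut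
edge is cut. The flag says whether all edges further to the left have been cut, so that the leftmost
edge may be cut as well. -/
def cuts (B : ℕ) : Bool → {b : Bool} → Branches d K Ξ O b → Multiset (BranchCut ℕ d K Ξ O b)
  | _, _, .nil => nilStep
  | true, _, .kernel k e n o above rest =>
      cutStep B k e {(1, ⟨n, o, above⟩)} (cuts B true rest) +
        keepStep k e (closeVertex n o (cuts B true above)) (cuts B false rest)
  | false, _, .kernel k e n o above rest =>
      keepStep k e (closeVertex n o (cuts B true above)) (cuts B false rest)
  | _, _, .noise ξ e n o rest => noiseStep ξ e n o (cuts B false rest)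

/-- The recentering coaction `Δ⁺_ex : 𝔗_ex → 𝔗⁺_ex ⊗ 𝔗_ex`. For every left admissible cut, the pruned
limbs are grafted onto a new root which receives everything that has been taken off the vertices of
the trunk and which has extended decoration `0`; all other vertices keep their extended decoration. -/
noncomputable def deltaPlusEx (β : K → ℝ) (α : Ξ → ℝ) (R : Type*) [CommRing R] :
    TEx d K Ξ R →ₗ[R] TExPlus d β α R ⊗[R] TEx d K Ξ R :=
  Finsupp.linearCombination R fun t : PTree d K Ξ ℝ true =>
    ((closeVertex t.dec t.exdec (cuts (t.bound β α) true t.br)).map fun s =>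
      (s.coef : R) • (projPos β α R ⟨s.red, 0, ofLimbs s.pruned⟩ ⊗ₜ[R] Finsupp.single s.trunk 1)).sum

/-! ## Contraction of negative subtrees -/

/-- All ways to contract subtrees in a tree whose root has decorations `(n, o)`, given the ways `A`
to contract subtrees inside the branches at the root, and the ways `E` to single out inside these
branches the part of a subtree that contains the root. In the second case the subtree is the trunk
`s.trunk`, it is put into `S(𝔗⁻)` if it is negative, and it is contracted into a vertex whose
extended decoration is its `|·|₊`-degree. -/
noncomputable def contractVertex (β : K → ℝ) (α : Ξ → ℝ) (R : Type*) [CommRing R] (n : MIdx d) (o : ℝ)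
    (A : Multiset (SMinus d β α R × Branches d K Ξ ℝ true))
    (E : Multiset (BranchCut (SMinus d β α R) d K Ξ ℝ true)) :
    Multiset (SMinus d β α R × PTree d K Ξ ℝ true) :=
  A.map (fun q => (q.1, ⟨n, o, q.2⟩)) +
    (closeVertex n o E).map fun s =>
      (s.coef * projNeg β α R s.trunk, ⟨s.red, s.trunk.degPlus β α, ofLimbs s.pruned⟩)

mutual

/-- All ways to contract admissible partitions inside the branches at a vertex which itself does not
belong to a contracted subtree. -/
noncomputable def contract (β : K → ℝ) (α : Ξ → ℝ) (R : Type*) [CommRing R] (B : ℕ) :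
    {b : Bool} → Branches d K Ξ ℝ b → Multiset (SMinus d β α R × Branches d K Ξ ℝ b)
  | _, .nil => {(1, .nil)}
  | _, .kernel k e n o above rest =>
      (contractVertex β α R n o (contract β α R B above) (extract β α R B true above)).bind fun h =>
        (contract β α R B rest).map fun q =>
          (h.1 * q.1, .kernel k e h.2.dec h.2.exdec h.2.br q.2)
  | _, .noise ξ e n o rest =>
      (contract β α R B rest).map fun q => (q.1, .noise ξ e n o q.2)

/-- All ways to single out inside the branches at a vertex `v` the part of a contracted subtree that
contains `v`. The edges at a vertex of the subtree which do not belong to the subtree form an initial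
segment of the kernel edges to the left of a possible noise edge, so the subtree is the trunk of a
left admissible cut; the edges that leave the subtree are deformed as cut edges are, and further
subtrees are contracted in the trees on top of them. -/
noncomputable def extract (β : K → ℝ) (α : Ξ → ℝ) (R : Type*) [CommRing R] (B : ℕ) :
    Bool → {b : Bool} → Branches d K Ξ ℝ b → Multiset (BranchCut (SMinus d β α R) d K Ξ ℝ b)
  | _, _, .nil => nilStep
  | true, _, .kernel k e n o above rest =>
      cutStep B k e
          (contractVertex β α R n o (contract β α R B above) (extract β α R B true above))
          (extract β α R B true rest) +
        keepStep k e (closeVertex n o (extract β α R B true above)) (extract β α R B false rest)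
  | false, _, .kernel k e n o above rest =>
      keepStep k e (closeVertex n o (extract β α R B true above)) (extract β α R B false rest)
  | _, _, .noise ξ e n o rest => noiseStep ξ e n o (extract β α R B false rest)

end

/-- The renormalisation coaction `Δ⁻_ex : 𝔗_ex → S(𝔗⁻) ⊗ 𝔗_ex`. -/
noncomputable def deltaMinusEx (β : K → ℝ) (α : Ξ → ℝ) (R : Type*) [CommRing R] :
    TEx d K Ξ R →ₗ[R] SMinus d β α R ⊗[R] TEx d K Ξ R :=
  Finsupp.linearCombination R fun t : PTree d K Ξ ℝ true =>
    ((contractVertex β α R t.dec t.exdec (contract β α R (t.bound β α) t.br)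
        (extract β α R (t.bound β α) true t.br)).map fun q =>
      q.1 ⊗ₜ[R] Finsupp.single q.2 1).sum

/-! The `|·|₊`-degree is preserved by contractions, hence contractions away from the root map `𝔗⁺_ex`
to itself. -/

/-- The contribution of a list of limbs to the `|·|₊`-degree. -/
noncomputable def limbsDeg (β : K → ℝ) (α : Ξ → ℝ) (l : List (Limb d K Ξ ℝ)) : ℝ :=
  (l.map fun x => (β x.k - (x.e.size : ℝ)) + x.tree.degPlus β α).sum

theorem MIdx.size_add (a b : MIdx d) : (a + b).size = a.size + b.size := by
  simp [MIdx.size, Finset.sum_add_distrib]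

theorem MIdx.size_zero : (0 : MIdx d).size = 0 := by
  simp [MIdx.size]

theorem deg_ofLimbs (β : K → ℝ) (α : Ξ → ℝ) {b : Bool} (l : List (Limb d K Ξ ℝ)) :
    (ofLimbs l : Branches d K Ξ ℝ b).deg β α id = limbsDeg β α l := by
  induction l with
  | nil => simp [ofLimbs, Branches.deg, limbsDeg]
  | cons x l ih =>
    simp only [ofLimbs, Branches.deg, ih]
    simp [limbsDeg, PTree.degPlus]

theorem perm_of_mem_shuffle {X : Type} (l m s : List X) (h : s ∈ shuffle l m) :
    s.Perm (l ++ m) := by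
  induction l, m using shuffle.induct generalizing s with
  | case1 l => simp_all [shuffle]
  | case2 x l => simp_all [shuffle]
  | case3 x l y m ih1 ih2 =>
    rw [shuffle, Multiset.mem_add, Multiset.mem_map, Multiset.mem_map] at h
    rcases h with ⟨s, hs, rfl⟩ | ⟨s, hs, rfl⟩
    · exact (ih1 s hs).cons x
    · exact ((ih2 s hs).cons y).trans List.perm_middle.symm

theorem limbsDeg_shuffle (β : K → ℝ) (α : Ξ → ℝ) {l m s : List (Limb d K Ξ ℝ)}
    (h : s ∈ shuffle l m) : limbsDeg β α s = limbsDeg β α l + limbsDeg β α m := by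
  rw [limbsDeg, ((perm_of_mem_shuffle l m s h).map _).sum_eq]
  simp [limbsDeg]

/-- The total degree of a term is `D`. -/
def BranchCut.HasDeg {C : Type*} {b : Bool} (β : K → ℝ) (α : Ξ → ℝ) (D : ℝ)
    (t : BranchCut C d K Ξ ℝ b) : Prop :=
  t.kept.deg β α id + limbsDeg β α t.own + limbsDeg β α t.deep + (t.red.size : ℝ)
    + (t.shift.size : ℝ) = D

/-- The total degree of a term is `D`. -/
def TreeCut.HasDeg {C : Type*} {b : Bool} (β : K → ℝ) (α : Ξ → ℝ) (D : ℝ)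
    (s : TreeCut C d K Ξ ℝ b) : Prop :=
  s.trunk.degPlus β α + limbsDeg β α s.pruned + (s.red.size : ℝ) = D

theorem hasDeg_nilStep {C : Type*} [CommSemiring C] {b : Bool} (β : K → ℝ) (α : Ξ → ℝ)
    (t : BranchCut C d K Ξ ℝ b) (ht : t ∈ nilStep) : t.HasDeg β α 0 := by
  rw [nilStep, Multiset.mem_singleton] at ht
  subst ht
  simp [BranchCut.HasDeg, Branches.deg, limbsDeg, MIdx.size_zero]

theorem hasDeg_cutStep {C : Type*} [CommSemiring C] {b : Bool} (β : K → ℝ) (α : Ξ → ℝ) {D D' : ℝ}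
    (B : ℕ) (k : K) (e : MIdx d) (heads : Multiset (C × PTree d K Ξ ℝ true))
    (rests : Multiset (BranchCut C d K Ξ ℝ b)) (h1 : ∀ h ∈ heads, h.2.degPlus β α = D)
    (h2 : ∀ t ∈ rests, t.HasDeg β α D') (t : BranchCut C d K Ξ ℝ b)
    (ht : t ∈ cutStep B k e heads rests) :
    t.HasDeg β α ((β k - (e.size : ℝ)) + D + D') := by
  simp only [cutStep, Multiset.mem_bind, Multiset.mem_map] at ht
  obtain ⟨ℓ, -, h, hh, t, ht, rfl⟩ := ht
  have h1 := h1 h hh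
  have h2 := h2 t ht
  simp only [BranchCut.HasDeg, limbsDeg, List.map_cons, List.sum_cons, MIdx.size_add,
    Nat.cast_add] at h2 ⊢
  linarith

theorem hasDeg_keepStep {C : Type*} [CommSemiring C] {b : Bool} (β : K → ℝ) (α : Ξ → ℝ) {D D' : ℝ}
    (k : K) (e : MIdx d) (aboves : Multiset (TreeCut C d K Ξ ℝ true))
    (rests : Multiset (BranchCut C d K Ξ ℝ b)) (h1 : ∀ s ∈ aboves, s.HasDeg β α D)
    (h2 : ∀ t ∈ rests, t.HasDeg β α D') (t : BranchCut C d K Ξ ℝ b)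
    (ht : t ∈ keepStep k e aboves rests) :
    t.HasDeg β α ((β k - (e.size : ℝ)) + D + D') := by
  simp only [keepStep, Multiset.mem_bind, Multiset.mem_map] at ht
  obtain ⟨s, hs, t, ht, l, hl, rfl⟩ := ht
  have h1 := h1 s hs
  have h2 := h2 t ht
  have h3 := limbsDeg_shuffle β α hl
  simp only [BranchCut.HasDeg, TreeCut.HasDeg, PTree.degPlus, Branches.deg, MIdx.size_add,
    Nat.cast_add, id] at h1 h2 ⊢
  linarith

theorem hasDeg_noiseStep {C : Type*} [CommSemiring C] (β : K → ℝ) (α : Ξ → ℝ) {D : ℝ}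
    (ξ : Ξ) (e n : MIdx d) (o : ℝ) (rests : Multiset (BranchCut C d K Ξ ℝ false))
    (h2 : ∀ t ∈ rests, t.HasDeg β α D) (t : BranchCut C d K Ξ ℝ true)
    (ht : t ∈ noiseStep ξ e n o rests) :
    t.HasDeg β α ((α ξ - 1 - (e.size : ℝ)) + ((n.size : ℝ) + o) + D) := by
  simp only [noiseStep, Multiset.mem_map] at ht
  obtain ⟨t, ht, rfl⟩ := ht
  have h2 := h2 t ht
  simp only [BranchCut.HasDeg, Branches.deg, id] at h2 ⊢
  linarith

theorem hasDeg_closeVertex {C : Type*} [CommSemiring C] {b : Bool} (β : K → ℝ) (α : Ξ → ℝ) {D : ℝ}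
    (n : MIdx d) (o : ℝ) (terms : Multiset (BranchCut C d K Ξ ℝ b))
    (h : ∀ t ∈ terms, t.HasDeg β α D) (s : TreeCut C d K Ξ ℝ b)
    (hs : s ∈ closeVertex n o terms) : s.HasDeg β α ((n.size : ℝ) + o + D) := by
  simp only [closeVertex, Multiset.mem_bind, Multiset.mem_map, Finset.mem_val,
    Finset.mem_Iic] at hs
  obtain ⟨a, ha, t, ht, l, hl, rfl⟩ := hs
  have h1 := h t ht
  have h3 := limbsDeg_shuffle β α hl
  have h4 : ((n - a).size : ℝ) + (a.size : ℝ) = (n.size : ℝ) := by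
    rw [← Nat.cast_add, ← MIdx.size_add, tsub_add_cancel_of_le ha]
  simp only [BranchCut.HasDeg, TreeCut.HasDeg, PTree.degPlus, MIdx.size_add, Nat.cast_add] at h1 ⊢
  linarith

theorem degPlus_contractVertex (β : K → ℝ) (α : Ξ → ℝ) (R : Type*) [CommRing R] {D : ℝ}
    (n : MIdx d) (o : ℝ) (A : Multiset (SMinus d β α R × Branches d K Ξ ℝ true))
    (E : Multiset (BranchCut (SMinus d β α R) d K Ξ ℝ true))
    (hA : ∀ q ∈ A, q.2.deg β α id = D) (hE : ∀ t ∈ E, t.HasDeg β α D)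
    (q : SMinus d β α R × PTree d K Ξ ℝ true) (hq : q ∈ contractVertex β α R n o A E) :
    q.2.degPlus β α = (n.size : ℝ) + o + D := by
  simp only [contractVertex, Multiset.mem_add, Multiset.mem_map] at hq
  rcases hq with ⟨q, hq, rfl⟩ | ⟨s, hs, rfl⟩
  · simp [PTree.degPlus, hA q hq]
  · have h := hasDeg_closeVertex β α n o E hE s hs
    simp only [TreeCut.HasDeg] at h
    simp only [PTree.degPlus, deg_ofLimbs] at h ⊢
    linarith

theorem deg_contract_extract (β : K → ℝ) (α : Ξ → ℝ) (R : Type*) [CommRing R] (B : ℕ)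
    {b : Bool} (br : Branches d K Ξ ℝ b) :
    (∀ q ∈ contract β α R B br, q.2.deg β α id = br.deg β α id) ∧
      ∀ c, ∀ t ∈ extract β α R B c br, t.HasDeg β α (br.deg β α id) := by
  induction br with
  | nil =>
    refine ⟨fun q hq => ?_, fun c t ht => ?_⟩
    · simp only [contract, Multiset.mem_singleton] at hq
      rw [hq]
    · cases c <;> simp only [extract] at ht <;> exact hasDeg_nilStep β α t ht
  | kernel k e n o above rest ih1 ih2 =>
    have hV := degPlus_contractVertex β α R n o _ _ ih1.1 (ih1.2 true)
    have hC := hasDeg_closeVertex β α n o _ (ih1.2 true)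
    refine ⟨fun q hq => ?_, fun c t ht => ?_⟩
    · simp only [contract, Multiset.mem_bind, Multiset.mem_map] at hq
      obtain ⟨h, hh, q, hq, rfl⟩ := hq
      have h1 := hV h hh
      have h2 := ih2.1 q hq
      simp only [PTree.degPlus, Branches.deg, id] at h1 h2 ⊢
      linarith
    · have hK := hasDeg_keepStep β α k e _ _ hC (ih2.2 false)
      cases c
      · simp only [extract] at ht
        exact hK t ht
      · simp only [extract, Multiset.mem_add] at ht
        rcases ht with ht | ht
        · exact hasDeg_cutStep β α B k e _ _ hV (ih2.2 true) t ht
        · exact hK t ht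
  | noise ξ e n o rest ih =>
    refine ⟨fun q hq => ?_, fun c t ht => ?_⟩
    · simp only [contract, Multiset.mem_map] at hq
      obtain ⟨q, hq, rfl⟩ := hq
      simp only [Branches.deg, ih.1 q hq]
    · cases c <;> simp only [extract] at ht <;>
        exact hasDeg_noiseStep β α ξ e n o _ (ih.2 false) t ht

theorem isPos_of_mem_contract (β : K → ℝ) (α : Ξ → ℝ) (R : Type*) [CommRing R] (B : ℕ)
    (t : PosTree d β α) (q : SMinus d β α R × Branches d K Ξ ℝ false)
    (hq : q ∈ contract β α R B t.1.br) :
    (⟨t.1.dec, t.1.exdec, q.2⟩ : PTree d K Ξ ℝ false).IsPos β α := by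
  obtain ⟨t, ht | rfl⟩ := t
  · left
    have h := (deg_contract_extract β α R B t.br).1 q hq
    simp only [PTree.degPlus] at ht ⊢
    rwa [h]
  · right
    simp only [PTree.one, contract, Multiset.mem_singleton] at hq ⊢
    rw [hq]

/-- The renormalisation coaction `Δ⁻_{ex-non-root} : 𝔗⁺_ex → S(𝔗⁻) ⊗ 𝔗⁺_ex`, which contracts only
subtrees that do not contain the root. -/
noncomputable def deltaMinusExNonRoot (β : K → ℝ) (α : Ξ → ℝ) (R : Type*) [CommRing R] :
    TExPlus d β α R →ₗ[R] SMinus d β α R ⊗[R] TExPlus d β α R :=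
  Finsupp.linearCombination R fun t : PosTree d β α =>
    ((contract β α R (t.1.bound β α) t.1.br).pmap
      (fun q hq => q.1 ⊗ₜ[R] Finsupp.single
        (⟨⟨t.1.dec, t.1.exdec, q.2⟩, hq⟩ : PosTree d β α) (1 : R))
      (isPos_of_mem_contract β α R (t.1.bound β α) t)).sum

/-- `m^{1,3}(a ⊗ b ⊗ c ⊗ e) = ac ⊗ b ⊗ e`. -/
noncomputable def m13 (R S M N : Type*) [CommRing R] [CommRing S] [Algebra R S]
    [AddCommGroup M] [Module R M] [AddCommGroup N] [Module R N] :
    (S ⊗[R] M) ⊗[R] (S ⊗[R] N) →ₗ[R] S ⊗[R] (M ⊗[R] N) :=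
  TensorProduct.map (LinearMap.mul' R S) LinearMap.id ∘ₗ
    (TensorProduct.tensorTensorTensorComm R S M S N).toLinearMap

end PlanarRS

/-!
Both sides of the identity involve infinitely many choices of `ℓ` cut down by the projections onto
positive and negative trees. To make the truncation compatible with all recursions, weight the
choice `ℓ` by `X ^ |ℓ|` and compute modulo `X ^ (N + 1)`: the sums over the box `{0, …, N}^d` then
behave like sums over all multi-indices, and for large `N` the sum of the coefficients up to degree
`N` is the value at `X = 1`.

A left admissible cut produces an element of the free divided power algebra (polynomial
decorations) tensored with the shuffle algebra (cut branches). Evaluating along a character of this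
algebra turns the shuffles and multinomial coefficients of both coactions into products over the
edges of the tree. The identity then follows by induction over the branches at a vertex,
simultaneously for the contractions that do not touch the vertex and for those that contract a
subtree containing it, and the universal character gives back the original statement.
-/

universe u

namespace PlanarRS

variable {d : ℕ} {K Ξ O : Type}

/-! ## Divided power coefficients -/

/-- The coefficient of `x_{a+b}` in the divided power product `x_a x_b`. -/
def addChoose (a b : MIdx d) : ℕ := mchoose (a + b) a

theorem mchoose_add_left (a b : MIdx d) : mchoose (a + b) a = addChoose a b := rfl

theorem mchoose_add_right (a b : MIdx d) : mchoose (a + b) b = addChoose a b :=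
  Finset.prod_congr rfl fun i _ => (Nat.choose_symm_add (a := a i) (b := b i)).symm

theorem mchoose_ne_zero_iff {n k : MIdx d} : mchoose n k ≠ 0 ↔ k ≤ n := by
  simp [mchoose, Finset.prod_ne_zero_iff, Nat.choose_ne_zero_iff, Pi.le_def]

theorem addChoose_comm (a b : MIdx d) : addChoose a b = addChoose b a := by
  rw [← mchoose_add_right, add_comm, mchoose_add_left]

theorem addChoose_zero_left (a : MIdx d) : addChoose 0 a = 1 := by
  simp [addChoose, mchoose]

theorem addChoose_zero_right (a : MIdx d) : addChoose a 0 = 1 := by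
  rw [addChoose_comm, addChoose_zero_left]

theorem addChoose_assoc (a b c : MIdx d) :
    addChoose a b * addChoose (a + b) c = addChoose b c * addChoose a (b + c) := by
  simp only [addChoose, mchoose, ← Finset.prod_mul_distrib, Pi.add_apply]
  refine Finset.prod_congr rfl fun i _ => ?_
  have h := Nat.choose_mul (n := a i + b i + c i) (k := a i + b i) (s := a i) (by omega)
  rw [mul_comm, h, mul_comm, ← add_assoc]
  congr 2 <;> omega

theorem sum_mchoose_mul_mchoose (p q c : MIdx d) (h : c ≤ p + q) :
    ∑ a ∈ Finset.Iic p, mchoose c a * mchoose (p + q - c) (p - a) = addChoose p q := by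
  have vandermonde (i : Fin d) : ∑ j ∈ Finset.Iic (p i),
      (c i).choose j * (p i + q i - c i).choose (p i - j) = (p i + q i).choose (p i) := by
    have hi := Nat.add_choose_eq (c i) (p i + q i - c i) (p i)
    rw [Nat.add_sub_cancel' (show c i ≤ p i + q i from h i),
      Finset.Nat.sum_antidiagonal_eq_sum_range_succ_mk] at hi
    rw [hi, Nat.range_succ_eq_Iic]
  simp only [addChoose, mchoose, Pi.add_apply, ← vandermonde, Finset.prod_univ_sum,
    ← Finset.prod_mul_distrib]
  rfl

/-! ## Sums over the decompositions of a multi-index -/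

/-- The sum over all decompositions of a multi-index into two. -/
def splitSum {M : Type*} [AddCommMonoid M] (n : MIdx d) (f : MIdx d → MIdx d → M) : M :=
  ∑ a ∈ Finset.Iic n, f a (n - a)

section SplitSum

variable {M : Type*} [AddCommMonoid M]

theorem splitSum_zero (f : MIdx d → MIdx d → M) : splitSum 0 f = f 0 0 := by
  have hIic : Finset.Iic (0 : MIdx d) = {0} := by
    ext a
    simp
  rw [splitSum, hIic, Finset.sum_singleton, tsub_zero]

theorem splitSum_congr {n : MIdx d} {f g : MIdx d → MIdx d → M}
    (h : ∀ a b, a + b = n → f a b = g a b) : splitSum n f = splitSum n g :=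
  Finset.sum_congr rfl fun a ha => h a _ (add_tsub_cancel_of_le (Finset.mem_Iic.1 ha))

theorem sum_Iic_add_mchoose_smul {p a : MIdx d} (ha : a ≤ p) (q : MIdx d)
    (f : MIdx d → MIdx d → M) :
    ∑ c ∈ Finset.Iic (p + q), (mchoose c a * mchoose (p + q - c) (p - a)) • f c (p + q - c) =
      splitSum q fun b b' => (addChoose a b * addChoose (p - a) b') • f (a + b) (p - a + b') := by
  symm
  refine Finset.sum_of_injOn (a + ·) (add_right_injective a).injOn ?_ ?_ ?_
  · intro b hb
    simp only [Finset.coe_Iic, Set.mem_Iic] at hb ⊢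
    exact add_le_add ha hb
  · intro c hc hc_range
    suffices mchoose c a * mchoose (p + q - c) (p - a) = 0 by rw [this, zero_smul]
    by_contra hne
    obtain ⟨hac, hpa⟩ := mul_ne_zero_iff.1 hne
    rw [mchoose_ne_zero_iff] at hac hpa
    refine hc_range ⟨c - a, Finset.mem_coe.2 (Finset.mem_Iic.2 fun i => ?_),
      add_tsub_cancel_of_le hac⟩
    have := Finset.mem_Iic.1 hc i
    have := ha i
    have := hpa i
    simp only [Pi.sub_apply, Pi.add_apply] at *
    omega
  · intro b hb
    rw [← tsub_add_tsub_comm ha (Finset.mem_Iic.1 hb), mchoose_add_left, mchoose_add_left]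

theorem addChoose_smul_splitSum_add (p q : MIdx d) (f : MIdx d → MIdx d → M) :
    addChoose p q • splitSum (p + q) f = splitSum p fun a a' => splitSum q fun b b' =>
      (addChoose a b * addChoose a' b') • f (a + b) (a' + b') := by
  have expand : ∀ c ∈ Finset.Iic (p + q), addChoose p q • f c (p + q - c) =
      ∑ a ∈ Finset.Iic p, (mchoose c a * mchoose (p + q - c) (p - a)) • f c (p + q - c) :=
    fun c hc => by rw [← Finset.sum_smul, sum_mchoose_mul_mchoose p q c (Finset.mem_Iic.1 hc)]
  rw [splitSum, Finset.smul_sum, Finset.sum_congr rfl expand, Finset.sum_comm]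
  exact Finset.sum_congr rfl fun a ha => sum_Iic_add_mchoose_smul (Finset.mem_Iic.1 ha) q f

theorem splitSum_assoc (n : MIdx d) (f : MIdx d → MIdx d → MIdx d → M) :
    (splitSum n fun a c => splitSum a fun b b' => f b b' c) =
      splitSum n fun b r => splitSum r fun b' c => f b b' c := by
  unfold splitSum
  rw [Finset.sum_sigma', Finset.sum_sigma']
  refine Finset.sum_bij' (fun s _ => ⟨s.2, s.1 - s.2⟩) (fun s _ => ⟨s.1 + s.2, s.1⟩) ?_ ?_ ?_ ?_ ?_
    <;> rintro ⟨a, b⟩ h <;> simp only [Finset.mem_sigma, Finset.mem_Iic] at h ⊢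
  · exact ⟨h.2.trans h.1, tsub_le_tsub_right h.1 b⟩
  · exact ⟨(le_tsub_iff_left h.1).1 h.2, le_self_add⟩
  · simp [add_tsub_cancel_of_le h.2]
  · simp
  · rw [tsub_tsub, add_tsub_cancel_of_le h.2]

theorem sum_smul_splitSum {C : Type*} [Semiring C] [Module C M] (S : Finset (MIdx d))
    (hS : IsLowerSet (S : Set (MIdx d))) (w : MIdx d → C) (w_add : ∀ a b, w (a + b) = w a * w b)
    (w_eq_zero : ∀ a, a ∉ S → w a = 0) (f : MIdx d → MIdx d → M) :
    ∑ m ∈ S, w m • splitSum m f = ∑ a ∈ S, ∑ b ∈ S, w a • w b • f a b := by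
  simp only [splitSum, Finset.smul_sum]
  rw [Finset.sum_sigma', ← Finset.sum_product']
  refine Finset.sum_of_injOn (fun s => (s.2, s.1 - s.2)) ?_ ?_ ?_ ?_
  · rintro ⟨m, a⟩ h ⟨m', a'⟩ h' e
    simp only [Finset.mem_coe, Finset.mem_sigma, Finset.mem_Iic] at h h'
    obtain ⟨rfl, hsub⟩ := Prod.mk.inj e
    rw [← add_tsub_cancel_of_le h.2, hsub, add_tsub_cancel_of_le h'.2]
  · rintro ⟨m, a⟩ h
    simp only [Finset.mem_coe, Finset.mem_sigma, Finset.mem_Iic, Finset.mem_product] at h ⊢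
    exact ⟨hS h.2 h.1, hS tsub_le_self h.1⟩
  · rintro ⟨a, b⟩ - h_range
    rw [smul_smul, ← w_add, w_eq_zero, zero_smul]
    exact fun hab => h_range ⟨⟨a + b, a⟩, by simpa using hab, by simp⟩
  · rintro ⟨m, a⟩ h
    rw [smul_smul, ← w_add, add_tsub_cancel_of_le (Finset.mem_Iic.1 (Finset.mem_sigma.1 h).2)]

end SplitSum

/-! ## Weighted sums over multisets -/

/-- The sum of the values of `f` over a multiset of weighted points. -/
def wsum {C A M : Type*} [AddCommMonoid M] [SMul C M] (T : Multiset (C × A)) (f : A → M) : M :=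
  (T.map fun q => q.1 • f q.2).sum

section WSum

variable {C C' A A' M M' : Type*} [Semiring C] [Semiring C'] [AddCommMonoid M] [Module C M]
  [Module C' M] [AddCommMonoid M'] [Module C M']

theorem wsum_congr (T : Multiset (C × A)) {f g : A → M} (h : ∀ a, f a = g a) :
    wsum T f = wsum T g := by
  rw [funext h]

theorem wsum_add_left (T T' : Multiset (C × A)) (f : A → M) :
    wsum (T + T') f = wsum T f + wsum T' f := by
  simp [wsum]

theorem wsum_cons (q : C × A) (T : Multiset (C × A)) (f : A → M) :
    wsum (q ::ₘ T) f = q.1 • f q.2 + wsum T f := by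
  simp [wsum]

theorem wsum_add (T : Multiset (C × A)) (f g : A → M) :
    (wsum T fun a => f a + g a) = wsum T f + wsum T g := by
  simp [wsum]

theorem wsum_smul [SMulCommClass C C' M] (T : Multiset (C × A)) (c : C') (f : A → M) :
    (wsum T fun a => c • f a) = c • wsum T f := by
  simp only [wsum, Multiset.smul_sum, Multiset.map_map, Function.comp_def, smul_comm (N := C')]

theorem wsum_smul_right [Module C C'] [IsScalarTower C C' M] (T : Multiset (C × A)) (c : A → C')
    (m : M) : (wsum T fun a => c a • m) = wsum T c • m := by
  simp only [wsum, Multiset.sum_smul, Multiset.map_map, Function.comp_def, smul_assoc]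

theorem wsum_finset_sum {ι : Type*} (T : Multiset (C × A)) (s : Finset ι) (f : ι → A → M) :
    (wsum T fun a => ∑ i ∈ s, f i a) = ∑ i ∈ s, wsum T (f i) := by
  simp only [wsum, Finset.smul_sum, Multiset.sum_map_sum]

theorem wsum_splitSum (T : Multiset (C × A)) (n : MIdx d) (f : MIdx d → MIdx d → A → M) :
    (wsum T fun a => splitSum n fun r s => f r s a) = splitSum n fun r s => wsum T (f r s) :=
  wsum_finset_sum T _ _

theorem wsum_comm [SMulCommClass C C' M] (T : Multiset (C × A)) (T' : Multiset (C' × A'))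
    (f : A → A' → M) :
    (wsum T fun a => wsum T' (f a)) = wsum T' fun a' => wsum T fun a => f a a' := by
  induction T' using Multiset.induction_on with
  | empty => simp [wsum]
  | cons q T' ih => simp only [wsum_cons, wsum_add, ih, wsum_smul]

theorem map_wsum (T : Multiset (C × A)) (φ : M →ₗ[C] M') (f : A → M) :
    φ (wsum T f) = wsum T fun a => φ (f a) := by
  simp [wsum, map_multiset_sum]

theorem wsum_bind_map (S : Multiset (C × A)) (T : Multiset (C × A')) {D : Type*} (c : A → A' → D)
    (f : D → M) :
    wsum (S.bind fun h => T.map fun q => (h.1 * q.1, c h.2 q.2)) f =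
      wsum S fun a => wsum T fun b => f (c a b) := by
  simp [wsum, Multiset.map_bind, Multiset.sum_bind, Multiset.smul_sum, mul_smul]

end WSum

/-! ## Shuffles -/

section Shuffle

variable {X Y : Type} {M M' : Type*} [AddCommMonoid M] [AddCommMonoid M']

theorem shuffle_nil_left (l : List X) : shuffle [] l = {l} := by
  simp [shuffle]

theorem shuffle_nil_right (l : List X) : shuffle l [] = {l} := by
  cases l <;> simp [shuffle]

theorem shuffle_comm (l m : List X) : shuffle l m = shuffle m l := by
  induction l, m using shuffle.induct with
  | case1 l => rw [shuffle_nil_left, shuffle_nil_right]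
  | case2 x l => rw [shuffle_nil_left, shuffle_nil_right]
  | case3 x l y m ih₁ ih₂ => simp only [shuffle, ih₁, ih₂, add_comm]

/-- The sum over all shuffles of two lists. -/
def shuffleSum (l m : List X) (f : List X → M) : M := ((shuffle l m).map f).sum

theorem shuffleSum_nil_left (l : List X) (f : List X → M) : shuffleSum [] l f = f l := by
  simp [shuffleSum, shuffle_nil_left]

theorem shuffleSum_nil_right (l : List X) (f : List X → M) : shuffleSum l [] f = f l := by
  simp [shuffleSum, shuffle_nil_right]

theorem shuffleSum_cons_cons (x y : X) (l m : List X) (f : List X → M) :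
    shuffleSum (x :: l) (y :: m) f =
      shuffleSum l (y :: m) (fun s => f (x :: s)) + shuffleSum (x :: l) m fun s => f (y :: s) := by
  simp [shuffleSum, shuffle]

theorem shuffleSum_comm (l m : List X) (f : List X → M) : shuffleSum l m f = shuffleSum m l f := by
  rw [shuffleSum, shuffle_comm, shuffleSum]

theorem shuffleSum_add (l m : List X) (f g : List X → M) :
    (shuffleSum l m fun s => f s + g s) = shuffleSum l m f + shuffleSum l m g := by
  simp [shuffleSum]

theorem map_shuffleSum {F : Type*} [FunLike F M M'] [AddMonoidHomClass F M M'] (φ : F)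
    (l m : List X) (f : List X → M) : φ (shuffleSum l m f) = shuffleSum l m fun s => φ (f s) := by
  simp [shuffleSum, map_multiset_sum]

theorem shuffleSum_assoc (a b c : List X) (f : List X → M) :
    (shuffleSum a b fun l => shuffleSum l c f) = shuffleSum b c fun l => shuffleSum a l f := by
  induction a generalizing b c f with
  | nil => simp only [shuffleSum_nil_left]
  | cons x a iha =>
    induction b generalizing c f with
    | nil => simp only [shuffleSum_nil_left, shuffleSum_nil_right]
    | cons y b ihb =>
      induction c generalizing f with
      | nil => simp only [shuffleSum_nil_right]
      | cons z c ihc =>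
        have hx := iha (y :: b) (z :: c) fun s => f (x :: s)
        have hy := ihb (z :: c) fun s => f (y :: s)
        have hz := ihc fun s => f (z :: s)
        simp only [shuffleSum_cons_cons, shuffleSum_add] at hx hy hz ⊢
        rw [hx, hy, ← hz]
        abel

/-- The sum over all ways to cut a list into an initial and a final segment. -/
def deconcatSum : List X → (List X → List X → M) → M
  | [], f => f [] []
  | x :: l, f => f [] (x :: l) + deconcatSum l fun a b => f (x :: a) b

theorem deconcatSum_congr (l : List X) {f g : List X → List X → M} (h : ∀ a b, f a b = g a b) :
    deconcatSum l f = deconcatSum l g := by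
  rw [funext₂ h]

theorem deconcatSum_add (l : List X) (f g : List X → List X → M) :
    (deconcatSum l fun a b => f a b + g a b) = deconcatSum l f + deconcatSum l g := by
  induction l generalizing f g with
  | nil => rfl
  | cons x l ih => rw [deconcatSum, ih, add_add_add_comm]; rfl

theorem deconcatSum_finset_sum {ι : Type*} (S : Finset ι) (l : List X)
    (f : ι → List X → List X → M) :
    (deconcatSum l fun a b => ∑ i ∈ S, f i a b) = ∑ i ∈ S, deconcatSum l (f i) := by
  induction l generalizing f with
  | nil => rfl
  | cons x l ih => simp only [deconcatSum, ih, Finset.sum_add_distrib]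

theorem map_deconcatSum {F : Type*} [FunLike F M M'] [AddMonoidHomClass F M M'] (φ : F)
    (l : List X) (f : List X → List X → M) :
    φ (deconcatSum l f) = deconcatSum l fun a b => φ (f a b) := by
  induction l generalizing f with
  | nil => rfl
  | cons x l ih => rw [deconcatSum, map_add, ih]; rfl

theorem deconcatSum_mul_deconcatSum {C : Type*} [NonUnitalNonAssocSemiring C] (l m : List X)
    (f g : List X → List X → C) : deconcatSum l f * deconcatSum m g =
      deconcatSum l fun a b => deconcatSum m fun a' b' => f a b * g a' b' :=
  (map_deconcatSum (AddMonoidHom.mulRight (deconcatSum m g)) l f).trans <|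
    deconcatSum_congr l fun a b => map_deconcatSum (AddMonoidHom.mulLeft (f a b)) m g

theorem shuffleSum_deconcatSum (l m : List X) (f : List X → List X → M) :
    (shuffleSum l m fun s => deconcatSum s f) = deconcatSum l fun a b => deconcatSum m fun a' b' =>
      shuffleSum a a' fun u => shuffleSum b b' fun v => f u v := by
  induction l, m using shuffle.induct generalizing f with
  | case1 l => simp only [shuffleSum_nil_left, deconcatSum]
  | case2 x l => simp only [shuffleSum_nil_right, deconcatSum]
  | case3 x l y m ih₁ ih₂ =>
    simp only [shuffleSum_cons_cons, deconcatSum, shuffleSum_add, ih₁, ih₂, shuffleSum_nil_left,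
      shuffleSum_nil_right, deconcatSum_add]
    abel

/-- Replace every letter of a list by each of its weighted substitutes. -/
def substList {C : Type*} [MulOneClass C] (σ : X → Multiset (C × Y)) :
    List X → Multiset (C × List Y)
  | [] => {(1, [])}
  | x :: l => (σ x).bind fun h => (substList σ l).map fun q => (h.1 * q.1, h.2 :: q.2)

theorem wsum_shuffleSum {C A : Type*} [Semiring C] [Module C M] (T : Multiset (C × A))
    (l m : List X) (f : A → List X → M) :
    (wsum T fun a => shuffleSum l m (f a)) = shuffleSum l m fun s => wsum T fun a => f a s := by
  simp only [wsum, shuffleSum, Multiset.smul_sum, Multiset.map_map, Function.comp_def]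
  exact Multiset.sum_map_sum_map _ _

section Subst

variable {C : Type*} [CommSemiring C] [Module C M] (σ : X → Multiset (C × Y))

theorem wsum_substList_nil (f : List Y → M) : wsum (substList σ []) f = f [] := by
  simp [substList, wsum]

theorem wsum_substList_cons (x : X) (l : List X) (f : List Y → M) :
    wsum (substList σ (x :: l)) f =
      wsum (σ x) fun y => wsum (substList σ l) fun m => f (y :: m) := by
  rw [substList]
  exact wsum_bind_map _ _ (fun y m => y :: m) f

theorem shuffleSum_substList (l m : List X) (f : List Y → M) :
    (shuffleSum l m fun s => wsum (substList σ s) f) =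
      wsum (substList σ l) fun a => wsum (substList σ m) fun b => shuffleSum a b f := by
  induction l, m using shuffle.induct generalizing f with
  | case1 l => simp only [shuffleSum_nil_left, wsum_substList_nil]
  | case2 x l => simp only [shuffleSum_nil_right, wsum_substList_nil]
  | case3 x l y m ih₁ ih₂ =>
    simp only [shuffleSum_cons_cons, wsum_substList_cons, ← wsum_shuffleSum, ih₁, ih₂, wsum_add]
    congr 1
    rw [wsum_comm]
    exact wsum_congr _ fun y => wsum_comm _ _ _

end Subst

end Shuffle

/-! ## Characters of divided powers and of shuffles -/

/-- A family which multiplies like divided powers. -/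
structure IsDividedPowers {C : Type*} [CommSemiring C] (x : MIdx d → C) : Prop where
  zero : x 0 = 1
  mul : ∀ a b, x a * x b = (addChoose a b : C) * x (a + b)

/-- A family indexed by words which multiplies by shuffling the words. -/
structure IsShuffleChar {C : Type*} [CommSemiring C] {X : Type} (U : List X → C) : Prop where
  nil : U [] = 1
  mul : ∀ l m, U l * U m = shuffleSum l m U

section Characters

variable {C : Type*} [CommSemiring C] {X Y : Type}

theorem IsDividedPowers.splitSum {x y : MIdx d → C} (hx : IsDividedPowers x)
    (hy : IsDividedPowers y) : IsDividedPowers fun n => splitSum n fun a b => x a * y b where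
  zero := by rw [splitSum_zero, hx.zero, hy.zero, mul_one]
  mul p q := by
    rw [← nsmul_eq_mul, addChoose_smul_splitSum_add]
    simp only [PlanarRS.splitSum, Finset.sum_mul_sum]
    refine Finset.sum_congr rfl fun a _ => Finset.sum_congr rfl fun b _ => ?_
    rw [mul_mul_mul_comm, hx.mul, hy.mul, nsmul_eq_mul, Nat.cast_mul]
    ring

theorem IsShuffleChar.deconcatSum {U V : List X → C} (hU : IsShuffleChar U)
    (hV : IsShuffleChar V) : IsShuffleChar fun l => deconcatSum l fun a b => U a * V b where
  nil := by rw [PlanarRS.deconcatSum, hU.nil, hV.nil, mul_one]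
  mul l m := by
    rw [shuffleSum_deconcatSum, deconcatSum_mul_deconcatSum]
    refine deconcatSum_congr l fun a b => deconcatSum_congr m fun a' b' => ?_
    rw [mul_mul_mul_comm, hU.mul, hV.mul]
    simp only [shuffleSum, Multiset.sum_map_mul_left, Multiset.sum_map_mul_right]

theorem IsShuffleChar.substList {C₀ : Type*} [CommSemiring C₀] [Algebra C₀ C]
    (σ : X → Multiset (C₀ × Y)) {U : List Y → C} (hU : IsShuffleChar U) :
    IsShuffleChar fun l => wsum (substList σ l) U where
  nil := by rw [wsum_substList_nil, hU.nil]
  mul l m := by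
    rw [shuffleSum_substList, ← smul_eq_mul, ← wsum_smul_right]
    simp only [← hU.mul, ← smul_eq_mul, wsum_smul]

end Characters

/-! ## The universal algebra with divided powers and a shuffle character -/

/-- The tensor product of a divided power algebra and a shuffle algebra: the free module on the
pairs of a multi-index and a word, with the divided power product on the former and the shuffle
product on the latter. -/
def DPShuffle (d : ℕ) (X : Type) (C : Type*) [CommRing C] : Type _ := (MIdx d × List X) →₀ C

namespace DPShuffle

variable {X : Type} {C₀ C : Type*} [CommRing C] [CommSemiring C₀] [Algebra C₀ C]

noncomputable instance : AddCommGroup (DPShuffle d X C) := inferInstanceAs (AddCommGroup (_ →₀ C))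

noncomputable instance : Module C₀ (DPShuffle d X C) := inferInstanceAs (Module C₀ (_ →₀ C))

instance : IsScalarTower C₀ C (DPShuffle d X C) := inferInstanceAs (IsScalarTower C₀ C (_ →₀ C))

/-- The basis element of a multi-index and a word. -/
noncomputable def basis (a : MIdx d) (l : List X) : DPShuffle d X C :=
  (Finsupp.single (a, l) 1 : (MIdx d × List X) →₀ C)

section Lift

variable {M : Type*} [AddCommGroup M] [Module C M]

/-- The linear map with prescribed values on the basis. -/
noncomputable def lift (f : MIdx d → List X → M) : DPShuffle d X C →ₗ[C] M :=
  Finsupp.linearCombination C fun q : MIdx d × List X => f q.1 q.2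

theorem lift_basis (f : MIdx d → List X → M) (a : MIdx d) (l : List X) :
    lift f (basis a l : DPShuffle d X C) = f a l :=
  (Finsupp.linearCombination_single C _ _).trans (one_smul _ _)

theorem hom_ext {φ ψ : DPShuffle d X C →ₗ[C] M} (h : ∀ a l, φ (basis a l) = ψ (basis a l)) :
    φ = ψ :=
  Finsupp.lhom_ext' fun q => LinearMap.ext_ring (h q.1 q.2)

end Lift

/-- The product, as a bilinear map. -/
noncomputable def mulHom : DPShuffle d X C →ₗ[C] DPShuffle d X C →ₗ[C] DPShuffle d X C :=
  lift fun a l => lift fun b m => addChoose a b • shuffleSum l m fun s => basis (a + b) s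

theorem mulHom_basis (a b : MIdx d) (l m : List X) :
    mulHom (basis a l : DPShuffle d X C) (basis b m) =
      addChoose a b • shuffleSum l m fun s => basis (a + b) s := by
  rw [mulHom, lift_basis, lift_basis]

theorem mulHom_comm (u v : DPShuffle d X C) : mulHom u v = mulHom v u := by
  have h : (mulHom : DPShuffle d X C →ₗ[C] _) = mulHom.flip :=
    hom_ext fun a l => hom_ext fun b m => by
      rw [LinearMap.flip_apply, mulHom_basis, mulHom_basis, addChoose_comm, shuffleSum_comm,
        add_comm a b]
  exact LinearMap.congr_fun₂ h u v

theorem mulHom_assoc_basis (a b c : MIdx d) (l m n : List X) :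
    mulHom (mulHom (basis a l : DPShuffle d X C) (basis b m)) (basis c n) =
      mulHom (basis a l) (mulHom (basis b m) (basis c n)) := by
  rw [mulHom_basis, mulHom_basis b, ← LinearMap.flip_apply]
  simp only [map_nsmul, map_shuffleSum, LinearMap.flip_apply, mulHom_basis]
  have smul_out (k : ℕ) (u v : List X) (f : List X → DPShuffle d X C) :
      (shuffleSum u v fun s => k • f s) = k • shuffleSum u v f :=
    (map_shuffleSum (DistribSMul.toAddMonoidHom _ k) u v f).symm
  rw [smul_out, smul_out, smul_smul, smul_smul, shuffleSum_assoc, addChoose_assoc, add_assoc]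

theorem mulHom_assoc (u v z : DPShuffle d X C) :
    mulHom (mulHom u v) z = mulHom u (mulHom v z) := by
  have h : (LinearMap.llcomp C _ _ _ mulHom ∘ₗ mulHom : DPShuffle d X C →ₗ[C] _) =
      (LinearMap.llcomp C (DPShuffle d X C) _ (DPShuffle d X C →ₗ[C] DPShuffle d X C)).flip
        mulHom ∘ₗ LinearMap.llcomp C _ _ _ ∘ₗ mulHom :=
    hom_ext fun a l => hom_ext fun b m => hom_ext fun c n => mulHom_assoc_basis a b c l m n
  exact LinearMap.congr_fun (LinearMap.congr_fun₂ h u v) z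

theorem mulHom_basis_zero_nil (u : DPShuffle d X C) : mulHom (basis 0 []) u = u := by
  have h : mulHom (basis 0 [] : DPShuffle d X C) = LinearMap.id :=
    hom_ext fun a l => by
      rw [mulHom_basis, addChoose_zero_left, one_smul, shuffleSum_nil_left, zero_add,
        LinearMap.id_apply]
  exact LinearMap.congr_fun h u

noncomputable instance : CommRing (DPShuffle d X C) :=
  { (inferInstance : AddCommGroup (DPShuffle d X C)) with
    mul := fun u v => mulHom u v
    one := basis 0 []
    left_distrib := fun u v z => map_add (mulHom u) v z
    right_distrib := fun u v z => LinearMap.map_add₂ mulHom u v z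
    zero_mul := fun u => LinearMap.map_zero₂ mulHom u
    mul_zero := fun u => map_zero (mulHom u)
    mul_assoc := mulHom_assoc
    one_mul := mulHom_basis_zero_nil
    mul_one := fun u => (mulHom_comm u _).trans (mulHom_basis_zero_nil u)
    mul_comm := mulHom_comm }

noncomputable instance : Algebra C₀ (DPShuffle d X C) :=
  Algebra.ofModule
    (fun c u v => by
      rw [← algebraMap_smul C c u, ← algebraMap_smul C c (u * v)]
      exact LinearMap.map_smul₂ mulHom _ u v)
    fun c u v => by
      rw [← algebraMap_smul C c v, ← algebraMap_smul C c (u * v)]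
      exact map_smul (mulHom u) _ v

theorem basis_mul_basis (a b : MIdx d) (l m : List X) :
    (basis a l : DPShuffle d X C) * basis b m =
      addChoose a b • shuffleSum l m fun s => basis (a + b) s :=
  mulHom_basis a b l m

theorem isDividedPowers_basis :
    IsDividedPowers fun a : MIdx d => (basis a [] : DPShuffle d X C) where
  zero := rfl
  mul a b := by rw [basis_mul_basis, shuffleSum_nil_left, nsmul_eq_mul]

theorem isShuffleChar_basis : IsShuffleChar fun l : List X => (basis 0 l : DPShuffle d X C) where
  nil := rfl
  mul l m := by rw [basis_mul_basis, addChoose_zero_left, one_smul, zero_add]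

theorem basis_eq_mul (a : MIdx d) (l : List X) :
    (basis a l : DPShuffle d X C) = basis a [] * basis 0 l := by
  rw [basis_mul_basis, addChoose_zero_right, one_smul, shuffleSum_nil_left, add_zero]

end DPShuffle

/-! ## Weighted contractions -/

/-- The parameters of a weighted contraction procedure: an edge decoration may be increased by any
`ℓ` in the box `{0, …, box}^d`, with weight `weight ℓ`; a contracted subtree `σ` has weight
`subtreeWeight σ` and leaves a vertex with second decoration `subtreeExdec σ`. -/
structure ContractionRule (d : ℕ) (K Ξ O : Type) (C₀ : Type*) where
  weight : MIdx d → C₀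
  box : ℕ
  subtreeWeight : PTree d K Ξ O true → C₀
  subtreeExdec : PTree d K Ξ O true → O

/-- A tree with weight `1`. -/
def pureTree {C₀ : Type*} [One C₀] (t : PTree d K Ξ O true) : Multiset (C₀ × PTree d K Ξ O true) :=
  {(1, t)}

/-- The limbs among the branches at a vertex. -/
def limbsOf : {b : Bool} → Branches d K Ξ O b → List (Limb d K Ξ O)
  | _, .nil => []
  | _, .kernel k e n o above rest => ⟨k, e, ⟨n, o, above⟩⟩ :: limbsOf rest
  | _, .noise _ _ _ _ rest => limbsOf rest

theorem limbsOf_ofLimbs {b : Bool} (l : List (Limb d K Ξ O)) :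
    limbsOf (ofLimbs l : Branches d K Ξ O b) = l := by
  induction l with
  | nil => rfl
  | cons z l ih => simp only [ofLimbs, limbsOf, ih]

/-- Replace the tree on top of a limb by its weighted images under `T`. -/
def onLimb {C : Type*} (T : PTree d K Ξ O true → Multiset (C × PTree d K Ξ O true))
    (z : Limb d K Ξ O) : Multiset (C × Limb d K Ξ O) :=
  (T z.tree).map fun h => (h.1, ⟨z.k, z.e, h.2⟩)

theorem wsum_onLimb {C M : Type*} [AddCommMonoid M] [SMul C M]
    (T : PTree d K Ξ O true → Multiset (C × PTree d K Ξ O true)) (z : Limb d K Ξ O)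
    (f : Limb d K Ξ O → M) : wsum (onLimb T z) f = wsum (T z.tree) fun h => f ⟨z.k, z.e, h⟩ := by
  simp [wsum, onLimb]

namespace ContractionRule

variable {C₀ : Type*} [CommSemiring C₀] (r : ContractionRule d K Ξ O C₀)

/-- The values by which an edge decoration may be increased. -/
def increases : Finset (MIdx d) := Finset.Iic fun _ => r.box

/-- The weighted form of `PlanarRS.cutStep`. -/
def cutStep {b : Bool} (k : K) (e : MIdx d) (heads : Multiset (C₀ × PTree d K Ξ O true))
    (rests : Multiset (BranchCut C₀ d K Ξ O b)) : Multiset (BranchCut C₀ d K Ξ O b) :=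
  r.increases.val.bind fun ℓ => heads.bind fun h => rests.map fun t =>
    ⟨h.1 * t.coef * (mchoose (t.shift + ℓ) ℓ : C₀) * r.weight ℓ, t.red, t.shift + ℓ,
      ⟨k, e + ℓ, h.2⟩ :: t.own, t.deep, t.kept⟩

/-- The weighted form of `PlanarRS.cuts`, with every tree that is cut off replaced by its weighted
images under `H`. -/
def cutsWith (H : PTree d K Ξ O true → Multiset (C₀ × PTree d K Ξ O true)) :
    Bool → {b : Bool} → Branches d K Ξ O b → Multiset (BranchCut C₀ d K Ξ O b)
  | _, _, .nil => nilStep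
  | true, _, .kernel k e n o above rest =>
      r.cutStep k e (H ⟨n, o, above⟩) (cutsWith H true rest) +
        keepStep k e (closeVertex n o (cutsWith H true above)) (cutsWith H false rest)
  | false, _, .kernel k e n o above rest =>
      keepStep k e (closeVertex n o (cutsWith H true above)) (cutsWith H false rest)
  | _, _, .noise ξ e n o rest => noiseStep ξ e n o (cutsWith H false rest)

/-- The weighted form of `PlanarRS.contractVertex`. -/
def contractVertex (n : MIdx d) (o : O) (A : Multiset (C₀ × Branches d K Ξ O true))
    (E : Multiset (BranchCut C₀ d K Ξ O true)) : Multiset (C₀ × PTree d K Ξ O true) :=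
  A.map (fun q => (q.1, ⟨n, o, q.2⟩)) +
    (closeVertex n o E).map fun s =>
      (s.coef * r.subtreeWeight s.trunk, ⟨s.red, r.subtreeExdec s.trunk, ofLimbs s.pruned⟩)

mutual

/-- The weighted form of `PlanarRS.contract`. -/
def contract : {b : Bool} → Branches d K Ξ O b → Multiset (C₀ × Branches d K Ξ O b)
  | _, .nil => {(1, .nil)}
  | _, .kernel k e n o above rest =>
      (r.contractVertex n o (contract above) (extract true above)).bind fun h =>
        (contract rest).map fun q => (h.1 * q.1, .kernel k e h.2.dec h.2.exdec h.2.br q.2)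
  | _, .noise ξ e n o rest => (contract rest).map fun q => (q.1, .noise ξ e n o q.2)

/-- The weighted form of `PlanarRS.extract`. -/
def extract : Bool → {b : Bool} → Branches d K Ξ O b → Multiset (BranchCut C₀ d K Ξ O b)
  | _, _, .nil => nilStep
  | true, _, .kernel k e n o above rest =>
      r.cutStep k e (r.contractVertex n o (contract above) (extract true above))
          (extract true rest) +
        keepStep k e (closeVertex n o (extract true above)) (extract false rest)
  | false, _, .kernel k e n o above rest =>
      keepStep k e (closeVertex n o (extract true above)) (extract false rest)
  | _, _, .noise ξ e n o rest => noiseStep ξ e n o (extract false rest)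

end

/-- All weighted contractions of a tree. -/
def contractTree (t : PTree d K Ξ O true) : Multiset (C₀ × PTree d K Ξ O true) :=
  r.contractVertex t.dec t.exdec (r.contract t.br) (r.extract true t.br)

/-- All weighted contractions inside the trees on top of a list of limbs. -/
def contractLimbs (l : List (Limb d K Ξ O)) : Multiset (C₀ × List (Limb d K Ξ O)) :=
  substList (onLimb r.contractTree) l

theorem extract_eq_cutsWith (c : Bool) {b : Bool} (br : Branches d K Ξ O b) :
    r.extract c br = r.cutsWith r.contractTree c br := by
  induction br generalizing c with
  | nil => cases c <;> simp only [extract, cutsWith]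
  | kernel k e n o above rest ih₁ ih₂ =>
    cases c <;> simp only [extract, cutsWith, contractTree, ih₁, ih₂]
  | noise ξ e n o rest ih => cases c <;> simp only [extract, cutsWith, ih]

section Recursion

variable {M : Type*} [AddCommMonoid M] [Module C₀ M]

theorem wsum_contract_nil {b : Bool} (F : Branches d K Ξ O b → M) :
    wsum (r.contract .nil) F = F .nil := by
  simp [wsum, contract]

theorem wsum_contract_noise (ξ : Ξ) (e n : MIdx d) (o : O) (rest : Branches d K Ξ O false)
    (F : Branches d K Ξ O true → M) :
    wsum (r.contract (.noise ξ e n o rest)) F =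
      wsum (r.contract rest) fun κ => F (.noise ξ e n o κ) := by
  simp [wsum, contract]

theorem wsum_contract_kernel {b : Bool} (k : K) (e n : MIdx d) (o : O)
    (above : Branches d K Ξ O true) (rest : Branches d K Ξ O b) (F : Branches d K Ξ O b → M) :
    wsum (r.contract (.kernel k e n o above rest)) F =
      wsum (r.contractTree ⟨n, o, above⟩) fun h => wsum (r.contract rest) fun κ =>
        F (.kernel k e h.dec h.exdec h.br κ) := by
  rw [contract]
  exact wsum_bind_map (C := C₀) _ _
    (fun (h : PTree d K Ξ O true) κ => .kernel k e h.dec h.exdec h.br κ) F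

theorem wsum_contractLimbs_nil (f : List (Limb d K Ξ O) → M) :
    wsum (r.contractLimbs []) f = f [] :=
  wsum_substList_nil _ f

theorem wsum_contractLimbs_cons (z : Limb d K Ξ O) (l : List (Limb d K Ξ O))
    (f : List (Limb d K Ξ O) → M) :
    wsum (r.contractLimbs (z :: l)) f = wsum (r.contractTree z.tree) fun h =>
      wsum (r.contractLimbs l) fun m => f (⟨z.k, z.e, h⟩ :: m) := by
  simp only [contractLimbs, wsum_substList_cons, wsum_onLimb]

theorem wsum_contract_ofLimbs {b : Bool} (l : List (Limb d K Ξ O)) (F : Branches d K Ξ O b → M) :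
    wsum (r.contract (ofLimbs l)) F = wsum (r.contractLimbs l) fun m => F (ofLimbs m) := by
  induction l generalizing F with
  | nil => simp only [ofLimbs, wsum_contract_nil, wsum_contractLimbs_nil]
  | cons z l ih => simp only [ofLimbs, wsum_contract_kernel, wsum_contractLimbs_cons, ih]

end Recursion

end ContractionRule

/-! ## Evaluation of cuts along a character -/

/-- A character of the tensor product of the divided power algebra and the shuffle algebra on limbs:
it evaluates what has been taken off the decorations and the limbs that have been cut off. -/
structure Character (d : ℕ) (K Ξ O : Type) (C : Type*) [CommSemiring C] where
  x : MIdx d → C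
  U : List (Limb d K Ξ O) → C
  isDividedPowers : IsDividedPowers x
  isShuffleChar : IsShuffleChar U

/-- What remains of a term obtained by cutting inside the branches at a vertex, once the reductions
and the deep limbs have been evaluated. -/
structure Stump (d : ℕ) (K Ξ O : Type) (b : Bool) where
  shift : MIdx d
  own : List (Limb d K Ξ O)
  kept : Branches d K Ξ O b

/-- Add a kernel edge with the tree `t` on top of it to the left of the kept branches. -/
def Stump.consKernel {b : Bool} (k : K) (e : MIdx d) (t : PTree d K Ξ O true)
    (s : Stump d K Ξ O b) : Stump d K Ξ O b :=
  ⟨s.shift, s.own, .kernel k e t.dec t.exdec t.br s.kept⟩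

/-- Add a noise edge to the left of the kept branches. -/
def Stump.consNoise (ξ : Ξ) (e n : MIdx d) (o : O) (s : Stump d K Ξ O false) :
    Stump d K Ξ O true :=
  ⟨s.shift, s.own, .noise ξ e n o s.kept⟩

/-- Add a limb to the left of the limbs that have been cut off, and increase the decoration of its
edge by `ℓ`. -/
def Stump.consCut {b : Bool} (z : Limb d K Ξ O) (ℓ : MIdx d) (s : Stump d K Ξ O b) :
    Stump d K Ξ O b :=
  ⟨s.shift + ℓ, ⟨z.k, z.e + ℓ, z.tree⟩ :: s.own, s.kept⟩

namespace Character

variable {C₀ C : Type*} [CommSemiring C₀] [CommSemiring C] [Algebra C₀ C]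
  (χ : Character d K Ξ O C)

/-- The value of the character on a pair of a multi-index and a word. -/
def eval (a : MIdx d) (l : List (Limb d K Ξ O)) : C := χ.x a * χ.U l

theorem eval_zero_nil : χ.eval 0 [] = 1 := by
  rw [eval, χ.isDividedPowers.zero, χ.isShuffleChar.nil, mul_one]

theorem eval_mul_eval (a b : MIdx d) (l m : List (Limb d K Ξ O)) :
    χ.eval a l * χ.eval b m = addChoose a b • shuffleSum l m fun s => χ.eval (a + b) s := by
  simp only [eval]
  rw [mul_mul_mul_comm, χ.isDividedPowers.mul, χ.isShuffleChar.mul, nsmul_eq_mul, mul_assoc,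
    shuffleSum, shuffleSum, Multiset.sum_map_mul_left]

/-- Evaluate the reductions and the deep limbs of terms. -/
def evalBranchCuts {b : Bool} (T : Multiset (BranchCut C₀ d K Ξ O b)) :
    Multiset (C × Stump d K Ξ O b) :=
  T.map fun t => (t.coef • χ.eval t.red t.deep, ⟨t.shift, t.own, t.kept⟩)

/-- Evaluate the reductions and the pruned limbs of terms. -/
def evalTreeCuts {b : Bool} (T : Multiset (TreeCut C₀ d K Ξ O b)) :
    Multiset (C × PTree d K Ξ O b) :=
  T.map fun s => (s.coef • χ.eval s.red s.pruned, s.trunk)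

variable {M : Type*} [AddCommMonoid M] [Module C M]

theorem wsum_evalBranchCuts {b : Bool} (T : Multiset (BranchCut C₀ d K Ξ O b))
    (F : Stump d K Ξ O b → M) :
    wsum (χ.evalBranchCuts T) F =
      (T.map fun t => (t.coef • χ.eval t.red t.deep) • F ⟨t.shift, t.own, t.kept⟩).sum := by
  simp [wsum, evalBranchCuts]

theorem wsum_evalTreeCuts {b : Bool} (T : Multiset (TreeCut C₀ d K Ξ O b))
    (f : PTree d K Ξ O b → M) :
    wsum (χ.evalTreeCuts T) f =
      (T.map fun s => (s.coef • χ.eval s.red s.pruned) • f s.trunk).sum := by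
  simp [wsum, evalTreeCuts]

theorem wsum_nilStep {b : Bool} (F : Stump d K Ξ O b → M) :
    wsum (χ.evalBranchCuts (nilStep : Multiset (BranchCut C₀ d K Ξ O b))) F = F ⟨0, [], .nil⟩ := by
  simp [wsum_evalBranchCuts, nilStep, χ.eval_zero_nil]

theorem wsum_noiseStep (ξ : Ξ) (e n : MIdx d) (o : O)
    (rests : Multiset (BranchCut C₀ d K Ξ O false)) (F : Stump d K Ξ O true → M) :
    wsum (χ.evalBranchCuts (noiseStep ξ e n o rests)) F =
      wsum (χ.evalBranchCuts rests) fun s => F (s.consNoise ξ e n o) := by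
  simp [wsum_evalBranchCuts, noiseStep, Stump.consNoise]

theorem sum_shuffle_smul_eval (c : C₀) (a b : MIdx d) (l m : List (Limb d K Ξ O)) (y : M) :
    ((shuffle l m).map fun s => ((c * (addChoose a b : C₀)) • χ.eval (a + b) s) • y).sum =
      (c • (χ.eval a l * χ.eval b m)) • y := by
  rw [eval_mul_eval, shuffleSum, Multiset.smul_sum, Multiset.smul_sum, Multiset.sum_smul]
  simp only [Multiset.map_map, Function.comp_def, mul_smul, Nat.cast_smul_eq_nsmul]

theorem wsum_keepStep {b : Bool} (k : K) (e : MIdx d)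
    (aboves : Multiset (TreeCut C₀ d K Ξ O true)) (rests : Multiset (BranchCut C₀ d K Ξ O b))
    (F : Stump d K Ξ O b → M) :
    wsum (χ.evalBranchCuts (keepStep k e aboves rests)) F =
      wsum (χ.evalTreeCuts aboves) fun t => wsum (χ.evalBranchCuts rests) fun s =>
        F (s.consKernel k e t) := by
  simp only [wsum_evalBranchCuts, wsum_evalTreeCuts, keepStep, Multiset.map_bind,
    Multiset.sum_bind, Multiset.map_map, Function.comp_def, Multiset.smul_sum]
  refine congrArg Multiset.sum (Multiset.map_congr rfl fun s _ => congrArg Multiset.sum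
    (Multiset.map_congr rfl fun t _ => ?_))
  simp only [mchoose_add_left, Stump.consKernel]
  rw [χ.sum_shuffle_smul_eval, smul_smul, smul_mul_smul_comm]

theorem wsum_closeVertex {b : Bool} (n : MIdx d) (o : O)
    (terms : Multiset (BranchCut C₀ d K Ξ O b)) (f : PTree d K Ξ O b → M) :
    wsum (χ.evalTreeCuts (closeVertex n o terms)) f =
      wsum (χ.evalBranchCuts terms) fun s => splitSum n fun a q =>
        χ.eval a s.own • addChoose q s.shift • f ⟨q + s.shift, o, s.kept⟩ := by
  rw [wsum_splitSum]
  simp only [wsum_evalBranchCuts, wsum_evalTreeCuts, closeVertex, Multiset.map_bind,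
    Multiset.sum_bind, Multiset.map_map, Function.comp_def, splitSum, Finset.sum]
  refine congrArg Multiset.sum (Multiset.map_congr rfl fun a _ => congrArg Multiset.sum
    (Multiset.map_congr rfl fun t _ => ?_))
  simp only [mchoose_add_left, mchoose_add_right, Nat.cast_mul, ← mul_assoc]
  rw [χ.sum_shuffle_smul_eval, mul_smul, Nat.cast_smul_eq_nsmul, smul_comm t.coef, smul_assoc,
    mul_comm, ← smul_mul_assoc, mul_smul, smul_comm (χ.eval a t.own), smul_comm (t.coef • _)]
  rw [smul_comm (t.coef • _), smul_comm (t.coef • _)]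

variable [Module C₀ M] [IsScalarTower C₀ C M] (r : ContractionRule d K Ξ O C₀)

theorem wsum_cutStep {b : Bool} (k : K) (e : MIdx d)
    (heads : Multiset (C₀ × PTree d K Ξ O true)) (rests : Multiset (BranchCut C₀ d K Ξ O b))
    (F : Stump d K Ξ O b → M) :
    wsum (χ.evalBranchCuts (r.cutStep k e heads rests)) F =
      ∑ ℓ ∈ r.increases, r.weight ℓ • wsum heads fun h => wsum (χ.evalBranchCuts rests) fun s =>
        addChoose s.shift ℓ • F (s.consCut ⟨k, e, h⟩ ℓ) := by
  simp only [wsum, evalBranchCuts, ContractionRule.cutStep, Multiset.map_bind, Multiset.sum_bind,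
    Multiset.map_map, Function.comp_def, Finset.sum, Multiset.smul_sum, Stump.consCut]
  refine congrArg Multiset.sum (Multiset.map_congr rfl fun ℓ _ => congrArg Multiset.sum
    (Multiset.map_congr rfl fun h _ => congrArg Multiset.sum
      (Multiset.map_congr rfl fun t _ => ?_)))
  rw [mchoose_add_right]
  simp only [smul_assoc, mul_smul, Nat.cast_smul_eq_nsmul]
  rw [smul_comm (addChoose _ _) (r.weight ℓ), smul_comm t.coef (r.weight ℓ),
    smul_comm h.1 (r.weight ℓ), smul_comm (addChoose _ _) (χ.eval _ _)]

end Character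

namespace ContractionRule

variable {C₀ C : Type*} [CommSemiring C₀] [CommSemiring C] [Algebra C₀ C]
  (r : ContractionRule d K Ξ O C₀) (χ : Character d K Ξ O C)
  (H : PTree d K Ξ O true → Multiset (C₀ × PTree d K Ξ O true))

/-- The cuts inside the branches at a vertex, evaluated along a character. -/
def branchCuts (c : Bool) {b : Bool} (br : Branches d K Ξ O b) : Multiset (C × Stump d K Ξ O b) :=
  χ.evalBranchCuts (r.cutsWith H c br)

/-- The cuts of a tree, evaluated along a character. -/
def treeCuts (t : PTree d K Ξ O true) : Multiset (C × PTree d K Ξ O true) :=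
  χ.evalTreeCuts (closeVertex t.dec t.exdec (r.cutsWith H true t.br))

section Recursion

variable {M : Type*} [AddCommMonoid M] [Module C M]

theorem wsum_branchCuts_nil (c : Bool) {b : Bool} (F : Stump d K Ξ O b → M) :
    wsum (r.branchCuts χ H c .nil) F = F ⟨0, [], .nil⟩ := by
  cases c <;> simp only [branchCuts, cutsWith, χ.wsum_nilStep]

theorem wsum_branchCuts_noise (c : Bool) (ξ : Ξ) (e n : MIdx d) (o : O)
    (rest : Branches d K Ξ O false) (F : Stump d K Ξ O true → M) :
    wsum (r.branchCuts χ H c (.noise ξ e n o rest)) F =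
      wsum (r.branchCuts χ H false rest) fun s => F (s.consNoise ξ e n o) := by
  cases c <;> simp only [branchCuts, cutsWith, χ.wsum_noiseStep]

theorem wsum_branchCuts_false_kernel {b : Bool} (k : K) (e n : MIdx d) (o : O)
    (above : Branches d K Ξ O true) (rest : Branches d K Ξ O b) (F : Stump d K Ξ O b → M) :
    wsum (r.branchCuts χ H false (.kernel k e n o above rest)) F =
      wsum (r.treeCuts χ H ⟨n, o, above⟩) fun t => wsum (r.branchCuts χ H false rest) fun s =>
        F (s.consKernel k e t) := by
  simp only [branchCuts, treeCuts, cutsWith, χ.wsum_keepStep]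

theorem wsum_treeCuts_mk (n : MIdx d) (o : O) (br : Branches d K Ξ O true)
    (f : PTree d K Ξ O true → M) :
    wsum (r.treeCuts χ H ⟨n, o, br⟩) f =
      wsum (r.branchCuts χ H true br) fun s => splitSum n fun a q =>
        χ.eval a s.own • addChoose q s.shift • f ⟨q + s.shift, o, s.kept⟩ := by
  simp only [branchCuts, treeCuts, χ.wsum_closeVertex]

theorem wsum_branchCuts_false {b : Bool} (br : Branches d K Ξ O b) (F : Stump d K Ξ O b → M) :
    wsum (r.branchCuts χ H false br) F =
      wsum (r.branchCuts χ H false br) fun s => F ⟨0, [], s.kept⟩ := by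
  induction br with
  | nil => simp only [wsum_branchCuts_nil]
  | kernel k e n o above rest _ ih =>
    simp only [wsum_branchCuts_false_kernel]
    refine wsum_congr _ fun t => ?_
    rw [ih]
    rfl
  | noise ξ e n o rest ih =>
    simp only [wsum_branchCuts_noise]
    rw [ih]
    rfl

variable [Module C₀ M] [IsScalarTower C₀ C M]

theorem wsum_branchCuts_true_kernel {b : Bool} (k : K) (e n : MIdx d) (o : O)
    (above : Branches d K Ξ O true) (rest : Branches d K Ξ O b) (F : Stump d K Ξ O b → M) :
    wsum (r.branchCuts χ H true (.kernel k e n o above rest)) F =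
      (∑ ℓ ∈ r.increases, r.weight ℓ • wsum (H ⟨n, o, above⟩) fun h =>
        wsum (r.branchCuts χ H true rest) fun s =>
          addChoose s.shift ℓ • F (s.consCut ⟨k, e, h⟩ ℓ)) +
      wsum (r.treeCuts χ H ⟨n, o, above⟩) fun t => wsum (r.branchCuts χ H false rest) fun s =>
        F (s.consKernel k e t) := by
  rw [branchCuts, cutsWith, Character.evalBranchCuts, Multiset.map_add, wsum_add_left]
  exact congrArg₂ _ (χ.wsum_cutStep r k e _ _ F) (χ.wsum_keepStep k e _ _ F)

end Recursion

theorem wsum_pureTree {M : Type*} [AddCommMonoid M] [Module C₀ M] (t : PTree d K Ξ O true)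
    (f : PTree d K Ξ O true → M) : wsum (pureTree t : Multiset (C₀ × _)) f = f t := by
  simp [pureTree, wsum]

end ContractionRule

/-! ## New characters from old ones -/

namespace ContractionRule

variable {C₀ C : Type*} [CommSemiring C₀] [CommSemiring C] [Algebra C₀ C]
  (r : ContractionRule d K Ξ O C₀) (χ η : Character d K Ξ O C)

/-- The deformed copies of a limb that has been cut off, weighted along `η`. -/
def shiftLimb (z : Limb d K Ξ O) : Multiset (C × Limb d K Ξ O) :=
  r.increases.val.map fun ℓ => (r.weight ℓ • η.x ℓ, ⟨z.k, z.e + ℓ, z.tree⟩)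

theorem wsum_shiftLimb {M : Type*} [AddCommMonoid M] [Module C M] (z : Limb d K Ξ O)
    (f : Limb d K Ξ O → M) :
    wsum (r.shiftLimb η z) f =
      ∑ ℓ ∈ r.increases, (r.weight ℓ • η.x ℓ) • f ⟨z.k, z.e + ℓ, z.tree⟩ := by
  simp only [wsum, shiftLimb, Multiset.map_map, Function.comp_def]
  rfl

/-- The trees cut off a limb are evaluated and the rest of the limb is kept. -/
def trimLimb : Limb d K Ξ O → Multiset (C × Limb d K Ξ O) := onLimb (r.treeCuts χ pureTree)

theorem wsum_branchCuts_false_ofLimbs {M : Type*} [AddCommMonoid M] [Module C M]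
    (l : List (Limb d K Ξ O)) (F : Stump d K Ξ O true → M) :
    wsum (r.branchCuts χ pureTree false (ofLimbs l)) F =
      wsum (substList (r.trimLimb χ) l) fun m => F ⟨0, [], ofLimbs m⟩ := by
  induction l generalizing F with
  | nil => simp only [ofLimbs, wsum_branchCuts_nil, wsum_substList_nil]
  | cons z l ih =>
    simp only [ofLimbs, wsum_branchCuts_false_kernel, wsum_substList_cons, trimLimb, wsum_onLimb,
      ih]
    rfl

theorem wsum_branchCuts_true_ofLimbs (l : List (Limb d K Ξ O)) (U : List (Limb d K Ξ O) → C)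
    (V : Branches d K Ξ O true → C) :
    (wsum (r.branchCuts χ pureTree true (ofLimbs l)) fun s => η.x s.shift * U s.own * V s.kept) =
      deconcatSum l fun a b => wsum (substList (r.shiftLimb η) a) U *
        wsum (substList (r.trimLimb χ) b) fun m => V (ofLimbs m) := by
  induction l generalizing U with
  | nil => simp [ofLimbs, wsum_branchCuts_nil, wsum_substList_nil, deconcatSum,
      η.isDividedPowers.zero]
  | cons z l ih =>
    have keep : (wsum (r.branchCuts χ pureTree false (ofLimbs (z :: l))) fun s =>
        η.x s.shift * U s.own * V s.kept) =
        U [] * wsum (substList (r.trimLimb χ) (z :: l)) fun m => V (ofLimbs m) := by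
      rw [wsum_branchCuts_false_ofLimbs]
      simp only [η.isDividedPowers.zero, one_mul, ← smul_eq_mul (U []), wsum_smul]
    have cut (ℓ : MIdx d) : (wsum (r.branchCuts χ pureTree true (ofLimbs l)) fun s =>
        addChoose s.shift ℓ • (η.x (s.shift + ℓ) * U (⟨z.k, z.e + ℓ, z.tree⟩ :: s.own) *
          V s.kept)) =
        η.x ℓ * deconcatSum l fun a b =>
          (wsum (substList (r.shiftLimb η) a) fun m => U (⟨z.k, z.e + ℓ, z.tree⟩ :: m)) *
          wsum (substList (r.trimLimb χ) b) fun m => V (ofLimbs m) := by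
      rw [← ih, ← smul_eq_mul, ← wsum_smul]
      refine wsum_congr _ fun s => ?_
      rw [nsmul_eq_mul, ← mul_assoc, ← mul_assoc, ← η.isDividedPowers.mul, smul_eq_mul]
      ring
    simp only [ofLimbs, wsum_branchCuts_false_kernel] at keep
    rw [deconcatSum, wsum_substList_nil, ← keep, ofLimbs, wsum_branchCuts_true_kernel, add_comm]
    congr 1
    simp only [wsum_pureTree, Stump.consCut, cut, wsum_substList_cons, wsum_shiftLimb,
      Finset.sum_mul]
    rw [deconcatSum_finset_sum]
    refine Finset.sum_congr rfl fun ℓ _ => ?_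
    rw [← smul_mul_assoc]
    refine (map_deconcatSum (AddMonoidHom.mulLeft (r.weight ℓ • η.x ℓ)) l _).trans ?_
    exact deconcatSum_congr l fun a b => (mul_assoc _ _ _).symm

/-- The character that contracts the limbs before it evaluates them. -/
def pullback : Character d K Ξ O C where
  x := χ.x
  U l := wsum (r.contractLimbs l) χ.U
  isDividedPowers := χ.isDividedPowers
  isShuffleChar := χ.isShuffleChar.substList (onLimb r.contractTree)

/-- The convolution of two characters: what is cut off is evaluated along `χ`, what is kept along
`η`. -/
def conv : Character d K Ξ O C where
  x n := splitSum n fun a b => χ.x a * η.x b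
  U l := wsum (r.branchCuts χ pureTree true (ofLimbs l)) fun s : Stump d K Ξ O true =>
    η.x s.shift * χ.U s.own * η.U (limbsOf s.kept)
  isDividedPowers := χ.isDividedPowers.splitSum η.isDividedPowers
  isShuffleChar := by
    have h := (χ.isShuffleChar.substList (r.shiftLimb η)).deconcatSum
      (η.isShuffleChar.substList (r.trimLimb χ))
    convert h using 2 with l
    rw [wsum_branchCuts_true_ofLimbs r χ η l χ.U fun κ => η.U (limbsOf κ)]
    simp only [limbsOf_ofLimbs]

theorem pullback_eval_smul {M : Type*} [AddCommMonoid M] [Module C₀ M] [Module C M]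
    [IsScalarTower C₀ C M] (a : MIdx d) (l : List (Limb d K Ξ O)) (y : M) :
    (r.pullback χ).eval a l • y = wsum (r.contractLimbs l) fun m => χ.eval a m • y := by
  simp only [Character.eval, mul_smul, wsum_smul, wsum_smul_right]
  rfl

end ContractionRule

/-! ## Cuts commute with contractions -/

section Pointwise

variable {C M : Type*} [CommSemiring C] [AddCommMonoid M] [Module C M]

theorem addChoose_mul_swap (s u ℓ : MIdx d) :
    addChoose s u * addChoose (s + u) ℓ = addChoose s ℓ * addChoose (s + ℓ) u := by
  rw [addChoose_assoc, addChoose_assoc, addChoose_comm u ℓ, add_comm u ℓ]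

theorem smul_splitSum {R : Type*} [DistribSMul R M] (c : R) (n : MIdx d)
    (f : MIdx d → MIdx d → M) : c • splitSum n f = splitSum n fun a b => c • f a b :=
  Finset.smul_sum

theorem splitSum_smul (n : MIdx d) (f : MIdx d → MIdx d → C) (y : M) :
    splitSum n f • y = splitSum n fun a b => f a b • y :=
  Finset.sum_smul

theorem splitSum_mul (n : MIdx d) (f : MIdx d → MIdx d → C) (y : C) :
    splitSum n f * y = splitSum n fun a b => f a b * y :=
  Finset.sum_mul _ _ _

theorem map_splitSum {M' F : Type*} [AddCommMonoid M'] [FunLike F M M'] [AddMonoidHomClass F M M']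
    (φ : F) (n : MIdx d) (f : MIdx d → MIdx d → M) :
    φ (splitSum n f) = splitSum n fun a b => φ (f a b) :=
  map_sum φ _ _

theorem splitSum_comm (n m : MIdx d) (f : MIdx d → MIdx d → MIdx d → MIdx d → M) :
    (splitSum n fun a b => splitSum m fun a' b' => f a b a' b') =
      splitSum m fun a' b' => splitSum n fun a b => f a b a' b' :=
  Finset.sum_comm

theorem sum_sum_smul_splitSum (S : Finset (MIdx d)) (hS : IsLowerSet (S : Set (MIdx d)))
    (w : MIdx d → C) (w_add : ∀ a b, w (a + b) = w a * w b) (w_eq_zero : ∀ a, a ∉ S → w a = 0)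
    (n u : MIdx d) (f : MIdx d → MIdx d → MIdx d → M) :
    ∑ ℓ ∈ S, ∑ ℓ' ∈ S, (splitSum n fun s' s => addChoose s u • w ℓ • w ℓ' •
        addChoose (s + u) ℓ • addChoose s' ℓ' • f (ℓ + ℓ') (s + u + ℓ) (s' + ℓ')) =
      ∑ m ∈ S, w m • addChoose n m •
        splitSum (n + m) fun s' s => addChoose s u • f m (s + u) s' := by
  have split_increase (m : MIdx d) :
      (addChoose n m • splitSum (n + m) fun s' s => addChoose s u • f m (s + u) s') =
        splitSum m fun ℓ' ℓ => splitSum n fun s' s =>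
          (addChoose s' ℓ' * (addChoose s u * addChoose (s + u) ℓ)) •
            f (ℓ + ℓ') (s + u + ℓ) (s' + ℓ') := by
    rw [addChoose_smul_splitSum_add, splitSum_comm]
    refine splitSum_congr fun ℓ' ℓ hm => splitSum_congr fun s' s _ => ?_
    subst hm
    rw [smul_smul, addChoose_mul_swap, mul_assoc, add_comm ℓ ℓ', add_right_comm]
  simp only [split_increase]
  rw [sum_smul_splitSum S hS w w_add w_eq_zero, Finset.sum_comm]
  refine Finset.sum_congr rfl fun ℓ' _ => Finset.sum_congr rfl fun ℓ _ => ?_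
  rw [smul_splitSum, smul_splitSum]
  refine splitSum_congr fun s' s _ => ?_
  simp only [← Nat.cast_smul_eq_nsmul C, smul_smul]
  congr 1
  push_cast
  ring

theorem splitSum_splitSum_mul (x y : MIdx d → C) (hy : IsDividedPowers y) (n m u : MIdx d)
    (f : MIdx d → M) :
    (splitSum m fun s' s => addChoose s u • y s' • splitSum n fun a q =>
        (splitSum a fun b c => x b * y c) • addChoose q (s + u) • f (q + (s + u))) =
      splitSum n fun b q => x b • addChoose q m •
        splitSum (q + m) fun a v => y a • addChoose v u • f (v + u) := by
  have expand_right (b q : MIdx d) :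
      (x b • addChoose q m • splitSum (q + m) fun a v => y a • addChoose v u • f (v + u)) =
        splitSum q fun c q' => splitSum m fun s' s =>
          x b • addChoose s u • y s' • y c • addChoose q' (s + u) • f (q' + (s + u)) := by
    rw [addChoose_smul_splitSum_add, smul_splitSum]
    refine splitSum_congr fun c q' _ => ?_
    rw [smul_splitSum]
    refine splitSum_congr fun s' s _ => ?_
    have hy_mul : (addChoose c s' : C) * y (c + s') = y c * y s' := (hy.mul _ _).symm
    have hassoc : (addChoose q' s : C) * addChoose (q' + s) u =
        addChoose s u * addChoose q' (s + u) := by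
      rw [← Nat.cast_mul, addChoose_assoc, Nat.cast_mul]
    simp only [← Nat.cast_smul_eq_nsmul C, smul_smul, add_assoc]
    congr 1
    push_cast
    calc _ = x b * ((addChoose c s' : C) * y (c + s')) *
        ((addChoose q' s : C) * addChoose (q' + s) u) := by ring
      _ = _ := by rw [hy_mul, hassoc]; ring
  simp only [expand_right]
  rw [← splitSum_assoc n fun b c q' => splitSum m fun s' s =>
    x b • addChoose s u • y s' • y c • addChoose q' (s + u) • f (q' + (s + u))]
  simp only [smul_splitSum, splitSum_smul]
  rw [splitSum_comm]
  refine splitSum_congr fun a q _ => ?_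
  rw [splitSum_comm]
  refine splitSum_congr fun b c _ => splitSum_congr fun s' s _ => ?_
  simp only [← Nat.cast_smul_eq_nsmul C, smul_smul]
  congr 1
  ring

end Pointwise

namespace Character

/-- Extension of scalars of a character. -/
def map {C : Type*} (C' : Type*) [CommSemiring C] [CommSemiring C'] [Algebra C C']
    (χ : Character d K Ξ O C) : Character d K Ξ O C' where
  x a := algebraMap C C' (χ.x a)
  U l := algebraMap C C' (χ.U l)
  isDividedPowers := ⟨by rw [χ.isDividedPowers.zero, map_one], fun a b => by
    rw [← map_mul, χ.isDividedPowers.mul, map_mul, map_natCast]⟩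
  isShuffleChar := ⟨by rw [χ.isShuffleChar.nil, map_one], fun l m => by
    rw [← map_mul, χ.isShuffleChar.mul, map_shuffleSum]⟩

/-- The character with values in the universal algebra from which every other character arises by
specialization. -/
noncomputable def universal (d : ℕ) (K Ξ O : Type) (C : Type*) [CommRing C] :
    Character d K Ξ O (DPShuffle d (Limb d K Ξ O) C) where
  x a := DPShuffle.basis a []
  U l := DPShuffle.basis 0 l
  isDividedPowers := DPShuffle.isDividedPowers_basis
  isShuffleChar := DPShuffle.isShuffleChar_basis

theorem universal_eval {C : Type*} [CommRing C] (a : MIdx d) (l : List (Limb d K Ξ O)) :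
    (universal d K Ξ O C).eval a l = DPShuffle.basis a l :=
  (DPShuffle.basis_eq_mul a l).symm

end Character

namespace ContractionRule

section ExtendScalars

variable {C₀ C C' N : Type*} [CommSemiring C₀] [CommSemiring C] [CommSemiring C'] [Algebra C₀ C]
  [Algebra C₀ C'] [Algebra C C'] [IsScalarTower C₀ C C'] [AddCommMonoid N] [Module C N]
  [Module C' N] [IsScalarTower C C' N] (r : ContractionRule d K Ξ O C₀)
  (χ : Character d K Ξ O C) (H : PTree d K Ξ O true → Multiset (C₀ × PTree d K Ξ O true))

theorem smul_map_eval_smul (c : C₀) (a : MIdx d) (l : List (Limb d K Ξ O)) (y : N) :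
    (c • (χ.map C').eval a l) • y = (c • χ.eval a l) • y := by
  rw [← algebraMap_smul C' (c • χ.eval a l), Algebra.smul_def, Algebra.smul_def,
    IsScalarTower.algebraMap_apply C₀ C C', Character.eval, Character.eval, map_mul, map_mul]
  rfl

theorem wsum_branchCuts_map (c : Bool) {b : Bool} (br : Branches d K Ξ O b)
    (F : Stump d K Ξ O b → N) :
    wsum (r.branchCuts (χ.map C') H c br) F = wsum (r.branchCuts χ H c br) F := by
  simp only [branchCuts, Character.wsum_evalBranchCuts, smul_map_eval_smul]

theorem wsum_treeCuts_map (t : PTree d K Ξ O true) (f : PTree d K Ξ O true → N) :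
    wsum (r.treeCuts (χ.map C') H t) f = wsum (r.treeCuts χ H t) f := by
  simp only [treeCuts, Character.wsum_evalTreeCuts, smul_map_eval_smul]

theorem pullback_map : r.pullback (χ.map C') = (r.pullback χ).map C' := by
  simp only [pullback, Character.map, Character.mk.injEq, true_and]
  funext l
  exact (map_wsum _ (IsScalarTower.toAlgHom C₀ C C').toLinearMap _).symm

end ExtendScalars

end ContractionRule

namespace ContractionRule

section Statements

variable {C₀ : Type u} [CommSemiring C₀] (r : ContractionRule d K Ξ O C₀)

/-- The weights are multiplicative and vanish outside the box once the scalars are extended to `C`,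
so that sums over the box behave like sums over all multi-indices. -/
structure IsTruncated (C : Type*) [CommSemiring C] [Algebra C₀ C] : Prop where
  weight_add : ∀ a b, r.weight (a + b) = r.weight a * r.weight b
  algebraMap_weight : ∀ a ∉ r.increases, algebraMap C₀ C (r.weight a) = 0

variable {r} in
theorem IsTruncated.extend {C : Type*} [CommSemiring C] [Algebra C₀ C] (hr : r.IsTruncated C)
    (C' : Type*) [CommSemiring C'] [Algebra C₀ C'] [Algebra C C'] [IsScalarTower C₀ C C'] :
    r.IsTruncated C' where
  weight_add := hr.weight_add
  algebraMap_weight a ha := by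
    rw [IsScalarTower.algebraMap_apply C₀ C C', hr.algebraMap_weight a ha, map_zero]

variable {r} in
theorem IsTruncated.sum_sum_smul_splitSum {C M : Type*} [CommSemiring C] [Algebra C₀ C]
    [AddCommMonoid M] [Module C₀ M] [Module C M] [IsScalarTower C₀ C M] (hr : r.IsTruncated C)
    (n u : MIdx d) (f : MIdx d → MIdx d → MIdx d → M) :
    ∑ ℓ ∈ r.increases, ∑ ℓ' ∈ r.increases, (splitSum n fun s' s =>
        addChoose s u • r.weight ℓ • r.weight ℓ' • addChoose (s + u) ℓ • addChoose s' ℓ' •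
          f (ℓ + ℓ') (s + u + ℓ) (s' + ℓ')) =
      ∑ m ∈ r.increases, r.weight m • addChoose n m •
        splitSum (n + m) fun s' s => addChoose s u • f m (s + u) s' := by
  have lower : IsLowerSet (r.increases (d := d) : Set (MIdx d)) := by
    rw [increases, Finset.coe_Iic]
    exact isLowerSet_Iic _
  simp only [← algebraMap_smul C (r.weight _)]
  exact PlanarRS.sum_sum_smul_splitSum _ lower (fun ℓ => algebraMap C₀ C (r.weight ℓ))
    (fun a b => by rw [hr.weight_add, map_mul]) hr.algebraMap_weight n u f

/-- Cutting commutes with the contractions inside the branches at a vertex. -/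
def ContractCut {b : Bool} (br : Branches d K Ξ O b) : Prop :=
  ∀ (C : Type u) [CommRing C] [Algebra C₀ C], r.IsTruncated C → ∀ (χ : Character d K Ξ O C)
    (M : Type u) [AddCommGroup M] [Module C₀ M] [Module C M] [IsScalarTower C₀ C M] (c : Bool)
    (F : Stump d K Ξ O b → M),
    (wsum (r.contract br) fun κ => wsum (r.branchCuts χ pureTree c κ) F) =
      wsum (r.branchCuts (r.pullback χ) pureTree c br) fun s =>
        wsum (r.contractLimbs s.own) fun own => wsum (r.contract s.kept) fun κ =>
          F ⟨s.shift, own, κ⟩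

/-- Cutting commutes with the extraction of a subtree that contains the vertex. -/
def ExtractCut {b : Bool} (br : Branches d K Ξ O b) : Prop :=
  ∀ (C : Type u) [CommRing C] [Algebra C₀ C], r.IsTruncated C → ∀ (χ η : Character d K Ξ O C)
    (M : Type u) [AddCommGroup M] [Module C₀ M] [Module C M] [IsScalarTower C₀ C M]
    (c₁ c₂ : Bool), c₁ ≤ c₂ →
    ∀ G : MIdx d → Stump d K Ξ O true → Branches d K Ξ O b → M,
    (wsum (r.branchCuts (r.conv χ η) r.contractTree c₂ br) fun t =>
        wsum (r.branchCuts χ pureTree c₁ (ofLimbs t.own)) fun s => G t.shift s t.kept) =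
      wsum (r.branchCuts (r.pullback χ) pureTree c₁ br) fun t =>
        wsum (r.contractLimbs t.own) fun own =>
          wsum (r.branchCuts η r.contractTree c₂ t.kept) fun u => splitSum t.shift fun s' s =>
            addChoose s u.shift • G (s + u.shift) ⟨s', own, ofLimbs u.own⟩ u.kept

end Statements

/-! ### From the branches at the root to the tree -/

section Tree

variable {C₀ : Type u} [CommSemiring C₀] {r : ContractionRule d K Ξ O C₀} {C : Type u} [CommRing C]
  [Algebra C₀ C] (hr : r.IsTruncated C) (χ η : Character d K Ξ O C) {M : Type u} [AddCommGroup M]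
  [Module C₀ M] [Module C M] [IsScalarTower C₀ C M]

include hr

theorem ExtractCut.tree {br : Branches d K Ξ O true} (h : r.ExtractCut br) (n : MIdx d) (o : O)
    (f : PTree d K Ξ O true → M) :
    wsum (r.treeCuts (r.conv χ η) r.contractTree ⟨n, o, br⟩) f =
      wsum (r.treeCuts (r.pullback χ) pureTree ⟨n, o, br⟩) fun τ =>
        wsum (r.treeCuts η r.contractTree τ) f := by
  have cut_limbs := h C hr χ η M true true le_rfl fun shift s κ =>
    (η.x s.shift * χ.U s.own * η.U (limbsOf s.kept)) • splitSum n fun a q =>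
      (r.conv χ η).x a • addChoose q shift • f ⟨q + shift, o, κ⟩
  rw [wsum_treeCuts_mk, wsum_treeCuts_mk]
  refine Eq.trans (wsum_congr _ fun t => ?_) (cut_limbs.trans (wsum_congr _ fun t => ?_))
  · rw [wsum_smul_right, smul_splitSum]
    refine splitSum_congr fun a q _ => ?_
    rw [smul_smul, mul_comm]
    rfl
  simp only [wsum_treeCuts_mk, limbsOf_ofLimbs, pullback_eval_smul, ← wsum_splitSum, ← wsum_smul]
  refine Eq.trans (wsum_congr _ fun own => wsum_congr _ fun u => ?_) (wsum_comm _ _ _)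
  have close := congrArg (fun y => (χ.U own * η.U u.own) • y)
    (splitSum_splitSum_mul χ.x η.x η.isDividedPowers n t.shift u.shift fun v => f ⟨v, o, u.kept⟩)
  simp only [smul_splitSum] at close
  refine Eq.trans (splitSum_congr fun s' s _ => ?_)
    (close.trans (splitSum_congr fun a q _ => ?_))
  · simp only [smul_splitSum]
    refine splitSum_congr fun a q _ => ?_
    simp only [← Nat.cast_smul_eq_nsmul C, smul_smul, conv]
    congr 1
    ring
  · simp only [smul_splitSum]
    refine splitSum_congr fun a' q' _ => ?_
    simp only [← Nat.cast_smul_eq_nsmul C, smul_smul, Character.eval]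
    congr 1
    ring

theorem ContractCut.tree {br : Branches d K Ξ O true} (h : r.ContractCut br) (n : MIdx d) (o : O)
    (f : PTree d K Ξ O true → M) :
    (wsum (r.contract br) fun κ => wsum (r.treeCuts χ pureTree ⟨n, o, κ⟩) f) =
      wsum (r.treeCuts (r.pullback χ) pureTree ⟨n, o, br⟩) fun τ =>
        wsum (r.contract τ.br) fun κ => f ⟨τ.dec, τ.exdec, κ⟩ := by
  simp only [wsum_treeCuts_mk]
  rw [h C hr χ M]
  refine wsum_congr _ fun t => ?_
  simp only [pullback_eval_smul, ← wsum_splitSum, ← wsum_smul]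
  exact wsum_comm _ _ _

end Tree

/-! ### The contracted tree as a linear functional of the universal character -/

section Contracted

variable {C₀ C : Type*} [CommSemiring C₀] [CommRing C] (r : ContractionRule d K Ξ O C₀)
  {M : Type*} [AddCommGroup M] [Module C₀ M] [Module C M] (f : PTree d K Ξ O true → M)

/-- The value of `f` on the tree that arises by contracting an extracted subtree, as a linear
functional of the value of the universal character on what was cut off that subtree. -/
noncomputable def contractedTree :
    (PTree d K Ξ O true →₀ DPShuffle d (Limb d K Ξ O) C) →ₗ[C] M :=
  Finsupp.lsum C fun σ => DPShuffle.lift fun a l =>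
    r.subtreeWeight σ • f ⟨a, r.subtreeExdec σ, ofLimbs l⟩

theorem contractedTree_single_basis (σ : PTree d K Ξ O true) (a : MIdx d)
    (l : List (Limb d K Ξ O)) :
    r.contractedTree (C := C) f (Finsupp.single σ (DPShuffle.basis a l)) =
      r.subtreeWeight σ • f ⟨a, r.subtreeExdec σ, ofLimbs l⟩ := by
  rw [contractedTree, Finsupp.lsum_single, DPShuffle.lift_basis]

variable [Algebra C₀ C] [IsScalarTower C₀ C M]

theorem contractedTree_wsum_evalTreeCuts
    (θ : Character d K Ξ O (DPShuffle d (Limb d K Ξ O) C))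
    (T : Multiset (TreeCut C₀ d K Ξ O true)) :
    r.contractedTree (C := C) f (wsum (θ.evalTreeCuts T) fun σ => Finsupp.single σ 1) =
      (T.map fun s =>
        s.coef • r.contractedTree f (Finsupp.single s.trunk (θ.eval s.red s.pruned))).sum := by
  rw [Character.wsum_evalTreeCuts, map_multiset_sum, Multiset.map_map]
  refine congrArg Multiset.sum (Multiset.map_congr rfl fun s _ => ?_)
  rw [Function.comp_apply, Finsupp.smul_single, smul_eq_mul, mul_one, ← Finsupp.smul_single,
    LinearMap.map_smul_of_tower]

theorem wsum_contractTree (t : PTree d K Ξ O true) :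
    wsum (r.contractTree t) f = (wsum (r.contract t.br) fun κ => f ⟨t.dec, t.exdec, κ⟩) +
      r.contractedTree (C := C) f (wsum (r.treeCuts (Character.universal d K Ξ O C)
        r.contractTree t) fun σ => Finsupp.single σ 1) := by
  rw [treeCuts, contractedTree_wsum_evalTreeCuts, ← extract_eq_cutsWith]
  simp only [wsum, contractTree, contractVertex, Multiset.map_add, Multiset.sum_add,
    Multiset.map_map, Function.comp_def, Character.universal_eval, contractedTree_single_basis,
    mul_smul]

end Contracted

section ConvUniversal

variable {C₀ C : Type*} [CommSemiring C₀] [CommRing C] [Algebra C₀ C]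
  (r : ContractionRule d K Ξ O C₀) (χ : Character d K Ξ O C)

theorem wsum_branchCuts_ofLimbs_kept {M : Type*} [AddCommMonoid M] [Module C M] [Module C₀ M]
    [IsScalarTower C₀ C M] (H : PTree d K Ξ O true → Multiset (C₀ × PTree d K Ξ O true)) (c : Bool)
    {b : Bool} (l : List (Limb d K Ξ O)) (F : Stump d K Ξ O b → M) :
    wsum (r.branchCuts χ H c (ofLimbs l)) F =
      wsum (r.branchCuts χ H c (ofLimbs l)) fun s : Stump d K Ξ O b =>
        F ⟨s.shift, s.own, ofLimbs (limbsOf s.kept)⟩ := by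
  induction l generalizing c F with
  | nil => simp only [ofLimbs, wsum_branchCuts_nil, limbsOf]
  | cons z l ih =>
    cases c
    · simp only [ofLimbs, wsum_branchCuts_false_kernel, Stump.consKernel, limbsOf]
      exact wsum_congr _ fun τ => ih _ _
    · simp only [ofLimbs, wsum_branchCuts_true_kernel, Stump.consKernel, Stump.consCut, limbsOf]
      exact congrArg₂ _ (Finset.sum_congr rfl fun ℓ _ => congrArg _ (wsum_congr _ fun h =>
        ih _ _)) (wsum_congr _ fun τ => ih _ _)

theorem conv_universal_eval (a : MIdx d) (l : List (Limb d K Ξ O)) :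
    (r.conv (χ.map _) (Character.universal d K Ξ O C)).eval a l =
      wsum (r.branchCuts χ pureTree true (ofLimbs l)) fun s : Stump d K Ξ O true =>
        splitSum a fun b q => χ.eval b s.own • addChoose q s.shift •
          DPShuffle.basis (q + s.shift) (limbsOf s.kept) := by
  simp only [Character.eval, conv]
  rw [wsum_branchCuts_map, ← LinearMap.mulLeft_apply (R := C), map_wsum]
  refine wsum_congr _ fun s => ?_
  rw [LinearMap.mulLeft_apply, splitSum_mul]
  refine splitSum_congr fun b q _ => ?_
  have basis_mul : (DPShuffle.basis q [] * DPShuffle.basis s.shift [] : DPShuffle d _ C) =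
      (addChoose q s.shift : DPShuffle d (Limb d K Ξ O) C) * DPShuffle.basis (q + s.shift) [] :=
    DPShuffle.isDividedPowers_basis.mul _ _
  simp only [Character.map, Character.universal]
  rw [DPShuffle.basis_eq_mul (q + s.shift), Algebra.smul_def, map_mul, nsmul_eq_mul]
  linear_combination (algebraMap C _ (χ.x b) * algebraMap C _ (χ.U s.own) *
    DPShuffle.basis 0 (limbsOf s.kept)) * basis_mul

theorem contractedTree_conv {M : Type*} [AddCommGroup M] [Module C₀ M] [Module C M]
    [IsScalarTower C₀ C M] (f : PTree d K Ξ O true → M) (σ : PTree d K Ξ O true) (a : MIdx d)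
    (l : List (Limb d K Ξ O)) :
    r.contractedTree f (Finsupp.single σ
        ((r.conv (χ.map _) (Character.universal d K Ξ O C)).eval a l)) =
      r.subtreeWeight σ • wsum (r.treeCuts χ pureTree ⟨a, r.subtreeExdec σ, ofLimbs l⟩) f := by
  have on_basis (b : MIdx d) (m : List (Limb d K Ξ O)) :
      (r.contractedTree f ∘ₗ Finsupp.lsingle σ) (DPShuffle.basis b m : DPShuffle d _ C) =
        r.subtreeWeight σ • f ⟨b, r.subtreeExdec σ, ofLimbs m⟩ :=
    r.contractedTree_single_basis f σ b m
  rw [wsum_treeCuts_mk, wsum_branchCuts_ofLimbs_kept, conv_universal_eval, ← wsum_smul]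
  refine (map_wsum _ (r.contractedTree f ∘ₗ Finsupp.lsingle σ) _).trans (wsum_congr _ fun s => ?_)
  rw [smul_splitSum, map_splitSum]
  refine splitSum_congr fun b q _ => ?_
  rw [map_smul, map_nsmul, on_basis, smul_comm (r.subtreeWeight σ), smul_comm (r.subtreeWeight σ)]

end ConvUniversal

theorem wsum_contractTree_treeCuts_of_branches {C₀ : Type u} [CommSemiring C₀]
    {r : ContractionRule d K Ξ O C₀} {C : Type u} [CommRing C] [Algebra C₀ C]
    (hr : r.IsTruncated C) (χ : Character d K Ξ O C) {M : Type u} [AddCommGroup M] [Module C₀ M]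
    [Module C M] [IsScalarTower C₀ C M] {br : Branches d K Ξ O true} (hcon : r.ContractCut br)
    (hext : r.ExtractCut br) (n : MIdx d) (o : O) (f : PTree d K Ξ O true → M) :
    (wsum (r.contractTree ⟨n, o, br⟩) fun h => wsum (r.treeCuts χ pureTree h) f) =
      wsum (r.treeCuts (r.pullback χ) pureTree ⟨n, o, br⟩) fun τ =>
        wsum (r.contractTree τ) f := by
  rw [r.wsum_contractTree (C := C), wsum_congr _ (r.wsum_contractTree (C := C) f), wsum_add,
    ← map_wsum, hcon.tree hr χ]
  congr 1
  have extract := hext.tree (hr.extend _) (χ.map _) (Character.universal d K Ξ O C) n o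
    fun σ => (Finsupp.single σ 1 : PTree d K Ξ O true →₀ DPShuffle d (Limb d K Ξ O) C)
  rw [pullback_map, wsum_treeCuts_map] at extract
  rw [← extract, treeCuts, treeCuts, contractedTree_wsum_evalTreeCuts,
    contractedTree_wsum_evalTreeCuts]
  simp only [Character.universal_eval, contractedTree_single_basis, contractedTree_conv]

end ContractionRule

/-! ### Induction over the branches at a vertex -/

namespace ContractionRule

section Induction

variable {C₀ : Type u} [CommSemiring C₀] {r : ContractionRule d K Ξ O C₀}

theorem contractCut_nil {b : Bool} : r.ContractCut (.nil : Branches d K Ξ O b) := by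
  intro C _ _ _ χ M _ _ _ _ c F
  simp only [wsum_contract_nil, wsum_branchCuts_nil, wsum_contractLimbs_nil]

theorem contractCut_noise (ξ : Ξ) (e n : MIdx d) (o : O) {rest : Branches d K Ξ O false}
    (h : r.ContractCut rest) : r.ContractCut (.noise ξ e n o rest) := by
  intro C _ _ hr χ M _ _ _ _ c F
  simp only [wsum_contract_noise, wsum_branchCuts_noise, Stump.consNoise]
  exact h C hr χ M false fun s => F (s.consNoise ξ e n o)

theorem extractCut_nil {b : Bool} : r.ExtractCut (.nil : Branches d K Ξ O b) := by
  intro C _ _ _ χ η M _ _ _ _ c₁ c₂ _ G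
  simp only [wsum_branchCuts_nil, wsum_contractLimbs_nil, ofLimbs, splitSum_zero,
    addChoose_zero_left, one_smul, add_zero]

theorem extractCut_noise (ξ : Ξ) (e n : MIdx d) (o : O) {rest : Branches d K Ξ O false}
    (h : r.ExtractCut rest) : r.ExtractCut (.noise ξ e n o rest) := by
  intro C _ _ hr χ η M _ _ _ _ c₁ c₂ _ G
  have own_empty (c : Bool) : (wsum (r.branchCuts (r.conv χ η) r.contractTree false rest) fun t =>
      wsum (r.branchCuts χ pureTree c (ofLimbs t.own)) fun s =>
        G t.shift s (.noise ξ e n o t.kept)) =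
      wsum (r.branchCuts (r.conv χ η) r.contractTree false rest) fun t =>
        G 0 ⟨0, [], .nil⟩ (.noise ξ e n o t.kept) := by
    rw [wsum_branchCuts_false]
    simp only [ofLimbs, wsum_branchCuts_nil]
  simp only [wsum_branchCuts_noise, Stump.consNoise]
  exact (own_empty c₁).trans ((own_empty false).symm.trans
    (h C hr χ η M false false le_rfl fun shift s κ => G shift s (.noise ξ e n o κ)))

section Kernel

variable {C : Type u} [CommRing C] [Algebra C₀ C] (hr : r.IsTruncated C)
  (χ η : Character d K Ξ O C) {M : Type u} [AddCommGroup M] [Module C₀ M] [Module C M]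
  [IsScalarTower C₀ C M] {b : Bool} (k : K) (e n : MIdx d) (o : O)
  {above : Branches d K Ξ O true} {rest : Branches d K Ξ O b}

include hr

theorem contractCut_keep (con_above : r.ContractCut above) (ext_above : r.ExtractCut above)
    (con_rest : r.ContractCut rest) (F : Stump d K Ξ O b → M) :
    (wsum (r.contractTree ⟨n, o, above⟩) fun h => wsum (r.contract rest) fun κ =>
      wsum (r.treeCuts χ pureTree h) fun τ => wsum (r.branchCuts χ pureTree false κ) fun s =>
        F (s.consKernel k e τ)) =
    wsum (r.treeCuts (r.pullback χ) pureTree ⟨n, o, above⟩) fun τ =>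
      wsum (r.branchCuts (r.pullback χ) pureTree false rest) fun s =>
        wsum (r.contractLimbs s.own) fun own => wsum (r.contractTree τ) fun h =>
          wsum (r.contract s.kept) fun κ => F (Stump.consKernel k e h ⟨s.shift, own, κ⟩) := by
  have in_above := wsum_contractTree_treeCuts_of_branches hr χ con_above ext_above n o fun τ =>
    wsum (r.contract rest) fun κ => wsum (r.branchCuts χ pureTree false κ) fun s =>
      F (s.consKernel k e τ)
  refine Eq.trans (wsum_congr _ fun h => wsum_comm _ _ _)
    (in_above.trans (wsum_congr _ fun τ => ?_))
  refine Eq.trans (wsum_congr _ fun h => con_rest C hr χ M false fun s => F (s.consKernel k e h))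
    ?_
  rw [wsum_comm]
  exact wsum_congr _ fun s => wsum_comm _ _ _

theorem extractCut_keep_keep (ext_above : r.ExtractCut above) (ext_rest : r.ExtractCut rest)
    (c : Bool) (G : MIdx d → Stump d K Ξ O true → Branches d K Ξ O b → M) :
    (wsum (r.treeCuts (r.conv χ η) r.contractTree ⟨n, o, above⟩) fun σ =>
      wsum (r.branchCuts (r.conv χ η) r.contractTree false rest) fun t =>
        wsum (r.branchCuts χ pureTree c (ofLimbs t.own)) fun s =>
          G t.shift s (.kernel k e σ.dec σ.exdec σ.br t.kept)) =
    wsum (r.treeCuts (r.pullback χ) pureTree ⟨n, o, above⟩) fun τ =>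
      wsum (r.branchCuts (r.pullback χ) pureTree false rest) fun t =>
        wsum (r.contractLimbs t.own) fun own => wsum (r.treeCuts η r.contractTree τ) fun σ =>
          wsum (r.branchCuts η r.contractTree false t.kept) fun u =>
            splitSum t.shift fun s' s => addChoose s u.shift •
              G (s + u.shift) ⟨s', own, ofLimbs u.own⟩
                (.kernel k e σ.dec σ.exdec σ.br u.kept) := by
  have own_empty (σ : PTree d K Ξ O true) (c' : Bool) :
      (wsum (r.branchCuts (r.conv χ η) r.contractTree false rest) fun t =>
        wsum (r.branchCuts χ pureTree c' (ofLimbs t.own)) fun s =>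
          G t.shift s (.kernel k e σ.dec σ.exdec σ.br t.kept)) =
      wsum (r.branchCuts (r.conv χ η) r.contractTree false rest) fun t =>
        G 0 ⟨0, [], .nil⟩ (.kernel k e σ.dec σ.exdec σ.br t.kept) := by
    rw [wsum_branchCuts_false]
    simp only [ofLimbs, wsum_branchCuts_nil]
  have in_rest (σ : PTree d K Ξ O true) := ext_rest C hr χ η M false false le_rfl fun shift s κ =>
    G shift s (.kernel k e σ.dec σ.exdec σ.br κ)
  refine Eq.trans (wsum_congr _ fun σ => (own_empty σ c).trans ((own_empty σ false).symm.trans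
    (in_rest σ))) ((ext_above.tree hr χ η n o _).trans (wsum_congr _ fun τ => ?_))
  rw [wsum_comm]
  exact wsum_congr _ fun t => wsum_comm _ _ _

theorem extractCut_cut_keep (con_above : r.ContractCut above) (ext_above : r.ExtractCut above)
    (ext_rest : r.ExtractCut rest)
    (G : MIdx d → Stump d K Ξ O true → Branches d K Ξ O b → M) :
    (∑ ℓ ∈ r.increases, r.weight ℓ • wsum (r.contractTree ⟨n, o, above⟩) fun h =>
      wsum (r.branchCuts (r.conv χ η) r.contractTree true rest) fun t => addChoose t.shift ℓ •
        wsum (r.treeCuts χ pureTree h) fun τ =>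
          wsum (r.branchCuts χ pureTree false (ofLimbs t.own)) fun s =>
            G (t.shift + ℓ) (s.consKernel k (e + ℓ) τ) t.kept) =
    wsum (r.treeCuts (r.pullback χ) pureTree ⟨n, o, above⟩) fun τ =>
      wsum (r.branchCuts (r.pullback χ) pureTree false rest) fun t =>
        wsum (r.contractLimbs t.own) fun own =>
          ∑ ℓ ∈ r.increases, r.weight ℓ • wsum (r.contractTree τ) fun h =>
            wsum (r.branchCuts η r.contractTree true t.kept) fun u => addChoose u.shift ℓ •
              splitSum t.shift fun s' s => addChoose s (u.shift + ℓ) •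
                G (s + (u.shift + ℓ))
                  ⟨s', own, .kernel k (e + ℓ) h.dec h.exdec h.br (ofLimbs u.own)⟩ u.kept := by
  simp only [wsum_finset_sum, wsum_smul]
  refine Finset.sum_congr rfl fun ℓ _ => congrArg _ ?_
  have in_above := wsum_contractTree_treeCuts_of_branches hr χ con_above ext_above n o fun τ =>
    wsum (r.branchCuts (r.conv χ η) r.contractTree true rest) fun t =>
      wsum (r.branchCuts χ pureTree false (ofLimbs t.own)) fun s =>
        addChoose t.shift ℓ • G (t.shift + ℓ) (s.consKernel k (e + ℓ) τ) t.kept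
  refine Eq.trans (wsum_congr _ fun h => ?_) (in_above.trans (wsum_congr _ fun τ => ?_))
  · simp only [← wsum_smul]
    exact wsum_comm _ _ _
  have in_rest (h : PTree d K Ξ O true) := ext_rest C hr χ η M false true (Bool.false_le true)
    fun shift s κ => addChoose shift ℓ • G (shift + ℓ) (s.consKernel k (e + ℓ) h) κ
  refine Eq.trans (wsum_congr _ in_rest) ?_
  rw [wsum_comm]
  refine wsum_congr _ fun t => (wsum_comm _ _ _).trans (wsum_congr _ fun own =>
    wsum_congr _ fun h => wsum_congr _ fun u => ?_)
  rw [smul_splitSum]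
  refine splitSum_congr fun s' s _ => ?_
  rw [smul_smul, smul_smul, add_assoc, addChoose_assoc]
  rfl

theorem extractCut_cut_cut (ext_rest : r.ExtractCut rest)
    (G : MIdx d → Stump d K Ξ O true → Branches d K Ξ O b → M) :
    (∑ ℓ ∈ r.increases, r.weight ℓ • wsum (r.contractTree ⟨n, o, above⟩) fun h =>
      wsum (r.branchCuts (r.conv χ η) r.contractTree true rest) fun t => addChoose t.shift ℓ •
        ∑ ℓ' ∈ r.increases, r.weight ℓ' •
          wsum (r.branchCuts χ pureTree true (ofLimbs t.own)) fun s => addChoose s.shift ℓ' •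
            G (t.shift + ℓ) (s.consCut ⟨k, e + ℓ, h⟩ ℓ') t.kept) =
    ∑ m ∈ r.increases, r.weight m •
      wsum (r.branchCuts (r.pullback χ) pureTree true rest) fun t => addChoose t.shift m •
        wsum (r.contractLimbs (⟨k, e + m, ⟨n, o, above⟩⟩ :: t.own)) fun own =>
          wsum (r.branchCuts η r.contractTree true t.kept) fun u =>
            splitSum (t.shift + m) fun s' s => addChoose s u.shift •
              G (s + u.shift) ⟨s', own, ofLimbs u.own⟩ u.kept := by
  have in_rest (ℓ ℓ' : MIdx d) (h : PTree d K Ξ O true) :=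
    ext_rest C hr χ η M true true le_rfl fun shift s κ =>
      r.weight ℓ • r.weight ℓ' • addChoose shift ℓ • addChoose s.shift ℓ' •
        G (shift + ℓ) ⟨s.shift + ℓ', ⟨k, e + (ℓ + ℓ'), h⟩ :: s.own, s.kept⟩ κ
  simp only [Finset.smul_sum, wsum_finset_sum, ← wsum_smul, wsum_contractLimbs_cons,
    Stump.consCut, add_assoc e]
  refine Eq.trans (Finset.sum_congr rfl fun ℓ _ => Finset.sum_congr rfl fun ℓ' _ =>
    wsum_congr _ fun h => Eq.trans ?_ (in_rest ℓ ℓ' h)) ?_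
  · refine wsum_congr _ fun t => wsum_congr _ fun s => ?_
    rw [smul_comm (addChoose t.shift ℓ) (r.weight ℓ')]
  simp only [← wsum_finset_sum]
  rw [wsum_comm]
  refine wsum_congr _ fun t => wsum_congr _ fun h => wsum_congr _ fun own => wsum_congr _ fun u =>
    ?_
  exact hr.sum_sum_smul_splitSum t.shift u.shift fun m s s' =>
    G s ⟨s', ⟨k, e + m, h⟩ :: own, ofLimbs u.own⟩ u.kept

end Kernel

theorem contractCut_kernel {b : Bool} (k : K) (e n : MIdx d) (o : O)
    {above : Branches d K Ξ O true} {rest : Branches d K Ξ O b} (con_above : r.ContractCut above)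
    (ext_above : r.ExtractCut above) (con_rest : r.ContractCut rest) :
    r.ContractCut (.kernel k e n o above rest) := by
  intro C _ _ hr χ M _ _ _ _ c F
  have keep := contractCut_keep hr χ k e n o con_above ext_above con_rest F
  cases c
  · simp only [wsum_contract_kernel, wsum_branchCuts_false_kernel, Stump.consKernel]
    exact keep
  · simp only [wsum_contract_kernel, wsum_branchCuts_true_kernel, wsum_add, wsum_pureTree,
      Stump.consKernel, Stump.consCut]
    refine congrArg₂ _ ?_ keep
    simp only [wsum_finset_sum, wsum_smul]
    refine Finset.sum_congr rfl fun ℓ _ => congrArg _ ?_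
    refine Eq.trans (wsum_congr _ fun h => con_rest C hr χ M true fun s =>
      addChoose s.shift ℓ • F (s.consCut ⟨k, e, h⟩ ℓ)) ?_
    rw [wsum_comm]
    simp only [Stump.consCut, wsum_contractLimbs_cons, wsum_smul]

theorem extractCut_kernel {b : Bool} (k : K) (e n : MIdx d) (o : O)
    {above : Branches d K Ξ O true} {rest : Branches d K Ξ O b} (con_above : r.ContractCut above)
    (ext_above : r.ExtractCut above) (ext_rest : r.ExtractCut rest) :
    r.ExtractCut (.kernel k e n o above rest) := by
  intro C _ _ hr χ η M _ _ _ _ c₁ c₂ hc G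
  have keep_keep := extractCut_keep_keep hr χ η k e n o ext_above ext_rest c₁ G
  have cut_keep := extractCut_cut_keep hr χ η k e n o con_above ext_above ext_rest G
  have cut_cut := extractCut_cut_cut hr χ η k e n o (above := above) ext_rest G
  match c₁, c₂ with
  | false, false =>
    simp only [wsum_branchCuts_false_kernel, Stump.consKernel]
    exact keep_keep
  | false, true =>
    simp only [wsum_branchCuts_false_kernel, wsum_branchCuts_true_kernel, Stump.consKernel,
      Stump.consCut, ofLimbs, wsum_add]
    exact congrArg₂ _ cut_keep keep_keep
  | true, true =>
    simp only [wsum_branchCuts_true_kernel, Stump.consKernel, Stump.consCut, ofLimbs, wsum_add,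
      wsum_pureTree, smul_add, Finset.sum_add_distrib]
    rw [add_assoc]
    exact congrArg₂ _ cut_cut (congrArg₂ _ cut_keep keep_keep)

theorem contractCut_extractCut {b : Bool} (br : Branches d K Ξ O b) :
    r.ContractCut br ∧ r.ExtractCut br := by
  induction br with
  | nil => exact ⟨contractCut_nil, extractCut_nil⟩
  | kernel k e n o above rest above_ih rest_ih =>
    exact ⟨contractCut_kernel k e n o above_ih.1 above_ih.2 rest_ih.1,
      extractCut_kernel k e n o above_ih.1 above_ih.2 rest_ih.2⟩
  | noise ξ e n o rest ih => exact ⟨contractCut_noise ξ e n o ih.1, extractCut_noise ξ e n o ih.2⟩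

theorem wsum_contractTree_treeCuts {C : Type u} [CommRing C] [Algebra C₀ C]
    (hr : r.IsTruncated C) (χ : Character d K Ξ O C) {M : Type u} [AddCommGroup M] [Module C₀ M]
    [Module C M] [IsScalarTower C₀ C M] (t : PTree d K Ξ O true) (f : PTree d K Ξ O true → M) :
    (wsum (r.contractTree t) fun h => wsum (r.treeCuts χ pureTree h) f) =
      wsum (r.treeCuts (r.pullback χ) pureTree t) fun τ => wsum (r.contractTree τ) f :=
  wsum_contractTree_treeCuts_of_branches hr χ (contractCut_extractCut t.br).1
    (contractCut_extractCut t.br).2 t.dec t.exdec f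

end Induction

end ContractionRule

/-! ## Polynomial weights -/

/-- Apply a map to the coefficient of a term. -/
def BranchCut.mapCoef {C C' : Type*} (φ : C → C') {b : Bool} (t : BranchCut C d K Ξ O b) :
    BranchCut C' d K Ξ O b :=
  ⟨φ t.coef, t.red, t.shift, t.own, t.deep, t.kept⟩

/-- Apply a map to the coefficient of a term. -/
def TreeCut.mapCoef {C C' : Type*} (φ : C → C') {b : Bool} (s : TreeCut C d K Ξ O b) :
    TreeCut C' d K Ξ O b :=
  ⟨φ s.coef, s.red, s.pruned, s.trunk⟩

/-- Apply a map to all weights. -/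
def mapWeight {A C C' : Type*} (φ : C → C') (T : Multiset (C × A)) : Multiset (C' × A) :=
  T.map fun q => (φ q.1, q.2)

section Scalars

variable {C C' : Type*} [CommSemiring C] [CommSemiring C'] (φ : C →+* C')

theorem map_nilStep {b : Bool} :
    (nilStep : Multiset (BranchCut C d K Ξ O b)).map (BranchCut.mapCoef φ) = nilStep := by
  simp [nilStep, BranchCut.mapCoef]

theorem map_cutStep {b : Bool} (B : ℕ) (k : K) (e : MIdx d)
    (heads : Multiset (C × PTree d K Ξ O true)) (rests : Multiset (BranchCut C d K Ξ O b)) :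
    (cutStep B k e heads rests).map (BranchCut.mapCoef φ) =
      cutStep B k e (mapWeight φ heads) (rests.map (BranchCut.mapCoef φ)) := by
  simp [cutStep, BranchCut.mapCoef, mapWeight, Multiset.map_bind, Multiset.bind_map,
    Function.comp_def]

theorem map_keepStep {b : Bool} (k : K) (e : MIdx d) (aboves : Multiset (TreeCut C d K Ξ O true))
    (rests : Multiset (BranchCut C d K Ξ O b)) :
    (keepStep k e aboves rests).map (BranchCut.mapCoef φ) =
      keepStep k e (aboves.map (TreeCut.mapCoef φ)) (rests.map (BranchCut.mapCoef φ)) := by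
  simp [keepStep, BranchCut.mapCoef, TreeCut.mapCoef, Multiset.map_bind, Multiset.bind_map,
    Function.comp_def]

theorem map_noiseStep (ξ : Ξ) (e n : MIdx d) (o : O)
    (rests : Multiset (BranchCut C d K Ξ O false)) :
    (noiseStep ξ e n o rests).map (BranchCut.mapCoef φ) =
      noiseStep ξ e n o (rests.map (BranchCut.mapCoef φ)) := by
  simp [noiseStep, BranchCut.mapCoef, Function.comp_def]

theorem map_closeVertex {b : Bool} (n : MIdx d) (o : O)
    (terms : Multiset (BranchCut C d K Ξ O b)) :
    (closeVertex n o terms).map (TreeCut.mapCoef φ) =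
      closeVertex n o (terms.map (BranchCut.mapCoef φ)) := by
  simp [closeVertex, BranchCut.mapCoef, TreeCut.mapCoef, Multiset.map_bind, Multiset.bind_map,
    Function.comp_def]

namespace ContractionRule

variable {φ} (r : ContractionRule d K Ξ O C) (hr : ∀ ℓ, φ (r.weight ℓ) = 1)
include hr

theorem map_cutStep {b : Bool} (k : K) (e : MIdx d) (heads : Multiset (C × PTree d K Ξ O true))
    (rests : Multiset (BranchCut C d K Ξ O b)) :
    (r.cutStep k e heads rests).map (BranchCut.mapCoef φ) =
      PlanarRS.cutStep r.box k e (mapWeight φ heads) (rests.map (BranchCut.mapCoef φ)) := by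
  simp [cutStep, increases, PlanarRS.cutStep, BranchCut.mapCoef, mapWeight, hr,
    Multiset.map_bind, Multiset.bind_map, Function.comp_def]

theorem map_cutsWith_pureTree (c : Bool) {b : Bool} (br : Branches d K Ξ O b) :
    (r.cutsWith pureTree c br).map (BranchCut.mapCoef φ) =
      (cuts r.box c br).map (BranchCut.mapCoef (Nat.castRingHom C')) := by
  have map_pureTree (t : PTree d K Ξ O true) :
      mapWeight φ (pureTree t) = mapWeight (Nat.castRingHom C') {(1, t)} := by
    simp [mapWeight, pureTree]
  induction br generalizing c with
  | nil => cases c <;> simp only [cutsWith, cuts, map_nilStep]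
  | kernel k e n o above rest ih₁ ih₂ =>
    cases c <;> simp only [cutsWith, cuts, Multiset.map_add, r.map_cutStep hr,
      PlanarRS.map_cutStep, map_keepStep, map_closeVertex, map_pureTree, ih₁, ih₂]
  | noise ξ e n o rest ih => cases c <;> simp only [cutsWith, cuts, map_noiseStep, ih]

end ContractionRule

end Scalars

section PolyRule

open Polynomial

variable (β : K → ℝ) (α : Ξ → ℝ) (R : Type u) [CommRing R]

/-- The rule behind `Δ⁻_ex` and `Δ⁺_ex`, with polynomial weights that record the degrees of all
increases of edge decorations. Its value at `X = 1` is the rule without weights. -/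
noncomputable def polyRule (B : ℕ) : ContractionRule d K Ξ ℝ (SMinus d β α R)[X] where
  weight ℓ := X ^ ℓ.size
  box := B
  subtreeWeight σ := C (projNeg β α R σ)
  subtreeExdec := PTree.degPlus β α

theorem eval_weight_polyRule (B : ℕ) (ℓ : MIdx d) :
    evalRingHom 1 ((polyRule β α R B).weight ℓ) = 1 := by
  simp [polyRule]

theorem mapWeight_contractVertex_polyRule (B : ℕ) (n : MIdx d) (o : ℝ)
    (A : Multiset ((SMinus d β α R)[X] × Branches d K Ξ ℝ true))
    (E : Multiset (BranchCut (SMinus d β α R)[X] d K Ξ ℝ true)) :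
    mapWeight (evalRingHom 1) ((polyRule β α R B).contractVertex n o A E) =
      contractVertex β α R n o (mapWeight (evalRingHom 1) A)
        (E.map (BranchCut.mapCoef (evalRingHom 1))) := by
  rw [contractVertex, ← map_closeVertex]
  simp [ContractionRule.contractVertex, polyRule, mapWeight, TreeCut.mapCoef, Function.comp_def]

theorem contract_and_extract_eq_map_polyRule (B : ℕ) {b : Bool} (br : Branches d K Ξ ℝ b) :
    contract β α R B br = mapWeight (evalRingHom 1) ((polyRule β α R B).contract br) ∧
      ∀ c, extract β α R B c br =
        ((polyRule β α R B).extract c br).map (BranchCut.mapCoef (evalRingHom 1)) := by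
  have map_cutStep {b : Bool} := (polyRule (d := d) β α R B).map_cutStep (b := b)
    (eval_weight_polyRule β α R B)
  induction br with
  | nil =>
    refine ⟨by simp [contract, ContractionRule.contract, mapWeight], fun c => ?_⟩
    cases c <;> simp only [extract, ContractionRule.extract, map_nilStep]
  | kernel k e n o above rest ih₁ ih₂ =>
    refine ⟨?_, fun c => ?_⟩
    · rw [contract, ih₁.1, ih₁.2, ih₂.1, ← mapWeight_contractVertex_polyRule β α R B]
      simp [ContractionRule.contract, mapWeight, Multiset.map_bind, Multiset.bind_map]
    · cases c <;> simp only [extract, ContractionRule.extract, Multiset.map_add, map_cutStep,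
        map_keepStep, map_closeVertex, mapWeight_contractVertex_polyRule, ih₁.1, ih₁.2, ih₂.2]
      rfl
  | noise ξ e n o rest ih =>
    refine ⟨?_, fun c => ?_⟩
    · rw [contract, ih.1]
      simp [ContractionRule.contract, mapWeight]
    · cases c <;> simp only [extract, ContractionRule.extract, map_noiseStep, ih.2]

theorem contractVertex_eq_map_contractTree (B : ℕ) (t : PTree d K Ξ ℝ true) :
    contractVertex β α R t.dec t.exdec (contract β α R B t.br) (extract β α R B true t.br) =
      mapWeight (evalRingHom 1) ((polyRule β α R B).contractTree t) := by
  rw [(contract_and_extract_eq_map_polyRule β α R B t.br).1,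
    (contract_and_extract_eq_map_polyRule β α R B t.br).2, ContractionRule.contractTree,
    mapWeight_contractVertex_polyRule]

end PolyRule

/-! ## Independence of the box -/

/-- `T` is `T'` together with further elements, all of which have the property `P`. -/
def ExtendsBy {A : Type*} (P : A → Prop) (T T' : Multiset A) : Prop :=
  ∃ E, T = T' + E ∧ ∀ a ∈ E, P a

namespace ExtendsBy

variable {A B : Type*} {P : A → Prop} {Q : B → Prop}

theorem refl (P : A → Prop) (T : Multiset A) : ExtendsBy P T T := ⟨0, by simp⟩

theorem add {T T' U U' : Multiset A} (hT : ExtendsBy P T T') (hU : ExtendsBy P U U') :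
    ExtendsBy P (T + U) (T' + U') := by
  obtain ⟨E, rfl, hE⟩ := hT
  obtain ⟨F, rfl, hF⟩ := hU
  refine ⟨E + F, add_add_add_comm _ _ _ _, fun a ha => ?_⟩
  exact (Multiset.mem_add.1 ha).elim (hE a) (hF a)

theorem map {T T' : Multiset A} (hT : ExtendsBy P T T') {f : A → B} (hf : ∀ a, P a → Q (f a)) :
    ExtendsBy Q (T.map f) (T'.map f) := by
  obtain ⟨E, rfl, hE⟩ := hT
  refine ⟨E.map f, Multiset.map_add _ _ _, fun b hb => ?_⟩
  obtain ⟨a, ha, rfl⟩ := Multiset.mem_map.1 hb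
  exact hf a (hE a ha)

theorem bind_congr (T : Multiset A) {G G' : A → Multiset B}
    (hG : ∀ a ∈ T, ExtendsBy Q (G a) (G' a)) : ExtendsBy Q (T.bind G) (T.bind G') := by
  induction T using Multiset.induction with
  | empty => exact refl Q 0
  | cons a T ih =>
    rw [Multiset.cons_bind, Multiset.cons_bind]
    exact (hG a (Multiset.mem_cons_self a T)).add
      (ih fun b hb => hG b (Multiset.mem_cons_of_mem hb))

theorem bind {T T' : Multiset A} (hT : ExtendsBy P T T') {G G' : A → Multiset B}
    (hP : ∀ a, P a → ∀ b ∈ G a, Q b) (hG : ∀ a ∈ T', ExtendsBy Q (G a) (G' a)) :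
    ExtendsBy Q (T.bind G) (T'.bind G') := by
  obtain ⟨E, rfl, hE⟩ := hT
  obtain ⟨F, hF, hFQ⟩ := bind_congr T' hG
  refine ⟨F + E.bind G, by rw [Multiset.add_bind, hF, add_assoc], fun b hb => ?_⟩
  obtain hb | hb := Multiset.mem_add.1 hb
  · exact hFQ b hb
  · obtain ⟨a, ha, hb⟩ := Multiset.mem_bind.1 hb
    exact hP a (hE a ha) b hb

theorem sum_map_eq {M : Type*} [AddCommMonoid M] {T T' : Multiset A} (hT : ExtendsBy P T T')
    {f : A → M} (hf : ∀ a ∈ T, P a → f a = 0) : (T.map f).sum = (T'.map f).sum := by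
  obtain ⟨E, rfl, hE⟩ := hT
  have hfE : (E.map f).sum = 0 := by
    refine Multiset.sum_eq_zero fun y hy => ?_
    obtain ⟨a, ha, rfl⟩ := Multiset.mem_map.1 hy
    exact hf a (Multiset.mem_add.2 (Or.inr ha)) (hE a ha)
  rw [Multiset.map_add, Multiset.sum_add, hfE, add_zero]

end ExtendsBy

theorem MIdx.lt_size_of_notMem {N : ℕ} {ℓ : MIdx d} (h : ℓ ∉ Finset.Iic (fun _ => N : MIdx d)) :
    N < ℓ.size := by
  rw [Finset.mem_Iic, Pi.le_def] at h
  push Not at h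
  obtain ⟨j, hj⟩ := h
  exact hj.trans_le (Finset.single_le_sum (f := ℓ) (fun _ _ => Nat.zero_le _) (Finset.mem_univ j))

theorem extendsBy_Iic {B N : ℕ} (h : N ≤ B) :
    ExtendsBy (fun ℓ => N < MIdx.size ℓ) (Finset.Iic (fun _ => B : MIdx d)).val
      (Finset.Iic (fun _ => N : MIdx d)).val := by
  have hsub : Finset.Iic (fun _ => N : MIdx d) ⊆ Finset.Iic fun _ => B :=
    Finset.Iic_subset_Iic.2 fun _ => h
  refine ⟨(Finset.Iic (fun _ => B : MIdx d) \ Finset.Iic fun _ => N).val, ?_, fun ℓ hℓ => ?_⟩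
  · rw [Finset.sdiff_val, add_tsub_cancel_of_le (Finset.val_le_iff.2 hsub)]
  · exact MIdx.lt_size_of_notMem (Finset.mem_sdiff.1 hℓ).2

section MinDeg

variable (β : K → ℝ) (α : Ξ → ℝ) (x : O → ℝ)

/-- The degree of a tree if its second decorations are counted by `x`. -/
def PTree.degBy {b : Bool} (t : PTree d K Ξ O b) : ℝ := t.dec.size + x t.exdec + t.br.deg β α x

/-- A lower bound for what the branches at a vertex contribute to the degrees of the subtrees that
contain this vertex. The decorations of inner vertices are not counted since they can be lowered. -/
noncomputable def Branches.minDeg : {b : Bool} → Branches d K Ξ O b → ℝ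
  | _, .nil => 0
  | _, .kernel k e _ o above rest => min 0 (β k - e.size + (x o + above.minDeg)) + rest.minDeg
  | _, .noise ξ e n o rest => α ξ - 1 - e.size + (n.size + x o) + rest.minDeg

theorem deg_forget {b : Bool} (br : Branches d K Ξ O b) :
    br.forget.deg β α (fun _ => 0) = br.deg β α fun _ => 0 := by
  induction br with
  | nil => rfl
  | kernel k e n o above rest ih₁ ih₂ => simp only [Branches.forget, Branches.deg, ih₁, ih₂]
  | noise ξ e n o rest ih => simp only [Branches.forget, Branches.deg, ih]

theorem reg_forget {b : Bool} (t : PTree d K Ξ O b) :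
    t.forget.reg β α = t.degBy β α fun _ => 0 := by
  simp only [PTree.reg, PTree.forget, deg_forget, PTree.degBy, add_zero]

theorem absSize_nonneg {b : Bool} (br : Branches d K Ξ ℝ b) : 0 ≤ br.absSize β α := by
  induction br <;> simp only [Branches.absSize] <;> positivity

theorem deg_le_absSize {b : Bool} (br : Branches d K Ξ ℝ b) : br.deg β α id ≤ br.absSize β α := by
  induction br with
  | nil => simp only [Branches.absSize, Branches.deg, le_refl]
  | kernel k e n o above rest ih₁ ih₂ =>
    simp only [Branches.absSize, Branches.deg, id]
    linarith [le_abs_self (β k), le_abs_self o, (Nat.cast_nonneg e.size : (0 : ℝ) ≤ e.size)]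
  | noise ξ e n o rest ih =>
    simp only [Branches.absSize, Branches.deg, id]
    linarith [le_abs_self (α ξ - 1), le_abs_self o, (Nat.cast_nonneg e.size : (0 : ℝ) ≤ e.size)]

theorem neg_absSize_le_minDeg {b : Bool} (br : Branches d K Ξ ℝ b) :
    -br.absSize β α ≤ br.minDeg β α fun _ => 0 := by
  induction br with
  | nil => simp only [Branches.absSize, Branches.minDeg, neg_zero, le_refl]
  | kernel k e n o above rest ih₁ ih₂ =>
    simp only [Branches.absSize, Branches.minDeg]
    rw [← sub_le_iff_le_add, le_min_iff]
    constructor <;> linarith [neg_abs_le (β k), abs_nonneg (β k), abs_nonneg o,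
      absSize_nonneg β α above, (Nat.cast_nonneg e.size : (0 : ℝ) ≤ e.size),
      (Nat.cast_nonneg n.size : (0 : ℝ) ≤ n.size)]
  | noise ξ e n o rest ih =>
    simp only [Branches.absSize, Branches.minDeg]
    linarith [neg_abs_le (α ξ - 1), abs_nonneg o, (Nat.cast_nonneg n.size : (0 : ℝ) ≤ n.size)]

theorem deg_sub_absSize_le_minDeg {b : Bool} (br : Branches d K Ξ ℝ b) :
    br.deg β α id - br.absSize β α ≤ br.minDeg β α id := by
  induction br with
  | nil => simp only [Branches.absSize, Branches.deg, Branches.minDeg, sub_zero, le_refl]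
  | kernel k e n o above rest ih₁ ih₂ =>
    simp only [Branches.absSize, Branches.deg, Branches.minDeg, id]
    rw [← sub_le_iff_le_add, le_min_iff]
    constructor <;> linarith [le_abs_self (β k), abs_nonneg (β k), le_abs_self o, abs_nonneg o,
      deg_le_absSize β α above, (Nat.cast_nonneg e.size : (0 : ℝ) ≤ e.size)]
  | noise ξ e n o rest ih =>
    simp only [Branches.absSize, Branches.deg, Branches.minDeg, id]
    linarith [abs_nonneg (α ξ - 1), abs_nonneg o, (Nat.cast_nonneg e.size : (0 : ℝ) ≤ e.size)]

variable {C : Type*}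

/-- What the kept branches contribute to the degree of the trunk; the increases of the cut edges
are added to the decoration of the vertex. -/
def BranchCut.keptDeg {b : Bool} (t : BranchCut C d K Ξ O b) : ℝ :=
  t.kept.deg β α x + t.shift.size

/-- The term vanishes, or the degree of its kept part is larger than `D`. -/
def BranchCut.IsNegligible [Zero C] (D : ℝ) {b : Bool} (t : BranchCut C d K Ξ O b) : Prop :=
  t.coef = 0 ∨ D < t.keptDeg β α x

/-- The term vanishes, or the degree of its trunk is larger than `D`. -/
def TreeCut.IsNegligible [Zero C] (D : ℝ) {b : Bool} (s : TreeCut C d K Ξ O b) : Prop :=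
  s.coef = 0 ∨ D < s.trunk.degBy β α x

section Steps

variable [CommSemiring C] {β α x}

theorem keptDeg_le_of_mem_closeVertex {b : Bool} {n : MIdx d} {o : O}
    {T : Multiset (BranchCut C d K Ξ O b)} {s : TreeCut C d K Ξ O b} (hs : s ∈ closeVertex n o T) :
    ∃ t ∈ T, (t.coef = 0 → s.coef = 0) ∧ x o + t.keptDeg β α x ≤ s.trunk.degBy β α x := by
  simp only [closeVertex, Multiset.mem_bind, Multiset.mem_map] at hs
  obtain ⟨a, -, t, ht, l, -, rfl⟩ := hs
  refine ⟨t, ht, fun h => by simp only [h, zero_mul], ?_⟩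
  simp only [BranchCut.keptDeg, PTree.degBy, MIdx.size_add, Nat.cast_add]
  linarith [(Nat.cast_nonneg (n - a).size : (0 : ℝ) ≤ (n - a).size)]

theorem ContractionRule.minDeg_le_keptDeg_of_mem_cutsWith (r : ContractionRule d K Ξ O C)
    (H : PTree d K Ξ O true → Multiset (C × PTree d K Ξ O true)) (c : Bool) {b : Bool}
    (br : Branches d K Ξ O b) : ∀ t ∈ r.cutsWith H c br, br.minDeg β α x ≤ t.keptDeg β α x := by
  induction br generalizing c with
  | nil =>
    intro t ht
    have : t = ⟨1, 0, 0, [], [], .nil⟩ := by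
      cases c <;> simpa only [cutsWith, nilStep, Multiset.mem_singleton] using ht
    simp [this, BranchCut.keptDeg, MIdx.size_zero, Branches.minDeg, Branches.deg]
  | kernel k e n o above rest ih₁ ih₂ =>
    have keep : ∀ t ∈ keepStep k e (closeVertex n o (r.cutsWith H true above))
        (r.cutsWith H false rest),
        (Branches.kernel k e n o above rest).minDeg β α x ≤ t.keptDeg β α x := by
      intro t ht
      simp only [keepStep, Multiset.mem_bind, Multiset.mem_map] at ht
      obtain ⟨s, hs, t, ht, l, -, rfl⟩ := ht
      obtain ⟨u, hu, -, hus⟩ := keptDeg_le_of_mem_closeVertex (β := β) (α := α) (x := x) hs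
      have h₁ := ih₁ true u hu
      have h₂ := ih₂ false t ht
      simp only [BranchCut.keptDeg, PTree.degBy, Branches.deg, Branches.minDeg] at *
      linarith [min_le_right 0 (β k - e.size + (x o + above.minDeg β α x))]
    cases c
    · simpa only [cutsWith] using keep
    · intro u hu
      simp only [cutsWith, Multiset.mem_add] at hu
      refine hu.elim (fun hu => ?_) (keep u)
      simp only [cutStep, Multiset.mem_bind, Multiset.mem_map] at hu
      obtain ⟨ℓ, -, h, -, t, ht, rfl⟩ := hu
      have h₂ := ih₂ true t ht
      simp only [BranchCut.keptDeg, Branches.minDeg, MIdx.size_add, Nat.cast_add] at h₂ ⊢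
      linarith [min_le_left 0 (β k - e.size + (x o + above.minDeg β α x)),
        (Nat.cast_nonneg (MIdx.size ℓ) : (0 : ℝ) ≤ MIdx.size ℓ)]
  | noise ξ e n o rest ih =>
    intro u hu
    have : u ∈ noiseStep ξ e n o (r.cutsWith H false rest) := by
      cases c <;> simpa only [cutsWith] using hu
    obtain ⟨t, ht, rfl⟩ := Multiset.mem_map.1 this
    have h := ih false t ht
    simp only [BranchCut.keptDeg, Branches.deg, Branches.minDeg] at h ⊢
    linarith

theorem extendsBy_closeVertex {b : Bool} {D : ℝ} (n : MIdx d) (o : O)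
    {T T' : Multiset (BranchCut C d K Ξ O b)}
    (hT : ExtendsBy (BranchCut.IsNegligible β α x D) T T') :
    ExtendsBy (TreeCut.IsNegligible β α x (x o + D)) (closeVertex n o T) (closeVertex n o T') := by
  obtain ⟨E, rfl, hE⟩ := hT
  refine ⟨closeVertex n o E, ?_, fun s hs => ?_⟩
  · simp only [closeVertex, Multiset.add_bind, Multiset.bind_add]
  · obtain ⟨t, ht, hcoef, hdeg⟩ := keptDeg_le_of_mem_closeVertex (β := β) (α := α) (x := x) hs
    exact (hE t ht).imp hcoef fun h => by linarith

theorem extendsBy_keepStep {b : Bool} {D L₁ L₂ D₁ D₂ : ℝ} (k : K) (e : MIdx d)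
    {S S' : Multiset (TreeCut C d K Ξ O true)} {T T' : Multiset (BranchCut C d K Ξ O b)}
    (hS : ExtendsBy (TreeCut.IsNegligible β α x D₁) S S')
    (hT : ExtendsBy (BranchCut.IsNegligible β α x D₂) T T')
    (hLS : ∀ s ∈ S', L₁ ≤ s.trunk.degBy β α x) (hLT : ∀ t ∈ T, L₂ ≤ t.keptDeg β α x)
    (h₁ : D ≤ β k - e.size + D₁ + L₂) (h₂ : D ≤ β k - e.size + L₁ + D₂) :
    ExtendsBy (BranchCut.IsNegligible β α x D) (keepStep k e S T) (keepStep k e S' T') := by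
  refine hS.bind (fun s hs u hu => ?_) fun s hs => hT.bind (fun t ht u hu => ?_) fun t _ =>
    .refl _ _
  · simp only [Multiset.mem_bind, Multiset.mem_map] at hu
    obtain ⟨t, ht, l, -, rfl⟩ := hu
    refine hs.imp (fun h => by simp only [h, zero_mul]) fun h => ?_
    have hL := hLT t ht
    simp only [BranchCut.keptDeg, PTree.degBy, Branches.deg] at h hL ⊢
    linarith
  · obtain ⟨l, -, rfl⟩ := Multiset.mem_map.1 hu
    refine ht.imp (fun h => by simp only [h, mul_zero, zero_mul]) fun h => ?_
    have hL := hLS s hs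
    simp only [BranchCut.keptDeg, PTree.degBy, Branches.deg] at h hL ⊢
    linarith

theorem extendsBy_noiseStep {D D' : ℝ} (ξ : Ξ) (e n : MIdx d) (o : O)
    {T T' : Multiset (BranchCut C d K Ξ O false)}
    (hT : ExtendsBy (BranchCut.IsNegligible β α x D) T T')
    (h : D' ≤ α ξ - 1 - e.size + (n.size + x o) + D) :
    ExtendsBy (BranchCut.IsNegligible β α x D') (noiseStep ξ e n o T) (noiseStep ξ e n o T') := by
  refine hT.map fun t ht => ht.imp_right fun ht => ?_
  simp only [BranchCut.keptDeg, Branches.deg] at ht ⊢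
  linarith

end Steps

end MinDeg

namespace ContractionRule

variable {C : Type*} [CommSemiring C] (r : ContractionRule d K Ξ O C)

/-- The rule with another bound for the increases of edge decorations. -/
def withBox (N : ℕ) : ContractionRule d K Ξ O C := { r with box := N }

variable {β : K → ℝ} {α : Ξ → ℝ} {x : O → ℝ} {N : ℕ}

theorem extendsBy_cutsWith_noise {H H' : PTree d K Ξ O true → Multiset (C × PTree d K Ξ O true)}
    (ξ : Ξ) (e n : MIdx d) (o : O) (rest : Branches d K Ξ O false)
    (hRest : ExtendsBy (BranchCut.IsNegligible β α x (N + rest.minDeg β α x))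
      (r.cutsWith H false rest) ((r.withBox N).cutsWith H' false rest)) (c : Bool) :
    ExtendsBy (BranchCut.IsNegligible β α x (N + (Branches.noise ξ e n o rest).minDeg β α x))
      (r.cutsWith H c (.noise ξ e n o rest))
      ((r.withBox N).cutsWith H' c (.noise ξ e n o rest)) := by
  cases c <;>
  · simp only [cutsWith]
    refine extendsBy_noiseStep ξ e n o hRest ?_
    simp only [Branches.minDeg]
    linarith

variable (hN : N ≤ r.box)
include hN

theorem extendsBy_cutStep {b : Bool} {D L : ℝ} (k : K) (e : MIdx d)
    {heads heads' : Multiset (C × PTree d K Ξ O true)} {T T' : Multiset (BranchCut C d K Ξ O b)}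
    (hheads : ExtendsBy (fun h => h.1 = 0) heads heads')
    (hT : ExtendsBy (BranchCut.IsNegligible β α x D) T T')
    (hL : ∀ t ∈ T, L ≤ t.keptDeg β α x) (hDL : D ≤ N + L) :
    ExtendsBy (BranchCut.IsNegligible β α x D) (r.cutStep k e heads T)
      ((r.withBox N).cutStep k e heads' T') := by
  refine (extendsBy_Iic hN).bind (fun ℓ hℓ u hu => ?_) fun ℓ _ =>
    hheads.bind (fun h hh u hu => ?_) fun h _ => hT.map fun t ht => ?_
  · simp only [Multiset.mem_bind, Multiset.mem_map] at hu
    obtain ⟨h, -, t, ht, rfl⟩ := hu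
    have hL := hL t ht
    have hℓ : (N : ℝ) < MIdx.size ℓ := Nat.cast_lt.2 hℓ
    right
    simp only [BranchCut.keptDeg, MIdx.size_add, Nat.cast_add] at hL ⊢
    linarith
  · obtain ⟨t, -, rfl⟩ := Multiset.mem_map.1 hu
    left
    simp only [hh, zero_mul]
  · refine ht.imp (fun h => by simp only [h, mul_zero, zero_mul]) fun h => ?_
    simp only [BranchCut.keptDeg, MIdx.size_add, Nat.cast_add] at h ⊢
    linarith [(Nat.cast_nonneg (MIdx.size ℓ) : (0 : ℝ) ≤ MIdx.size ℓ)]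

theorem extendsBy_cutsWith_kernel {b : Bool}
    {H H' : PTree d K Ξ O true → Multiset (C × PTree d K Ξ O true)} (k : K) (e n : MIdx d) (o : O)
    (above : Branches d K Ξ O true) (rest : Branches d K Ξ O b)
    (hH : ExtendsBy (fun h => h.1 = 0) (H ⟨n, o, above⟩) (H' ⟨n, o, above⟩))
    (hAbove : ExtendsBy (BranchCut.IsNegligible β α x (N + above.minDeg β α x))
      (r.cutsWith H true above) ((r.withBox N).cutsWith H' true above))
    (hRest : ∀ c, ExtendsBy (BranchCut.IsNegligible β α x (N + rest.minDeg β α x))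
      (r.cutsWith H c rest) ((r.withBox N).cutsWith H' c rest)) (c : Bool) :
    ExtendsBy
      (BranchCut.IsNegligible β α x (N + (Branches.kernel k e n o above rest).minDeg β α x))
      (r.cutsWith H c (.kernel k e n o above rest))
      ((r.withBox N).cutsWith H' c (.kernel k e n o above rest)) := by
  have hminl := min_le_left 0 (β k - e.size + (x o + above.minDeg β α x))
  have hminr := min_le_right 0 (β k - e.size + (x o + above.minDeg β α x))
  have keep : ExtendsBy
      (BranchCut.IsNegligible β α x (N + (Branches.kernel k e n o above rest).minDeg β α x))
      (keepStep k e (closeVertex n o (r.cutsWith H true above)) (r.cutsWith H false rest))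
      (keepStep k e (closeVertex n o ((r.withBox N).cutsWith H' true above))
        ((r.withBox N).cutsWith H' false rest)) := by
    refine extendsBy_keepStep k e (L₁ := x o + above.minDeg β α x)
      (extendsBy_closeVertex n o hAbove) (hRest false) (fun s hs => ?_)
      (r.minDeg_le_keptDeg_of_mem_cutsWith H false rest) ?_ ?_
    · obtain ⟨t, ht, -, hts⟩ := keptDeg_le_of_mem_closeVertex (β := β) (α := α) (x := x) hs
      linarith [(r.withBox N).minDeg_le_keptDeg_of_mem_cutsWith (β := β) (α := α) (x := x)
        H' true above t ht]
    all_goals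
      simp only [Branches.minDeg]
      linarith
  cases c
  · simpa only [cutsWith] using keep
  · simp only [cutsWith]
    refine .add ?_ keep
    obtain ⟨E, hE, hEneg⟩ := hRest true
    refine r.extendsBy_cutStep hN k e hH ⟨E, hE, fun t ht => (hEneg t ht).imp_right fun h => ?_⟩
      (r.minDeg_le_keptDeg_of_mem_cutsWith H true rest) ?_
    all_goals
      simp only [Branches.minDeg]
      linarith

theorem extendsBy_cutsWith_pureTree (c : Bool) {b : Bool} (br : Branches d K Ξ O b) :
    ExtendsBy (BranchCut.IsNegligible β α x (N + br.minDeg β α x))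
      (r.cutsWith pureTree c br) ((r.withBox N).cutsWith pureTree c br) := by
  induction br generalizing c with
  | nil => cases c <;> simpa only [cutsWith] using .refl _ _
  | kernel k e n o above rest ih₁ ih₂ =>
    exact r.extendsBy_cutsWith_kernel hN k e n o above rest (.refl _ _) (ih₁ true) ih₂ c
  | noise ξ e n o rest ih => exact r.extendsBy_cutsWith_noise ξ e n o rest (ih false) c

end ContractionRule

namespace ContractionRule

variable {C : Type*} [CommSemiring C] (r : ContractionRule d K Ξ ℝ C) {β : K → ℝ} {α : Ξ → ℝ}
  (hr : ∀ σ : PTree d K Ξ ℝ true, 0 ≤ σ.degBy β α (fun _ => 0) → r.subtreeWeight σ = 0) {N : ℕ}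
include hr

theorem extendsBy_contractVertex {D : ℝ} (hD : 0 ≤ D) (n : MIdx d) (o : ℝ)
    {A A' : Multiset (C × Branches d K Ξ ℝ true)} {E E' : Multiset (BranchCut C d K Ξ ℝ true)}
    (hA : ExtendsBy (fun q => q.1 = 0) A A')
    (hE : ExtendsBy (BranchCut.IsNegligible β α (fun _ => 0) D) E E') :
    ExtendsBy (fun q => q.1 = 0) (r.contractVertex n o A E)
      ((r.withBox N).contractVertex n o A' E') := by
  refine .add (hA.map fun q hq => hq) ((extendsBy_closeVertex n o hE).map fun s hs => ?_)
  obtain hs | hs := hs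
  · simp only [hs, zero_mul]
  · simp only [hr s.trunk (by linarith), mul_zero]

variable (hN : N ≤ r.box)
include hN

theorem extendsBy_contract_and_extract {b : Bool} (br : Branches d K Ξ ℝ b)
    (hbr : br.absSize β α ≤ N) :
    ExtendsBy (fun q => q.1 = 0) (r.contract br) ((r.withBox N).contract br) ∧
      ∀ c, ExtendsBy (BranchCut.IsNegligible β α (fun _ => 0) (N + br.minDeg β α fun _ => 0))
        (r.extract c br) ((r.withBox N).extract c br) := by
  induction br with
  | nil =>
    refine ⟨by simpa only [contract] using .refl _ _, fun c => ?_⟩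
    cases c <;> simpa only [extract] using .refl _ _
  | kernel k e n o above rest ih₁ ih₂ =>
    have habove := absSize_nonneg β α above
    have hrest := absSize_nonneg β α rest
    have hmin := neg_absSize_le_minDeg β α above
    simp only [Branches.absSize] at hbr
    have : above.absSize β α + rest.absSize β α ≤ N := by
      linarith [abs_nonneg (β k), abs_nonneg o, (Nat.cast_nonneg e.size : (0 : ℝ) ≤ e.size),
        (Nat.cast_nonneg n.size : (0 : ℝ) ≤ n.size)]
    obtain ⟨hAbove, hAbove'⟩ := ih₁ (by linarith)
    obtain ⟨hRest, hRest'⟩ := ih₂ (by linarith)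
    have hVertex := r.extendsBy_contractVertex hr (N := N) (by linarith) n o hAbove (hAbove' true)
    constructor
    · simp only [contract]
      refine hVertex.bind (fun h hh u hu => ?_) fun h _ => hRest.map fun q hq => ?_
      · obtain ⟨q, -, rfl⟩ := Multiset.mem_map.1 hu
        simp only [hh, zero_mul]
      · simp only [hq, mul_zero]
    · simp only [extract_eq_cutsWith] at hAbove' hRest' ⊢
      refine r.extendsBy_cutsWith_kernel hN k e n o above rest ?_ (hAbove' true) hRest'
      simpa only [contractTree, extract_eq_cutsWith] using hVertex
  | noise ξ e n o rest ih =>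
    simp only [Branches.absSize] at hbr
    obtain ⟨hRest, hRest'⟩ := ih (by linarith [abs_nonneg (α ξ - 1), abs_nonneg o,
      (Nat.cast_nonneg e.size : (0 : ℝ) ≤ e.size), (Nat.cast_nonneg n.size : (0 : ℝ) ≤ n.size)])
    constructor
    · simpa only [contract] using hRest.map fun q hq => hq
    · simp only [extract_eq_cutsWith] at hRest' ⊢
      exact r.extendsBy_cutsWith_noise ξ e n o rest (hRest' false)

theorem extendsBy_contractTree (t : PTree d K Ξ ℝ true) (ht : t.br.absSize β α ≤ N) :
    ExtendsBy (fun q => q.1 = 0) (r.contractTree t) ((r.withBox N).contractTree t) := by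
  obtain ⟨hA, hE⟩ := r.extendsBy_contract_and_extract hr hN t.br ht
  exact r.extendsBy_contractVertex hr (by linarith [neg_absSize_le_minDeg β α t.br]) _ _ hA
    (hE true)

end ContractionRule

section CutDegree

variable {C : Type*} [CommSemiring C] (r : ContractionRule d K Ξ ℝ C) (β : K → ℝ) (α : Ξ → ℝ)

theorem hasDeg_cutsWith_pureTree (c : Bool) {b : Bool} (br : Branches d K Ξ ℝ b) :
    ∀ t ∈ r.cutsWith pureTree c br, t.HasDeg β α (br.deg β α id) := by
  induction br generalizing c with
  | nil => cases c <;> simpa only [ContractionRule.cutsWith, Branches.deg] using hasDeg_nilStep β α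
  | kernel k e n o above rest ih₁ ih₂ =>
    rw [Branches.deg, id]
    have keep := hasDeg_keepStep β α k e _ _ (hasDeg_closeVertex β α n o _ (ih₁ true)) (ih₂ false)
    cases c
    · simpa only [ContractionRule.cutsWith] using keep
    · intro u hu
      simp only [ContractionRule.cutsWith, Multiset.mem_add] at hu
      refine hu.elim (fun hu => ?_) (keep u)
      simp only [ContractionRule.cutStep, pureTree, Multiset.mem_bind, Multiset.mem_map,
        Multiset.mem_singleton] at hu
      obtain ⟨ℓ, -, h, rfl, t, ht, rfl⟩ := hu
      have := ih₂ true t ht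
      simp only [BranchCut.HasDeg, PTree.degPlus, limbsDeg, List.map_cons,
        List.sum_cons, MIdx.size_add, Nat.cast_add] at this ⊢
      linarith
  | noise ξ e n o rest ih =>
    cases c <;> simpa only [ContractionRule.cutsWith, Branches.deg, id] using
      hasDeg_noiseStep β α ξ e n o _ (ih false)

theorem degPlus_neg_of_isNegligible {c : Bool} {t : PTree d K Ξ ℝ true} {N : ℕ}
    (hN : t.dec.size + t.br.absSize β α ≤ N) {s : TreeCut C d K Ξ ℝ true}
    (hs : s ∈ closeVertex t.dec t.exdec (r.cutsWith pureTree c t.br))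
    (hD : t.exdec + (N + t.br.minDeg β α id) < s.trunk.degPlus β α) :
    (⟨s.red, 0, ofLimbs s.pruned⟩ : PTree d K Ξ ℝ false).degPlus β α < 0 := by
  have hdeg := hasDeg_closeVertex β α _ _ _ (hasDeg_cutsWith_pureTree r β α c t.br) s hs
  have hmin := deg_sub_absSize_le_minDeg β α t.br
  simp only [TreeCut.HasDeg] at hdeg
  simp only [PTree.degPlus, deg_ofLimbs] at hdeg hD ⊢
  linarith

end CutDegree

namespace ContractionRule

variable {C₀ : Type u} [CommSemiring C₀] (r : ContractionRule d K Ξ O C₀)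

/-- All left admissible cuts of a tree. -/
def admissibleCuts (t : PTree d K Ξ O true) : Multiset (TreeCut C₀ d K Ξ O true) :=
  closeVertex t.dec t.exdec (r.cutsWith pureTree true t.br)

theorem wsum_contractTree_admissibleCuts {C M : Type u} [CommRing C] [Algebra C₀ C]
    (hr : r.IsTruncated C) [AddCommGroup M] [Module C₀ M] [Module C M] [IsScalarTower C₀ C M]
    (t : PTree d K Ξ O true) (f : MIdx d → Branches d K Ξ O false → PTree d K Ξ O true → M) :
    (wsum (r.contractTree t) fun h => ((r.admissibleCuts h).map fun s =>
        s.coef • f s.red (ofLimbs s.pruned) s.trunk).sum) =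
      ((r.admissibleCuts t).map fun s => s.coef • wsum (r.contract (ofLimbs s.pruned)) fun κ =>
        wsum (r.contractTree s.trunk) fun h => f s.red κ h).sum := by
  let W := DPShuffle d (Limb d K Ξ O) C
  let χ : Character d K Ξ O W := .universal d K Ξ O C
  let trunk (h : PTree d K Ξ O true) : PTree d K Ξ O true →₀ W := .single h 1
  let φ : (PTree d K Ξ O true →₀ W) →ₗ[C₀] M :=
    (Finsupp.lsum C fun h => DPShuffle.lift fun a l => f a (ofLimbs l) h).restrictScalars C₀
  have φ_eval (a : MIdx d) (l : List (Limb d K Ξ O)) (h : PTree d K Ξ O true) :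
      φ (χ.eval a l • trunk h) = f a (ofLimbs l) h := by
    rw [Character.universal_eval, Finsupp.smul_single, smul_eq_mul, mul_one]
    exact (Finsupp.lsum_single C _ _ _).trans (DPShuffle.lift_basis _ a l)
  have key := congrArg φ (r.wsum_contractTree_treeCuts (hr.extend W) χ t trunk)
  simp only [treeCuts, Character.wsum_evalTreeCuts, map_wsum, map_multiset_sum, Multiset.map_map,
    Function.comp_def, smul_assoc, map_smul, pullback_eval_smul, φ_eval, ← wsum_smul] at key
  simpa only [wsum_contract_ofLimbs, admissibleCuts, wsum_smul,
    wsum_comm (r.contractLimbs _)] using key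

end ContractionRule

/-! ## Truncation -/

section Truncation

open Polynomial

variable {S : Type u} [CommRing S]

/-- The sum of the coefficients up to degree `N`. -/
noncomputable def truncSum (N : ℕ) : S[X] →ₗ[S] S := ∑ k ∈ Finset.range (N + 1), lcoeff S k

theorem truncSum_apply (N : ℕ) (c : S[X]) :
    truncSum N c = ∑ k ∈ Finset.range (N + 1), c.coeff k := by
  simp [truncSum]

theorem truncSum_eq_eval {N : ℕ} {c : S[X]} (h : c.natDegree ≤ N) :
    truncSum N c = c.eval 1 := by
  rw [truncSum_apply, eval_eq_sum_range' (Nat.lt_succ_of_le h)]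
  simp

theorem truncSum_eq_zero_of_dvd {N : ℕ} {c : S[X]} (h : X ^ (N + 1) ∣ c) : truncSum N c = 0 := by
  rw [truncSum_apply]
  exact Finset.sum_eq_zero fun k hk => X_pow_dvd_iff.1 h k (Finset.mem_range.1 hk)

/-- Polynomials modulo `X ^ (N + 1)`. -/
abbrev TruncPoly (S : Type u) [CommRing S] (N : ℕ) : Type u :=
  S[X] ⧸ Ideal.span {(X : S[X]) ^ (N + 1)}

/-- `truncSum`, factored through the truncated polynomials. -/
noncomputable def quotSum (N : ℕ) : TruncPoly S N →ₗ[S] S :=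
  ((Ideal.span {(X : S[X]) ^ (N + 1)}).restrictScalars S).liftQ (truncSum N) (fun _ hc =>
    truncSum_eq_zero_of_dvd (Ideal.mem_span_singleton.1 hc)) ∘ₗ
      (Submodule.Quotient.restrictScalarsEquiv S _).symm.toLinearMap

theorem quotSum_mk (N : ℕ) (c : S[X]) :
    quotSum N (Ideal.Quotient.mk _ c) = truncSum N c := rfl

variable {M : Type u} [AddCommGroup M] [Module S M]

/-- Apply a linear functional to the coefficients of an element of `A ⊗ M`. -/
noncomputable def coefMap {A : Type u} [CommRing A] [Algebra S A] (φ : A →ₗ[S] S) :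
    A ⊗[S] M →ₗ[S] M :=
  TensorProduct.lid S M ∘ₗ φ.rTensor M

theorem coefMap_tmul {A : Type u} [CommRing A] [Algebra S A] (φ : A →ₗ[S] S) (c : A) (m : M) :
    coefMap φ (c ⊗ₜ m) = φ c • m := by
  simp [coefMap]

theorem eventually_coefMap_truncSum (z : S[X] ⊗[S] M) : ∀ᶠ N in Filter.atTop,
    coefMap (truncSum N) z = coefMap (leval 1) z := by
  induction z with
  | zero => simp
  | tmul c m =>
    filter_upwards [Filter.eventually_ge_atTop c.natDegree] with N hN
    rw [coefMap_tmul, coefMap_tmul, truncSum_eq_eval hN, leval_apply]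
  | add z w hz hw =>
    filter_upwards [hz, hw] with N hz hw
    rw [map_add, map_add, hz, hw]

theorem isTruncated_of_weight_eq {r : ContractionRule d K Ξ O S[X]}
    (hr : ∀ ℓ, r.weight ℓ = X ^ ℓ.size) : r.IsTruncated (TruncPoly S r.box) where
  weight_add a b := by simp only [hr, MIdx.size_add, pow_add]
  algebraMap_weight a ha := by
    rw [hr]
    exact Ideal.Quotient.eq_zero_iff_mem.2
      (Ideal.mem_span_singleton.2 (pow_dvd_pow _ (MIdx.lt_size_of_notMem ha)))

theorem coefMap_truncSum_contract_cut {r : ContractionRule d K Ξ O S[X]}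
    (hr : ∀ ℓ, r.weight ℓ = X ^ ℓ.size) (t : PTree d K Ξ O true)
    (f : MIdx d → Branches d K Ξ O false → PTree d K Ξ O true → S[X] ⊗[S] M) :
    coefMap (truncSum r.box) (wsum (r.contractTree t) fun h => ((r.admissibleCuts h).map fun s =>
        s.coef • f s.red (ofLimbs s.pruned) s.trunk).sum) =
      coefMap (truncSum r.box) ((r.admissibleCuts t).map fun s =>
        s.coef • wsum (r.contract (ofLimbs s.pruned)) fun κ =>
          wsum (r.contractTree s.trunk) fun h => f s.red κ h).sum := by
  let φ : S[X] ⊗[S] M →ₗ[S[X]] TruncPoly S r.box ⊗[S] M :=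
    TensorProduct.AlgebraTensorModule.map (Submodule.mkQ _) LinearMap.id
  have coefMap_eq (z : S[X] ⊗[S] M) :
      coefMap (truncSum r.box) z = coefMap (quotSum r.box) (φ z) := by
    induction z with
    | zero => simp
    | tmul c m =>
      rw [coefMap_tmul, TensorProduct.AlgebraTensorModule.map_tmul, coefMap_tmul,
        LinearMap.id_apply]
      exact congrArg (· • m) (quotSum_mk r.box c).symm
    | add z w hz hw => rw [map_add, map_add, map_add, hz, hw]
  have key := r.wsum_contractTree_admissibleCuts (isTruncated_of_weight_eq hr) t
    fun a κ h => φ (f a κ h)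
  simpa only [coefMap_eq, map_wsum, map_multiset_sum, Multiset.map_map, Function.comp_def,
    map_smul] using congrArg (coefMap (quotSum r.box)) key

end Truncation

/-! ## The coactions -/

section Box

open Polynomial

variable {β : K → ℝ} {α : Ξ → ℝ} {R : Type u} [CommRing R]

theorem size_add_absSize_le_bound {b : Bool} (t : PTree d K Ξ ℝ b) :
    t.dec.size + t.br.absSize β α ≤ t.bound β α := by
  refine le_trans ?_ (Nat.le_ceil _)
  linarith [abs_nonneg t.exdec]

theorem absSize_le_bound {b : Bool} (t : PTree d K Ξ ℝ b) : t.br.absSize β α ≤ t.bound β α :=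
  le_of_add_le_of_nonneg_right (size_add_absSize_le_bound t) (Nat.cast_nonneg _)

theorem subtreeWeight_polyRule_eq_zero {N : ℕ} (σ : PTree d K Ξ ℝ true)
    (h : 0 ≤ σ.degBy β α fun _ => 0) : (polyRule β α R N).subtreeWeight σ = 0 := by
  rw [← reg_forget] at h
  simp only [polyRule, projNeg, dif_neg h.not_gt, map_zero]

variable {M : Type*} [AddCommGroup M] [Module (SMinus d β α R)[X] M] {N : ℕ}

theorem wsum_contractTree_polyRule {t : PTree d K Ξ ℝ true} (hN : t.bound β α ≤ N)
    (f : PTree d K Ξ ℝ true → M) :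
    wsum ((polyRule β α R N).contractTree t) f =
      wsum ((polyRule β α R (t.bound β α)).contractTree t) f :=
  ((polyRule β α R N).extendsBy_contractTree subtreeWeight_polyRule_eq_zero hN t
    (absSize_le_bound t)).sum_map_eq fun q _ hq => by rw [hq, zero_smul]

theorem wsum_contract_polyRule {b : Bool} {t : PTree d K Ξ ℝ b} (hN : t.bound β α ≤ N)
    (f : Branches d K Ξ ℝ b → M) :
    wsum ((polyRule β α R N).contract t.br) f =
      wsum ((polyRule β α R (t.bound β α)).contract t.br) f :=
  ((polyRule β α R N).extendsBy_contract_and_extract subtreeWeight_polyRule_eq_zero hN t.br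
    (absSize_le_bound t)).1.sum_map_eq fun q _ hq => by rw [hq, zero_smul]

theorem sum_admissibleCuts_polyRule {t : PTree d K Ξ ℝ true} (hN : t.bound β α ≤ N)
    {F : TreeCut (SMinus d β α R)[X] d K Ξ ℝ true → M}
    (hF : ∀ s, (⟨s.red, 0, ofLimbs s.pruned⟩ : PTree d K Ξ ℝ false).degPlus β α < 0 → F s = 0) :
    (((polyRule β α R N).admissibleCuts t).map fun s => s.coef • F s).sum =
      (((polyRule β α R (t.bound β α)).admissibleCuts t).map fun s => s.coef • F s).sum := by
  refine (extendsBy_closeVertex (β := β) (α := α) (x := id) t.dec t.exdec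
    ((polyRule β α R N).extendsBy_cutsWith_pureTree hN true t.br)).sum_map_eq fun s hs hneg => ?_
  obtain hcoef | hdeg := hneg
  · rw [hcoef, zero_smul]
  · rw [hF s (degPlus_neg_of_isNegligible _ β α (size_add_absSize_le_bound t) hs hdeg), smul_zero]

theorem degPlus_eq_of_mem_contract_polyRule {B : ℕ} {n : MIdx d} {o : ℝ} {b : Bool}
    {br : Branches d K Ξ ℝ b} {q : (SMinus d β α R)[X] × Branches d K Ξ ℝ b}
    (hq : q ∈ (polyRule β α R B).contract br) :
    (⟨n, o, q.2⟩ : PTree d K Ξ ℝ b).degPlus β α = (⟨n, o, br⟩ : PTree d K Ξ ℝ b).degPlus β α := by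
  simp only [PTree.degPlus]
  congr 1
  refine (deg_contract_extract β α R B br).1 (q.1.eval 1, q.2) ?_
  rw [(contract_and_extract_eq_map_polyRule β α R B br).1]
  exact Multiset.mem_map_of_mem (fun q : (SMinus d β α R)[X] × Branches d K Ξ ℝ b =>
    (evalRingHom 1 q.1, q.2)) hq

end Box

section Coactions

open Polynomial

variable (β : K → ℝ) (α : Ξ → ℝ) (R : Type u) [CommRing R]

section Composites

variable {M : Type u} [AddCommGroup M] [Module (SMinus d β α R)[X] M]

/-- The terms of `Δ⁺_ex` after `Δ⁻_ex` with polynomial weights, where the box used for a tree is a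
function of the tree. -/
noncomputable def contractThenCut (B : ∀ {b : Bool}, PTree d K Ξ ℝ b → ℕ)
    (f : MIdx d → Branches d K Ξ ℝ false → PTree d K Ξ ℝ true → M) (t : PTree d K Ξ ℝ true) : M :=
  wsum ((polyRule β α R (B t)).contractTree t) fun h =>
    (((polyRule β α R (B h)).admissibleCuts h).map fun s =>
      s.coef • f s.red (ofLimbs s.pruned) s.trunk).sum

/-- The terms of `Δ⁻_ex-non-root ⊗ Δ⁻_ex` after `Δ⁺_ex` with polynomial weights, where the box used
for a tree is a function of the tree. -/
noncomputable def cutThenContract (B : ∀ {b : Bool}, PTree d K Ξ ℝ b → ℕ)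
    (f : MIdx d → Branches d K Ξ ℝ false → PTree d K Ξ ℝ true → M) (t : PTree d K Ξ ℝ true) : M :=
  (((polyRule β α R (B t)).admissibleCuts t).map fun s => s.coef •
    wsum ((polyRule β α R (B (⟨s.red, 0, ofLimbs s.pruned⟩ : PTree d K Ξ ℝ false))).contract
      (ofLimbs s.pruned)) fun κ =>
        wsum ((polyRule β α R (B s.trunk)).contractTree s.trunk) fun h => f s.red κ h).sum

variable {f : MIdx d → Branches d K Ξ ℝ false → PTree d K Ξ ℝ true → M}
  (hf : ∀ n κ τ, (⟨n, 0, κ⟩ : PTree d K Ξ ℝ false).degPlus β α < 0 → f n κ τ = 0)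

theorem eventually_forall_le {A : Type*} (T : Multiset A) (B : A → ℕ) :
    ∀ᶠ N in Filter.atTop, ∀ a ∈ T, B a ≤ N :=
  (Filter.eventually_all_finite (Multiset.finite_toSet T)).2 fun a _ =>
    Filter.eventually_ge_atTop (B a)

include hf

theorem eventually_contractThenCut (t : PTree d K Ξ ℝ true) : ∀ᶠ N in Filter.atTop,
    contractThenCut β α R (fun _ => N) f t = contractThenCut β α R (PTree.bound β α) f t := by
  filter_upwards [Filter.eventually_ge_atTop (t.bound β α), eventually_forall_le
    ((polyRule β α R (t.bound β α)).contractTree t) fun h => h.2.bound β α] with N ht hN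
  rw [contractThenCut, wsum_contractTree_polyRule ht]
  refine congrArg Multiset.sum (Multiset.map_congr rfl fun h hh => congrArg (h.1 • ·) ?_)
  exact sum_admissibleCuts_polyRule (hN h hh) fun s hs => hf _ _ _ hs

theorem eventually_cutThenContract (t : PTree d K Ξ ℝ true) : ∀ᶠ N in Filter.atTop,
    cutThenContract β α R (fun _ => N) f t = cutThenContract β α R (PTree.bound β α) f t := by
  let cuts := (polyRule β α R (t.bound β α)).admissibleCuts t
  let limbTree (s : TreeCut (SMinus d β α R)[X] d K Ξ ℝ true) : PTree d K Ξ ℝ false :=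
    ⟨s.red, 0, ofLimbs s.pruned⟩
  filter_upwards [Filter.eventually_ge_atTop (t.bound β α),
    eventually_forall_le cuts fun s => (limbTree s).bound β α,
    eventually_forall_le cuts fun s => s.trunk.bound β α] with N ht hLimbs hTrunk
  rw [cutThenContract, sum_admissibleCuts_polyRule ht]
  · refine congrArg Multiset.sum (Multiset.map_congr rfl fun s hs => ?_)
    congr 1
    refine (wsum_contract_polyRule (hLimbs s hs) _).trans (wsum_congr _ fun κ => ?_)
    exact wsum_contractTree_polyRule (hTrunk s hs) _
  · intro s hs
    refine Multiset.sum_eq_zero fun y hy => ?_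
    obtain ⟨q, hq, rfl⟩ := Multiset.mem_map.1 hy
    have hκ (τ : PTree d K Ξ ℝ true) : f s.red q.2 τ = 0 :=
      hf _ _ _ ((degPlus_eq_of_mem_contract_polyRule hq).trans_lt hs)
    simp [wsum, hκ]

end Composites

section Evaluation

variable {S : Type u} [CommRing S] {M : Type u} [AddCommGroup M] [Module S M]

theorem coefMap_leval_smul (c : S[X]) (z : S[X] ⊗[S] M) :
    coefMap (leval 1) (c • z) = c.eval 1 • coefMap (leval 1) z := by
  induction z with
  | zero => simp
  | tmul a m =>
    rw [TensorProduct.smul_tmul', coefMap_tmul, coefMap_tmul, leval_apply, leval_apply,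
      smul_eq_mul, eval_mul, mul_smul]
  | add z w hz hw => rw [smul_add, map_add, map_add, smul_add, hz, hw]

theorem coefMap_leval_wsum {A : Type*} (T : Multiset (S[X] × A)) (f : A → S[X] ⊗[S] M) :
    coefMap (leval 1) (wsum T f) =
      wsum (mapWeight (evalRingHom 1) T) fun a => coefMap (leval 1) (f a) := by
  simp [wsum, mapWeight, map_multiset_sum, coefMap_leval_smul]

end Evaluation

section Cuts

theorem map_admissibleCuts_polyRule (B : ℕ) (t : PTree d K Ξ ℝ true) :
    ((polyRule β α R B).admissibleCuts t).map (TreeCut.mapCoef (evalRingHom 1)) =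
      (closeVertex t.dec t.exdec (cuts B true t.br)).map
        (TreeCut.mapCoef (Nat.castRingHom (SMinus d β α R))) := by
  rw [ContractionRule.admissibleCuts, map_closeVertex, map_closeVertex,
    ContractionRule.map_cutsWith_pureTree _ (eval_weight_polyRule β α R B)]
  rfl

theorem sum_cuts_eq_sum_admissibleCuts {M : Type*} [AddCommMonoid M] [Module (SMinus d β α R) M]
    (B : ℕ) (t : PTree d K Ξ ℝ true)
    (f : MIdx d → List (Limb d K Ξ ℝ) → PTree d K Ξ ℝ true → M) :
    ((closeVertex t.dec t.exdec (cuts B true t.br)).map fun s =>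
        (s.coef : SMinus d β α R) • f s.red s.pruned s.trunk).sum =
      (((polyRule β α R B).admissibleCuts t).map fun s =>
        s.coef.eval 1 • f s.red s.pruned s.trunk).sum := by
  have h := congrArg (fun T => (T.map fun s => s.coef • f s.red s.pruned s.trunk).sum)
    (map_admissibleCuts_polyRule β α R B t)
  simpa only [Multiset.map_map, Function.comp_def, TreeCut.mapCoef, eq_natCast,
    coe_evalRingHom] using h.symm

end Cuts

theorem deltaPlusEx_single (t : PTree d K Ξ ℝ true) :
    deltaPlusEx (d := d) β α R (Finsupp.single t 1) =
      ((closeVertex t.dec t.exdec (cuts (t.bound β α) true t.br)).map fun s => (s.coef : R) •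
        (projPos β α R ⟨s.red, 0, ofLimbs s.pruned⟩ ⊗ₜ[R] Finsupp.single s.trunk 1)).sum := by
  rw [deltaPlusEx, Finsupp.linearCombination_single, one_smul]

theorem deltaMinusEx_single (t : PTree d K Ξ ℝ true) :
    deltaMinusEx β α R (Finsupp.single t 1) =
      wsum (mapWeight (evalRingHom 1) ((polyRule β α R (t.bound β α)).contractTree t)) fun h =>
        1 ⊗ₜ[R] Finsupp.single h (1 : R) := by
  rw [deltaMinusEx, Finsupp.linearCombination_single, one_smul, contractVertex_eq_map_contractTree]
  simp only [wsum, TensorProduct.smul_tmul', smul_eq_mul, mul_one]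

theorem projPos_eq_zero {t : PTree d K Ξ ℝ false} (h : t.degPlus β α < 0) :
    projPos β α R t = 0 := by
  rw [projPos, dif_neg]
  rintro (hpos | rfl)
  · exact h.not_gt hpos
  · simp [PTree.degPlus, PTree.one, MIdx.size_zero, Branches.deg] at h

theorem eq_nil_of_nil_mem_contract {B : ℕ} {br : Branches d K Ξ ℝ false} {c : SMinus d β α R}
    (h : (c, .nil) ∈ contract β α R B br) : br = .nil := by
  cases br with
  | nil => rfl
  | kernel k e n o above rest =>
    simp only [contract, Multiset.mem_bind, Multiset.mem_map] at h
    obtain ⟨_, _, _, _, h⟩ := h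
    cases h

theorem isPos_contract_iff {B : ℕ} {t : PTree d K Ξ ℝ false}
    {q : SMinus d β α R × Branches d K Ξ ℝ false} (hq : q ∈ contract β α R B t.br) :
    (⟨t.dec, t.exdec, q.2⟩ : PTree d K Ξ ℝ false).IsPos β α ↔ t.IsPos β α := by
  refine ⟨?_, fun h => isPos_of_mem_contract β α R B ⟨t, h⟩ q hq⟩
  obtain ⟨n, o, br⟩ := t
  obtain ⟨c, κ⟩ := q
  rintro (hpos | hone)
  · left
    rwa [PTree.degPlus, (deg_contract_extract β α R B br).1 _ hq] at hpos
  · right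
    obtain ⟨rfl, rfl, rfl⟩ := PTree.mk.injEq .. ▸ hone
    obtain rfl : br = .nil := eq_nil_of_nil_mem_contract β α R hq
    rfl

theorem deltaMinusExNonRoot_projPos (t : PTree d K Ξ ℝ false) :
    deltaMinusExNonRoot β α R (projPos β α R t) =
      wsum (contract β α R (t.bound β α) t.br) fun κ =>
        1 ⊗ₜ[R] projPos β α R ⟨t.dec, t.exdec, κ⟩ := by
  simp only [wsum, TensorProduct.smul_tmul', smul_eq_mul, mul_one]
  by_cases h : t.IsPos β α
  · rw [projPos, dif_pos h, deltaMinusExNonRoot, Finsupp.linearCombination_single, one_smul,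
      ← Multiset.pmap_eq_map (H := isPos_of_mem_contract β α R (t.bound β α) ⟨t, h⟩)]
    refine congrArg Multiset.sum (Multiset.pmap_congr _ fun q _ hpos _ => ?_)
    rw [projPos, dif_pos hpos]
  · rw [projPos, dif_neg h, map_zero]
    refine (Multiset.sum_eq_zero fun y hy => ?_).symm
    obtain ⟨q, hq, rfl⟩ := Multiset.mem_map.1 hy
    rw [projPos, dif_neg (mt (isPos_contract_iff β α R hq).1 h), TensorProduct.tmul_zero]

section M13

variable {R} {S M N : Type*} [CommRing S] [Algebra R S] [AddCommGroup M] [Module R M]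
  [AddCommGroup N] [Module R N]

theorem m13_smul_tmul (c : S) (z : S ⊗[R] M) (w : S ⊗[R] N) :
    m13 R S M N ((c • z) ⊗ₜ w) = c • m13 R S M N (z ⊗ₜ w) := by
  induction z with
  | zero => simp
  | add z z' hz hz' => simp only [smul_add, TensorProduct.add_tmul, map_add, hz, hz']
  | tmul a y =>
    induction w with
    | zero => simp
    | add w w' hw hw' => simp only [smul_add, TensorProduct.tmul_add, map_add, hw, hw']
    | tmul b y' => simp [m13, TensorProduct.smul_tmul', mul_assoc]

theorem m13_tmul_smul (c : S) (z : S ⊗[R] M) (w : S ⊗[R] N) :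
    m13 R S M N (z ⊗ₜ (c • w)) = c • m13 R S M N (z ⊗ₜ w) := by
  induction z with
  | zero => simp
  | add z z' hz hz' => simp only [smul_add, TensorProduct.add_tmul, map_add, hz, hz']
  | tmul a y =>
    induction w with
    | zero => simp
    | add w w' hw hw' => simp only [smul_add, TensorProduct.tmul_add, map_add, hw, hw']
    | tmul b y' => simp [m13, TensorProduct.smul_tmul', mul_left_comm]

theorem m13_wsum_tmul_wsum {A A' : Type*} (T : Multiset (S × A)) (T' : Multiset (S × A'))
    (f : A → M) (g : A' → N) :
    m13 R S M N ((wsum T fun a => 1 ⊗ₜ f a) ⊗ₜ (wsum T' fun a => 1 ⊗ₜ g a)) =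
      wsum T fun a => wsum T' fun a' => 1 ⊗ₜ (f a ⊗ₜ g a') := by
  let ψ : S ⊗[R] M →ₗ[S] S ⊗[R] N →ₗ[S] S ⊗[R] (M ⊗[R] N) :=
    .mk₂ S (fun z w => m13 R S M N (z ⊗ₜ w))
      (fun z z' w => by rw [TensorProduct.add_tmul, map_add]) m13_smul_tmul
      (fun z w w' => by rw [TensorProduct.tmul_add, map_add]) m13_tmul_smul
  refine (map_wsum T (ψ.flip _) _).trans (wsum_congr T fun a => ?_)
  refine (map_wsum T' (ψ _) _).trans (wsum_congr T' fun a' => ?_)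
  simp [ψ, m13]

end M13

/-- The term of the two composite coactions for the given trees, as a constant polynomial. -/
noncomputable def outTerm (n : MIdx d) (κ : Branches d K Ξ ℝ false) (τ : PTree d K Ξ ℝ true) :
    (SMinus d β α R)[X] ⊗[SMinus d β α R]
      (SMinus d β α R ⊗[R] (TExPlus d β α R ⊗[R] TEx d K Ξ R)) :=
  1 ⊗ₜ (1 ⊗ₜ (projPos β α R ⟨n, 0, κ⟩ ⊗ₜ Finsupp.single τ 1))

theorem outTerm_eq_zero (n : MIdx d) (κ : Branches d K Ξ ℝ false) (τ : PTree d K Ξ ℝ true)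
    (h : (⟨n, 0, κ⟩ : PTree d K Ξ ℝ false).degPlus β α < 0) : outTerm β α R n κ τ = 0 := by
  simp [outTerm, projPos_eq_zero β α R h]

theorem coefMap_leval_outTerm (n : MIdx d) (κ : Branches d K Ξ ℝ false) (τ : PTree d K Ξ ℝ true) :
    coefMap (leval 1) (outTerm β α R n κ τ) =
      1 ⊗ₜ (projPos β α R ⟨n, 0, κ⟩ ⊗ₜ Finsupp.single τ 1) := by
  simp [outTerm, coefMap_tmul]

theorem lTensor_deltaPlusEx_deltaMinusEx (t : PTree d K Ξ ℝ true) :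
    (deltaPlusEx (d := d) β α R).lTensor (SMinus d β α R)
        (deltaMinusEx β α R (Finsupp.single t 1)) =
      coefMap (leval 1) (contractThenCut β α R (PTree.bound β α) (outTerm β α R) t) := by
  rw [contractThenCut, coefMap_leval_wsum, deltaMinusEx_single, ← LinearMap.baseChange_eq_ltensor]
  refine (map_wsum _ _ _).trans (wsum_congr _ fun h => ?_)
  simp only [map_multiset_sum, Multiset.map_map, Function.comp_def, coefMap_leval_smul,
    coefMap_leval_outTerm]
  rw [LinearMap.baseChange_tmul, deltaPlusEx_single, ← sum_cuts_eq_sum_admissibleCuts β α R _ h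
    fun n l τ => 1 ⊗ₜ (projPos β α R ⟨n, 0, ofLimbs l⟩ ⊗ₜ Finsupp.single τ 1),
    ← TensorProduct.mk_apply, map_multiset_sum, Multiset.map_map]
  simp only [Function.comp_def, Nat.cast_smul_eq_nsmul, TensorProduct.mk_apply,
    TensorProduct.tmul_smul]

theorem m13_deltaMinusEx_deltaPlusEx (t : PTree d K Ξ ℝ true) :
    m13 R (SMinus d β α R) (TExPlus d β α R) (TEx d K Ξ R)
        (TensorProduct.map (deltaMinusExNonRoot β α R) (deltaMinusEx β α R)
          (deltaPlusEx β α R (Finsupp.single t 1))) =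
      coefMap (leval 1) (cutThenContract β α R (PTree.bound β α) (outTerm β α R) t) := by
  rw [cutThenContract, deltaPlusEx_single]
  simp only [map_multiset_sum, Multiset.map_map, Function.comp_def, coefMap_leval_smul,
    coefMap_leval_wsum, coefMap_leval_outTerm, map_smul, TensorProduct.map_tmul,
    deltaMinusExNonRoot_projPos, deltaMinusEx_single, m13_wsum_tmul_wsum,
    ← (contract_and_extract_eq_map_polyRule β α R _ _).1]
  refine Eq.trans ?_ (sum_cuts_eq_sum_admissibleCuts β α R _ t fun n l τ =>
    wsum (contract β α R (PTree.bound β α (⟨n, 0, ofLimbs l⟩ : PTree d K Ξ ℝ false)) (ofLimbs l))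
      fun κ => wsum (mapWeight (evalRingHom 1)
        ((polyRule β α R (τ.bound β α)).contractTree τ)) fun h =>
          1 ⊗ₜ (projPos β α R ⟨n, 0, κ⟩ ⊗ₜ Finsupp.single h 1))
  simp only [Nat.cast_smul_eq_nsmul]

theorem coefMap_truncSum_contractThenCut (N : ℕ) (t : PTree d K Ξ ℝ true) :
    coefMap (truncSum N) (contractThenCut β α R (fun _ => N) (outTerm β α R) t) =
      coefMap (truncSum N) (cutThenContract β α R (fun _ => N) (outTerm β α R) t) :=
  coefMap_truncSum_contract_cut (r := polyRule β α R N) (fun _ => rfl) t _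

theorem coefMap_leval_contractThenCut (t : PTree d K Ξ ℝ true) :
    coefMap (leval 1) (contractThenCut β α R (PTree.bound β α) (outTerm β α R) t) =
      coefMap (leval 1) (cutThenContract β α R (PTree.bound β α) (outTerm β α R) t) := by
  obtain ⟨N, hContract, hCut, hContractSum, hCutSum⟩ :=
    ((eventually_contractThenCut β α R (f := outTerm β α R) (outTerm_eq_zero β α R) t).and <|
      (eventually_cutThenContract β α R (f := outTerm β α R) (outTerm_eq_zero β α R) t).and <|
      (eventually_coefMap_truncSum
        (contractThenCut β α R (PTree.bound β α) (outTerm β α R) t)).and <|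
      eventually_coefMap_truncSum
        (cutThenContract β α R (PTree.bound β α) (outTerm β α R) t)).exists
  rw [← hContractSum, ← hCutSum, ← hContract, ← hCut, coefMap_truncSum_contractThenCut]

end Coactions

end PlanarRS

theorem mainTheorem4 {d : ℕ} {K Ξ : Type} (β : K → ℝ) (α : Ξ → ℝ) (R : Type*) [CommRing R] :
    (PlanarRS.deltaPlusEx (d := d) β α R).lTensor (PlanarRS.SMinus d β α R) ∘ₗ
        PlanarRS.deltaMinusEx β α R =
      PlanarRS.m13 R (PlanarRS.SMinus d β α R) (PlanarRS.TExPlus d β α R) (PlanarRS.TEx d K Ξ R) ∘ₗ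
        TensorProduct.map (PlanarRS.deltaMinusExNonRoot β α R) (PlanarRS.deltaMinusEx β α R) ∘ₗ
          PlanarRS.deltaPlusEx β α R := by
  refine Finsupp.lhom_ext' fun t => LinearMap.ext_ring ?_
  simp only [LinearMap.comp_apply, Finsupp.lsingle_apply]
  rw [PlanarRS.lTensor_deltaPlusEx_deltaMinusEx, PlanarRS.m13_deltaMinusEx_deltaPlusEx,
    PlanarRS.coefMap_leval_contractThenCut]
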